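/- **Setting.** Let $\mathcal A$ be a finite set of linear hyperplanes in a finite-dimensional real vector space $V$ of dimension $d$ with $\bigcap_{H\in\mathcal A}H=\{0\}$ (a central, essential arrangement). Its intersection subspaces are the intersections of subsets of $\mathcal A$ (including $V$); $L_k$ is the set of those of codimension $k$. For an intersection subspace $X$, the localized arrangement is $\mathcal A_X=\{H/X : H\in\mathcal A,\ H\supseteq X\}$ in $V/X$. A modular coatom is an intersection subspace $\ell$ of dimension $1$ such that for all distinct $H,H'\in\mathcal A$ not containing $\ell$ some $H''\in\mathcal A$ contains both $\ell$ and $H\cap H'$. The arrangement is supersolvable if $d=1$, or if it has a modular coatom $\ell$ with $\mathcal A_\ell$ supersolvable. A modular flag is a chain $\{0\}=X_0\subset X_1\subset\cdots\subset X_d=V$ of intersection subspaces with $\dim X_i=i$ such that $X_i/X_{i-1}$ is a modular coatom of $\mathcal A_{X_{i-1}}$ for $1\le i\le d$. Chambers are the connected components of $V\setminus\bigcup_{H\in\mathcal A}H$; a chamber $c$ is incident to the flag if, for every $i$, the cone $\overline c\cap X_i$ has dimension $i$. The graph $G_1$ has the chambers as vertices, two chambers being adjacent when exactly one hyperplane of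 $\mathcal A$ separates them. For a chamber $c_0$, the graph $G_2$ has as vertices the minimal galleries (geodesics of $G_1$) from $c_0$ to $-c_0$; a subspace $X\in L_2$ separates two galleries $r,r'$ if the galleries $r/X$ and $r'/X$ that they induce in $\mathcal A_X$ differ, and $r,r'$ are adjacent in $G_2$ when exactly one $X\in L_2$ separates them. For a finite Coxeter group $W$ with Coxeter generators $S$ and longest element $w_0$, let $G(w_0)$ be the graph whose vertices are the reduced words of $w_0$, two words being adjacent when they differ by one braid move, i.e. by replacing a consecutive subword $sts\cdots$ of length $m$ by $tst\cdots$ of length $m$, where $s\ne t$ in $S$ and $m$ is the order of $st$. **Theorem.** If $\mathcal A$ is supersolvable and the base chamber $c_0$ is incident to a modular flag of $\mathcal A$, then $G_2$ has diameter exactly $|L_2|$. Moreover, in each of the following types there is a unique longest element $w_0$, and the diameter of $G(w_0)$ equals $|L_2|$ for the corresponding reflection arrangement, with the following values: * type $A_{n-1}$, $n\ge1$ (the symmetric group $\mathfrak S_n$ generated by the adjacent transpositions; hyperplanes $x_i=x_j$ in $\mathbb R^n/\{x_1=\cdots=x_n\}$): $\frac1{24}n(n-1)(n-2)(3n-5)$;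 * type $B_n$, $n\ge1$ (the group of signed permutations of the coordinates of $\mathbb R^n$, generated by the sign change of $x_1$ and the transpositions of adjacent coordinates; hyperplanes $x_i=\pm x_j$ and $x_i=0$ in $\mathbb R^n$): $\frac16n(n-1)(3n^2-5n+1)$; * type $I_2(m)$, $m\ge2$ (the dihedral group of order $2m$, generated by two reflections whose product is a rotation by $2\pi/m$; the $m$ lines at angles $k\pi/m$ in the plane): $1$. -/

import Mathlib

namespace HyperplaneArrangement

section Basic

variable {V : Type*} [AddCommGroup V] [Module ℝ V]

/-- `A` is a finite set of linear hyperplanes of `V` whose common intersection is `{0}`, that is,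
a central and essential real hyperplane arrangement. -/
structure IsEssentialArrangement (A : Set (Submodule ℝ V)) : Prop where
  finite : A.Finite
  hyperplane : ∀ H ∈ A, Module.finrank ℝ (V ⧸ H) = 1
  essential : sInf A = ⊥

/-- The intersection subspaces of `A`, including the empty intersection `V`. -/
def intersections (A : Set (Submodule ℝ V)) : Set (Submodule ℝ V) :=
  {X | ∃ S ⊆ A, X = sInf S}

/-- `flats A k` is `L_k`, the set of intersection subspaces of codimension `k`. -/
def flats (A : Set (Submodule ℝ V)) (k : ℕ) : Set (Submodule ℝ V) :=
  {X | X ∈ intersections A ∧ Module.finrank ℝ (V ⧸ X) = k}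

/-- The localized arrangement `A_X = {H / X : H ∈ A, X ⊆ H}` in `V / X`. -/
def localization (A : Set (Submodule ℝ V)) (X : Submodule ℝ V) : Set (Submodule ℝ (V ⧸ X)) :=
  {K | ∃ H ∈ A, X ≤ H ∧ K = H.map X.mkQ}

/-- A modular coatom: a line `ℓ` which is an intersection of hyperplanes of `A`, such that for any
two distinct hyperplanes `H`, `H'` of `A` not containing `ℓ` there is a hyperplane of `A` containing
both `ℓ` and `H ∩ H'`. -/
structure IsModularCoatom (A : Set (Submodule ℝ V)) (ℓ : Submodule ℝ V) : Prop where
  mem : ℓ ∈ intersections A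
  line : Module.finrank ℝ ℓ = 1
  modular : ∀ H ∈ A, ∀ H' ∈ A, H ≠ H' → ¬ ℓ ≤ H → ¬ ℓ ≤ H' →
    ∃ H'' ∈ A, ℓ ≤ H'' ∧ H ⊓ H' ≤ H''

/-- A modular flag `{0} = X 0 ⊂ X 1 ⊂ ⋯ ⊂ X d = V`: a chain of intersection subspaces with
`dim (X i) = i`, such that each `X (i + 1) / X i` is a modular coatom of the localized arrangement
`A_{X i}`. -/
structure IsModularFlag (A : Set (Submodule ℝ V))
    (X : Fin (Module.finrank ℝ V + 1) → Submodule ℝ V) : Prop where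
  mem : ∀ i, X i ∈ intersections A
  mono : StrictMono X
  dim : ∀ i, Module.finrank ℝ (X i) = (i : ℕ)
  modular : ∀ i : Fin (Module.finrank ℝ V),
    IsModularCoatom (localization A (X i.castSucc)) ((X i.succ).map (X i.castSucc).mkQ)

end Basic

/-- Supersolvability of an essential arrangement: either the rank is one, or there is a modular
coatom whose localized arrangement is supersolvable. -/
inductive IsSupersolvable.{u} : ∀ {V : Type u} [AddCommGroup V] [Module ℝ V],
    Set (Submodule ℝ V) → Prop
  | rank_one {V : Type u} [AddCommGroup V] [Module ℝ V] (A : Set (Submodule ℝ V))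
      (h : Module.finrank ℝ V = 1) : IsSupersolvable A
  | step {V : Type u} [AddCommGroup V] [Module ℝ V] (A : Set (Submodule ℝ V))
      (ℓ : Submodule ℝ V) (hl : IsModularCoatom A ℓ) (h : IsSupersolvable (localization A ℓ)) :
      IsSupersolvable A

section Chambers

variable {V : Type*} [AddCommGroup V] [Module ℝ V] [TopologicalSpace V]

/-- The complement of the union of the hyperplanes of `A`. -/
def complement (A : Set (Submodule ℝ V)) : Set V := {x | ∀ H ∈ A, x ∉ H}

/-- A chamber of `A`: a connected component of the complement. -/
def IsChamber (A : Set (Submodule ℝ V)) (c : Set V) : Prop :=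
  ∃ x ∈ complement A, c = connectedComponentIn (complement A) x

/-- The type of chambers of `A`. -/
abbrev Chamber (A : Set (Submodule ℝ V)) : Type _ := {c : Set V // IsChamber A c}

theorem Chamber.nonempty {A : Set (Submodule ℝ V)} (c : Chamber A) : c.1.Nonempty := by
  obtain ⟨c, x, hx, rfl⟩ := c
  exact ⟨x, mem_connectedComponentIn hx⟩

theorem Chamber.subset {A : Set (Submodule ℝ V)} (c : Chamber A) : c.1 ⊆ complement A := by
  obtain ⟨c, x, hx, rfl⟩ := c
  exact connectedComponentIn_subset _ _

/-- The hyperplane `H` separates `c` from `c'`: they lie strictly on opposite sides of `H`. -/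
def Separates (H : Submodule ℝ V) (c c' : Set V) : Prop :=
  ∃ f : Module.Dual ℝ V, LinearMap.ker f = H ∧ (∀ x ∈ c, 0 < f x) ∧ ∀ x ∈ c', f x < 0

theorem Separates.symm {H : Submodule ℝ V} {c c' : Set V} (h : Separates H c c') :
    Separates H c' c := by
  obtain ⟨f, hf, h1, h2⟩ := h
  refine ⟨-f, ?_, fun x hx => ?_, fun x hx => ?_⟩
  · rw [← hf]; ext x; simp
  · simpa using h2 x hx
  · simpa using h1 x hx

/-- The separation set `L_1(c, c')`. -/
def sepHyperplanes (A : Set (Submodule ℝ V)) (c c' : Chamber A) : Set (Submodule ℝ V) :=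
  {H | H ∈ A ∧ Separates H c.1 c'.1}

theorem sepHyperplanes_comm (A : Set (Submodule ℝ V)) (c c' : Chamber A) :
    sepHyperplanes A c c' = sepHyperplanes A c' c := by
  ext H
  exact ⟨fun h => ⟨h.1, h.2.symm⟩, fun h => ⟨h.1, h.2.symm⟩⟩

theorem sepHyperplanes_self (A : Set (Submodule ℝ V)) (c : Chamber A) :
    sepHyperplanes A c c = ∅ := by
  ext H
  simp only [Set.mem_empty_iff_false, iff_false]
  rintro ⟨-, f, -, h1, h2⟩
  obtain ⟨x, hx⟩ := c.nonempty
  exact lt_asymm (h1 x hx) (h2 x hx)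

/-- The graph `G_1` on the chambers: two chambers are adjacent when exactly one hyperplane
separates them. -/
def chamberGraph (A : Set (Submodule ℝ V)) : SimpleGraph (Chamber A) where
  Adj c c' := (sepHyperplanes A c c').encard = 1
  symm := ⟨fun c c' h => by rwa [sepHyperplanes_comm]⟩
  loopless := ⟨fun c h => by simp [sepHyperplanes_self] at h⟩

/-- The chamber `c` is incident to the subspace `X`: the cone `closure c ∩ X` has the same dimension
as `X`, where the dimension of a cone is that of its linear span. -/
def Chamber.IsIncident {A : Set (Submodule ℝ V)} (c : Chamber A) (X : Submodule ℝ V) : Prop :=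
  Module.finrank ℝ (Submodule.span ℝ (closure c.1 ∩ (X : Set V))) = Module.finrank ℝ X

theorem mk_mem_complement {A : Set (Submodule ℝ V)} (X : Submodule ℝ V) {x : V}
    (hx : x ∈ complement A) : X.mkQ x ∈ complement (localization A X) := by
  rintro K ⟨H, hH, hXH, rfl⟩ hK
  obtain ⟨y, hy, hyx⟩ := hK
  have hs : y - x ∈ X := by
    have := (Submodule.Quotient.eq X).1 hyx
    exact this
  have hxH : x ∈ H := by
    have := H.sub_mem hy (hXH hs)
    simpa using this
  exact hx H hH hxH

/-- The chamber `c / X` of `A_X`, namely the one containing the cosets of `X` represented by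
points of `c` (see `Chamber.mkQ_image_subset`). -/
noncomputable def Chamber.proj {A : Set (Submodule ℝ V)} (X : Submodule ℝ V) (c : Chamber A) :
    Chamber (localization A X) :=
  ⟨connectedComponentIn (complement (localization A X)) (X.mkQ c.nonempty.some),
    X.mkQ c.nonempty.some, mk_mem_complement X (c.subset c.nonempty.some_mem), rfl⟩

theorem Chamber.mkQ_image_subset {A : Set (Submodule ℝ V)} (X : Submodule ℝ V) (c : Chamber A) :
    X.mkQ '' c.1 ⊆ (c.proj X).1 := by
  have hpre : IsPreconnected c.1 := by
    obtain ⟨c, x, hx, rfl⟩ := c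
    exact isPreconnected_connectedComponentIn
  have hcont : Continuous X.mkQ := continuous_quot_mk
  refine (hpre.image _ hcont.continuousOn).subset_connectedComponentIn
    ⟨_, c.nonempty.some_mem, rfl⟩ ?_
  rintro _ ⟨x, hx, rfl⟩
  exact mk_mem_complement X (c.subset hx)

section Galleries

variable [IsTopologicalAddGroup V]

theorem neg_complement (A : Set (Submodule ℝ V)) :
    (Homeomorph.neg V) '' complement A = complement A := by
  ext x
  simp only [Set.mem_image, Homeomorph.coe_neg, complement, Set.mem_ofPred_eq]
  constructor
  · rintro ⟨y, hy, rfl⟩ H hH hx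
    exact hy H hH (by simpa using hx)
  · intro hx
    exact ⟨-x, fun H hH h => hx H hH (by simpa using h), by simp⟩

/-- The antipodal chamber `-c = {-x : x ∈ c}`. -/
def Chamber.neg {A : Set (Submodule ℝ V)} (c : Chamber A) : Chamber A :=
  ⟨(fun x => -x) '' c.1, by
    obtain ⟨c, x, hx, rfl⟩ := c
    refine ⟨-x, fun H hH h => hx H hH (by simpa using h), ?_⟩
    have h := (Homeomorph.neg V).image_connectedComponentIn hx
    rw [neg_complement] at h
    exact h⟩

/-- The set `R` of minimal galleries from `c₀` to `-c₀`: the geodesics of `G_1` between them. -/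
abbrev Gallery (A : Set (Submodule ℝ V)) (c₀ : Chamber A) : Type _ :=
  {r : (chamberGraph A).Walk c₀ c₀.neg // r.length = (chamberGraph A).dist c₀ c₀.neg}

open Classical in
/-- The gallery `r / X` induced by `r` in the localized arrangement `A_X`, as the sequence of
chambers it visits: the chambers `c / X` for `c` visited by `r`, with consecutive repetitions
removed. -/
noncomputable def Gallery.proj {A : Set (Submodule ℝ V)} {c₀ : Chamber A} (r : Gallery A c₀)
    (X : Submodule ℝ V) : List (Chamber (localization A X)) :=
  (r.1.support.map (Chamber.proj X)).destutter (· ≠ ·)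

/-- The separation set `L_2(r, r')`: the codimension-two intersection subspaces `X` with
`r / X ≠ r' / X`. -/
def sepFlats (A : Set (Submodule ℝ V)) (c₀ : Chamber A) (r r' : Gallery A c₀) :
    Set (Submodule ℝ V) :=
  {X | X ∈ flats A 2 ∧ r.proj X ≠ r'.proj X}

/-- The graph `G_2` on the minimal galleries from `c₀` to `-c₀`: two galleries are adjacent when
exactly one codimension-two intersection subspace separates them. -/
def galleryGraph (A : Set (Submodule ℝ V)) (c₀ : Chamber A) : SimpleGraph (Gallery A c₀) where
  Adj r r' := (sepFlats A c₀ r r').encard = 1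
  symm := ⟨fun r r' h => by
    have : sepFlats A c₀ r' r = sepFlats A c₀ r r' := by
      ext X; simp [sepFlats, ne_comm]
    rwa [this]⟩
  loopless := ⟨fun r h => by simp [sepFlats] at h⟩

end Galleries

end Chambers

section ReflectionArrangements

/-- The hyperplane `a x_i + b x_j = 0` of `ℝ^n`. -/
def coordKer {n : ℕ} (a : ℝ) (i : Fin n) (b : ℝ) (j : Fin n) : Submodule ℝ (Fin n → ℝ) :=
  LinearMap.ker (a • LinearMap.proj i + b • LinearMap.proj j : (Fin n → ℝ) →ₗ[ℝ] ℝ)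

/-- The reflection arrangement of type `A_{n-1}`: the hyperplanes `x_i = x_j`, `i < j`, in the
quotient of `ℝ^n` by the subspace `x_1 = ⋯ = x_n`. -/
def arrangementA (n : ℕ) :
    Set (Submodule ℝ ((Fin n → ℝ) ⧸ Submodule.span ℝ {(fun _ => 1 : Fin n → ℝ)})) :=
  localization {H | ∃ i j : Fin n, i < j ∧ H = coordKer 1 i (-1) j} _

/-- The reflection arrangement of type `B_n`: the hyperplanes `x_i = x_j` and `x_i = -x_j`, `i < j`,
and `x_i = 0`, in `ℝ^n`. -/
def arrangementB (n : ℕ) : Set (Submodule ℝ (Fin n → ℝ)) :=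
  {H | ∃ i j : Fin n, i < j ∧ (H = coordKer 1 i (-1) j ∨ H = coordKer 1 i 1 j)} ∪
  {H | ∃ i : Fin n, H = LinearMap.ker (LinearMap.proj i : (Fin n → ℝ) →ₗ[ℝ] ℝ)}

/-- The reflection arrangement of type `I_2(m)`: the `m` lines through the origin of the plane that
make the angles `kπ/m`, `0 ≤ k < m`, with the first axis. -/
noncomputable def arrangementI (m : ℕ) : Set (Submodule ℝ (Fin 2 → ℝ)) :=
  {H | ∃ k < m, H = coordKer (Real.sin (k * Real.pi / m)) 0 (-Real.cos (k * Real.pi / m)) 1}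

end ReflectionArrangements

end HyperplaneArrangement

namespace ReducedWords

section Words

variable {ι G : Type*} [Group G]

/-- The minimal number of factors in an expression of `w` as a product of the `s i` (for `w` in the
group generated by the involutions `s i`). -/
noncomputable def wordLength (s : ι → G) (w : G) : ℕ :=
  sInf {k | ∃ l : List ι, (l.map s).prod = w ∧ l.length = k}

/-- The reduced words (reduced decompositions) of `w`: the words in the generators with product `w`
and the minimal possible length. -/
abbrev ReducedWord (s : ι → G) (w : G) : Type _ :=
  {l : List ι // (l.map s).prod = w ∧ l.length = wordLength s w}

/-- `w` is an element of maximal length in the group generated by the `s i`. -/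
def IsLongest (s : ι → G) (w : G) : Prop :=
  w ∈ Subgroup.closure (Set.range s) ∧
    ∀ v ∈ Subgroup.closure (Set.range s), wordLength s v ≤ wordLength s w

/-- `l'` arises from `l` by a braid move: for some `i ≠ j` with `m` the order of `s i * s j`, a
consecutive subword `⋯ i j i j` of length `m` is replaced by the word `⋯ j i j i` of length `m`. -/
def BraidMove (s : ι → G) (l l' : List ι) : Prop :=
  ∃ (i j : ι) (u v : List ι), i ≠ j ∧
    l = u ++ CoxeterSystem.alternatingWord i j (orderOf (s i * s j)) ++ v ∧
    l' = u ++ CoxeterSystem.alternatingWord j i (orderOf (s i * s j)) ++ v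

/-- The graph `G(w)` of reduced words of `w` under braid moves. -/
def wordGraph (s : ι → G) (w : G) : SimpleGraph (ReducedWord s w) :=
  SimpleGraph.fromRel fun l l' => BraidMove s l.1 l'.1

end Words

/-- The Coxeter generators of the symmetric group (type `A_{n-1}`): adjacent transpositions. -/
def genA (n : ℕ) (i : Fin (n - 1)) : Equiv.Perm (Fin n) :=
  Equiv.swap ⟨i, by omega⟩ ⟨i + 1, by omega⟩

/-- The Coxeter generators of the hyperoctahedral group (type `B_n`) of signed permutations of the
coordinates of `ℝ^n`: the sign change of the first coordinate, and the transpositions of adjacent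
coordinates. -/
def genB (n : ℕ) (i : Fin n) : (Fin n → ℝ) ≃ₗ[ℝ] (Fin n → ℝ) :=
  if (i : ℕ) = 0 then
    LinearEquiv.piCongrRight fun j => if j = i then LinearEquiv.neg ℝ else LinearEquiv.refl ℝ ℝ
  else LinearEquiv.funCongrLeft ℝ ℝ (Equiv.swap ⟨i - 1, by omega⟩ i)

/-- The Coxeter generators of the dihedral group of order `2m` (type `I_2(m)`): two reflections
whose product is the rotation by `2π/m`. -/
def genI (m : ℕ) : Fin 2 → DihedralGroup m :=
  ![DihedralGroup.sr 0, DihedralGroup.sr 1]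

end ReducedWords

open HyperplaneArrangement ReducedWords

/-! ### Galleries as orderings of a family of linear functionals -/

namespace ListGallery

open scoped Classical

/-! ### Orderings encoded as duplicate-free lists. -/

section ListLemmas

variable {ι : Type*}

/-! Choose for each hyperplane a functional positive on the base chamber. A minimal gallery to the
antipode crosses every hyperplane once, so it is an ordering of the functionals each of whose
initial segments is the set of functionals negative at some point (`IsListGallery`). Reduced words
of `w₀` give the same objects through the roots they successively invert. Both graphs are therefore
treated by one statement about orderings, `ListGallery.ediam_eq`.

If `f b` is a positive combination of `f a` and `f c`, then `b` comes between `a` and `c` in every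
gallery. Hence a gallery orders each rank-two flat in one of exactly two mutually reverse ways
(`filter_eq_or_reverse`), and a gallery and its reversal are separated by all flats. An edge changes
at most one flat, so the diameter is at least the number of flats. For the converse, call `r₀`
accessible if from every other gallery one can reverse a block which is a flat separating it from
`r₀`. Then the distance to `r₀` is at most the number of separating flats. The reversal of `r₀` is
accessible too, and the routes between two galleries through `r₀` and through its reversal have
total length at most twice the number of flats, so one of them is short enough.

Accessible galleries are built along the modular flag (`IsModularStep.exists_accessible`). Let `T`
be the hyperplanes through the modular line spanned by `e`. Moving along `-e` keeps the signs of `T`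
and crosses the remaining hyperplanes in the order of the heights `f k x / f k e`. By modularity the
comparison of two heights is governed by the sign of a single member of `T`. The accessible gallery
first crosses the fibre over the base chamber and then follows an accessible gallery of `T`. In any
other gallery, either `T` comes last and induction applies, or there is a last member `K` of `T`
followed directly by a run outside `T`. In the latter case the flat spanned by `K` and the next
hyperplane is a consecutive block that can be reversed (`exists_flip_of_descent`).

For reduced words, length is the number of inversions, galleries are exactly the sequences of walls
of reduced words of `w₀`, and flips are braid moves (`braidMove_of_flipAt`). The numerical values in
types A and B come from adding one coordinate at a time: each new rank-two flat contains a unique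
old root `K` and a normalized new root. The dihedral group is treated directly, since its `w₀` has
only two reduced words. -/

theorem idxOf_lt_of_split {u v : List ι} (hr : (u ++ v).Nodup) {a b : ι} (ha : a ∈ u)
    (hb : b ∈ v) : (u ++ v).idxOf a < (u ++ v).idxOf b := by
  have hbu : b ∉ u := fun h => (List.disjoint_of_nodup_append hr) h hb
  rw [List.idxOf_append_of_mem ha, List.idxOf_append_of_notMem hbu]
  have := List.idxOf_lt_length_of_mem ha
  omega

theorem exists_split_of_idxOf_lt {r : List ι} {a b : ι} (hb : b ∈ r)
    (h : r.idxOf a < r.idxOf b) : ∃ u v, r = u ++ v ∧ a ∈ u ∧ b ∈ v := by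
  have hbl := List.idxOf_lt_length_of_mem hb
  refine ⟨r.take (r.idxOf a + 1), r.drop (r.idxOf a + 1), (List.take_append_drop _ _).symm, ?_, ?_⟩
  · rw [List.mem_take_iff_getElem]
    exact ⟨r.idxOf a, by simp; omega, by simp⟩
  · rw [List.mem_drop_iff_getElem]
    refine ⟨r.idxOf b - (r.idxOf a + 1), by omega, ?_⟩
    have : r.idxOf a + 1 + (r.idxOf b - (r.idxOf a + 1)) = r.idxOf b := by omega
    simp [this]

theorem pairwise_idxOf {r : List ι} (hr : r.Nodup) :
    r.Pairwise (fun a b => r.idxOf a < r.idxOf b) := by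
  rw [List.pairwise_iff_getElem]
  intro i j hi hj hij
  rwa [hr.idxOf_getElem, hr.idxOf_getElem]

theorem idxOf_ne {r : List ι} {a b : ι} (ha : a ∈ r) (h : a ≠ b) : r.idxOf a ≠ r.idxOf b :=
  fun h' => h ((List.idxOf_inj ha).1 h')

theorem perm_of_nodup_of_mem_iff {l l' : List ι} (h : l.Nodup) (h' : l'.Nodup)
    (hm : ∀ a, a ∈ l ↔ a ∈ l') : l.Perm l' :=
  (List.perm_ext_iff_of_nodup h h').2 hm

/-- Two duplicate-free lists with the same elements agree if they are ordered by the same strict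
real-valued ranking. -/
theorem eq_of_pairwise_lt {α : Type*} [LinearOrder α] {l l' : List ι} (t : ι → α)
    (h : l.Pairwise fun a b => t a < t b) (h' : l'.Pairwise fun a b => t a < t b)
    (hp : l.Perm l') : l = l' :=
  hp.eq_of_pairwise (fun _ _ _ _ h1 h2 => absurd h1 (lt_asymm h2)) h h'

theorem reverse_ne_self {m : List ι} (hm : m.Nodup) {a b : ι} (ha : a ∈ m) (hb : b ∈ m)
    (hab : a ≠ b) : m.reverse ≠ m := by
  intro h
  cases m with
  | nil => simp at ha
  | cons x t =>
    cases t using List.reverseRecOn with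
    | nil => simp at ha hb; exact hab (ha.trans hb.symm)
    | append_singleton t y =>
      simp at h hm
      exact hm.1.2 h.1.symm

/-- Either all elements satisfying `p` come last in `r`, or `r` has a last position where an
element satisfying `p` is followed by one that does not. -/
theorem last_descent (p : ι → Prop) (r : List ι) :
    (∃ s t, r = s ++ t ∧ (∀ k ∈ s, ¬ p k) ∧ ∀ k ∈ t, p k) ∨
    ∃ u K h B w, r = u ++ K :: ((h :: B) ++ w) ∧ p K ∧ (∀ k ∈ h :: B, ¬ p k) ∧ ∀ k ∈ w, p k := by
  induction r with
  | nil => exact Or.inl ⟨[], [], by simp⟩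
  | cons a r ih =>
    rcases ih with ⟨s, t, rfl, hs, ht⟩ | ⟨u, K, h, B, w, rfl, hK, hB, hw⟩
    · by_cases ha : p a
      · cases s with
        | nil => exact Or.inl ⟨[], a :: t, by simp, by simp, by simpa [ha] using ht⟩
        | cons h B => exact Or.inr ⟨[], a, h, B, t, by simp, ha, hs, ht⟩
      · exact Or.inl ⟨a :: s, t, by simp, by simpa [ha] using hs, ht⟩
    · exact Or.inr ⟨a :: u, K, h, B, w, by simp, hK, hB, hw⟩

/-- Serves for a flat meeting a reversed block in at most one element: such a flat does not notice
the reversal. -/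
theorem filter_reverse_eq_of_subsingleton {m : List ι} (hm : m.Nodup) (p : ι → Bool)
    (h : ∀ a ∈ m, ∀ b ∈ m, p a → p b → a = b) : m.reverse.filter p = m.filter p := by
  rw [List.filter_reverse]
  by_contra hne
  have hnd := hm.filter p
  cases hl : m.filter p with
  | nil => simp [hl] at hne
  | cons a l =>
    cases l with
    | nil => simp [hl] at hne
    | cons b l =>
      have ha : a ∈ m.filter p := by simp [hl]
      have hb : b ∈ m.filter p := by simp [hl]
      rw [List.mem_filter] at ha hb
      have := h a ha.1 b hb.1 ha.2 hb.2
      simp [hl, this] at hnd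

theorem filter_eq_of_perm_of_subsingleton {m m' : List ι} (hm : m.Nodup) (hp : m.Perm m')
    (p : ι → Bool) (h : ∀ a ∈ m, ∀ b ∈ m, p a → p b → a = b) : m'.filter p = m.filter p := by
  have hpf := hp.filter p
  have hnd := hm.filter p
  cases hl : m.filter p with
  | nil => rw [hl] at hpf; exact List.nil_perm.1 hpf
  | cons a l =>
    cases l with
    | nil => rw [hl] at hpf; exact List.singleton_perm.1 hpf |>.symm
    | cons b l =>
      have ha : a ∈ m.filter p := by simp [hl]
      have hb : b ∈ m.filter p := by simp [hl]
      rw [List.mem_filter] at ha hb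
      have := h a ha.1 b hb.1 ha.2 hb.2
      simp [hl, this] at hnd

end ListLemmas

/-! ### Galleries and rank-two flats of a family of functionals. -/

variable {V ι : Type*} [AddCommGroup V] [Module ℝ V]

/-- An ordering of the functionals `f k`, `k ∈ S`, such that for every initial segment some point
is negative exactly on that segment: the sequence of hyperplanes crossed by a minimal gallery from
the chamber where all `f k` are positive to its antipode. -/
structure IsListGallery (f : ι → Module.Dual ℝ V) (S : Set ι) (r : List ι) : Prop where
  nodup : r.Nodup
  mem_iff : ∀ k, k ∈ r ↔ k ∈ S
  exists_point : ∀ u v, r = u ++ v → ∃ x, (∀ k ∈ u, f k x < 0) ∧ ∀ k ∈ v, 0 < f k x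

/-- The functionals of the family `S` in the span of `f a` and `f b`. -/
def line (f : ι → Module.Dual ℝ V) (S : Set ι) (a b : ι) : Set ι :=
  {k | k ∈ S ∧ ∃ α β : ℝ, f k = α • f a + β • f b}

/-- The rank-two flats of the family `S`. -/
def lines (f : ι → Module.Dual ℝ V) (S : Set ι) : Set (Set ι) :=
  {L | ∃ a ∈ S, ∃ b ∈ S, a ≠ b ∧ L = line f S a b}

/-- The rank-two flats whose elements occur in different orders in `r` and `r'`. -/
noncomputable def sepLines (f : ι → Module.Dual ℝ V) (S : Set ι) (r r' : List ι) : Set (Set ι) :=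
  {L | L ∈ lines f S ∧ r.filter (· ∈ L) ≠ r'.filter (· ∈ L)}

/-- Two galleries differing by reversing a consecutive segment that is a rank-two flat `L`. -/
def FlipAt (f : ι → Module.Dual ℝ V) (S : Set ι) (L : Set ι) (r r' : List ι) : Prop :=
  IsListGallery f S r ∧ IsListGallery f S r' ∧ L ∈ lines f S ∧
    ∃ u m v, r = u ++ m ++ v ∧ r' = u ++ m.reverse ++ v ∧ ∀ k, k ∈ m ↔ k ∈ L

/-- A family of pairwise non-proportional functionals, all positive at `x₀`. -/
structure IsPosFamily (f : ι → Module.Dual ℝ V) (S : Set ι) (x₀ : V) : Prop where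
  pos : ∀ k ∈ S, 0 < f k x₀
  inj : ∀ a ∈ S, ∀ b ∈ S, ∀ α : ℝ, f a = α • f b → a = b

variable {f : ι → Module.Dual ℝ V} {S T : Set ι} {x₀ : V}

namespace IsPosFamily

theorem mono (h : IsPosFamily f S x₀) (hT : T ⊆ S) : IsPosFamily f T x₀ :=
  ⟨fun k hk => h.pos k (hT hk), fun a ha b hb => h.inj a (hT ha) b (hT hb)⟩

/-- Positivity at `x₀` excludes zero functionals, so pairwise non-proportionality is genuine linear
independence of pairs. -/
theorem indep (h : IsPosFamily f S x₀) {a b : ι} (ha : a ∈ S) (hb : b ∈ S) (hab : a ≠ b)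
    {α β : ℝ} (h0 : α • f a + β • f b = 0) : α = 0 ∧ β = 0 := by
  have key : α = 0 := by
    by_contra hα
    apply hab
    apply h.inj a ha b hb (-(α⁻¹ * β))
    have : α • f a = -(β • f b) := eq_neg_of_add_eq_zero_left h0
    calc f a = α⁻¹ • (α • f a) := by rw [smul_smul, inv_mul_cancel₀ hα, one_smul]
      _ = _ := by rw [this]; module
  refine ⟨key, ?_⟩
  rw [key, zero_smul, zero_add] at h0
  have := congrArg (fun g => g x₀) h0
  simp only [LinearMap.smul_apply, smul_eq_mul, LinearMap.zero_apply] at this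
  exact (mul_eq_zero.1 this).resolve_right (h.pos b hb).ne'

theorem _root_.ListGallery.line_subset_line {a b c d : ι}
    (hc : c ∈ line f S a b) (hd : d ∈ line f S a b) :
    line f S c d ⊆ line f S a b := by
  rintro k ⟨hk, p, q, hpq⟩
  obtain ⟨-, α, β, h1⟩ := hc
  obtain ⟨-, γ, δ, h2⟩ := hd
  exact ⟨hk, p * α + q * γ, p * β + q * δ, by rw [hpq, h1, h2]; module⟩

theorem mem_line_of_mem (h : IsPosFamily f S x₀) {a b c d : ι} (ha : a ∈ S) (hb : b ∈ S)
    (hcd : c ≠ d) (hc : c ∈ line f S a b) (hd : d ∈ line f S a b) :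
    a ∈ line f S c d ∧ b ∈ line f S c d := by
  obtain ⟨hcS, α, β, h1⟩ := hc
  obtain ⟨hdS, γ, δ, h2⟩ := hd
  have e1 : (α * δ - β * γ) • f a = δ • f c + (-β) • f d := by rw [h1, h2]; module
  have e2 : (α * δ - β * γ) • f b = (-γ) • f c + α • f d := by rw [h1, h2]; module
  -- If the determinant vanished, independence of `f c` and `f d` would make all four coefficients
  -- zero, contradicting `f c x₀ > 0`. The rest is Cramer's rule.
  have hdet : α * δ - β * γ ≠ 0 := by
    intro h0
    rw [h0, zero_smul] at e1 e2
    have i1 := h.indep hcS hdS hcd e1.symm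
    have i2 := h.indep hcS hdS hcd e2.symm
    have hβ : β = 0 := by linarith [i1.2]
    rw [hβ, i2.2, zero_smul, zero_smul, add_zero] at h1
    have := h.pos c hcS
    simp [h1] at this
  refine ⟨⟨ha, (α * δ - β * γ)⁻¹ * δ, (α * δ - β * γ)⁻¹ * (-β), ?_⟩,
    ⟨hb, (α * δ - β * γ)⁻¹ * (-γ), (α * δ - β * γ)⁻¹ * α, ?_⟩⟩
  · rw [mul_smul, mul_smul, ← smul_add, ← e1, smul_smul, inv_mul_cancel₀ hdet, one_smul]
  · rw [mul_smul, mul_smul, ← smul_add, ← e2, smul_smul, inv_mul_cancel₀ hdet, one_smul]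

theorem line_eq (h : IsPosFamily f S x₀) {a b c d : ι} (ha : a ∈ S) (hb : b ∈ S)
    (hcd : c ≠ d) (hc : c ∈ line f S a b) (hd : d ∈ line f S a b) :
    line f S c d = line f S a b :=
  (line_subset_line hc hd).antisymm <|
    line_subset_line (h.mem_line_of_mem ha hb hcd hc hd).1 (h.mem_line_of_mem ha hb hcd hc hd).2

theorem eq_line (h : IsPosFamily f S x₀) {L : Set ι} (hL : L ∈ lines f S) {c d : ι}
    (hc : c ∈ L) (hd : d ∈ L) (hcd : c ≠ d) : L = line f S c d := by
  obtain ⟨a, ha, b, hb, -, rfl⟩ := hL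
  exact (h.line_eq ha hb hcd hc hd).symm

end IsPosFamily

theorem left_mem_line {a b : ι} (ha : a ∈ S) : a ∈ line f S a b := ⟨ha, 1, 0, by simp⟩

theorem right_mem_line {a b : ι} (hb : b ∈ S) : b ∈ line f S a b := ⟨hb, 0, 1, by simp⟩

theorem line_mem_lines {a b : ι} (ha : a ∈ S) (hb : b ∈ S) (hab : a ≠ b) :
    line f S a b ∈ lines f S := ⟨a, ha, b, hb, hab, rfl⟩

theorem subset_of_mem_lines {L : Set ι} (hL : L ∈ lines f S) : L ⊆ S := by
  obtain ⟨a, -, b, -, -, rfl⟩ := hL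
  exact fun k hk => hk.1

theorem IsListGallery.finite {r : List ι} (hr : IsListGallery f S r) : S.Finite :=
  (r.finite_toSet).subset fun k hk => (hr.mem_iff k).2 hk

theorem lines_finite (h : S.Finite) : (lines f S).Finite :=
  h.finite_subsets.subset fun _ hL => subset_of_mem_lines hL

theorem IsListGallery.reverse {r : List ι} (hr : IsListGallery f S r) :
    IsListGallery f S r.reverse := by
  refine ⟨List.nodup_reverse.2 hr.nodup, fun k => by rw [List.mem_reverse, hr.mem_iff], ?_⟩
  intro u v huv
  obtain ⟨x, h1, h2⟩ := hr.exists_point v.reverse u.reverse (by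
    rw [← List.reverse_append, ← huv, List.reverse_reverse])
  refine ⟨-x, fun k hk => ?_, fun k hk => ?_⟩
  · simpa using h2 k (by simpa using hk)
  · simpa using h1 k (by simpa using hk)

/-! ### The two possible orders on a rank-two flat. -/

section Betweenness

variable {r r' : List ι}

/-- If `b` preceded both `a` and `c`, some point would have `f b < 0` with `f a` and `f c` positive;
if it followed both, the opposite signs would occur. A positive combination permits neither. -/
theorem IsListGallery.between (hr : IsListGallery f S r) {a b c : ι} (ha : a ∈ S) (hb : b ∈ S)
    (hc : c ∈ S) (hab : a ≠ b) (hbc : b ≠ c) {α β : ℝ} (hα : 0 < α) (hβ : 0 < β)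
    (h : f b = α • f a + β • f c) :
    (r.idxOf a < r.idxOf b ∧ r.idxOf b < r.idxOf c) ∨
      (r.idxOf c < r.idxOf b ∧ r.idxOf b < r.idxOf a) := by
  have ha' := (hr.mem_iff a).2 ha
  have hb' := (hr.mem_iff b).2 hb
  have hc' := (hr.mem_iff c).2 hc
  have n1 := idxOf_ne ha' hab
  have n2 := idxOf_ne hb' hbc
  have hx : ∀ x, f b x = α * f a x + β * f c x := fun x => by rw [h]; simp
  have k1 : ¬ (r.idxOf b < r.idxOf a ∧ r.idxOf b < r.idxOf c) := by
    rintro ⟨h1, h2⟩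
    obtain ⟨u, v, huv, hbu, hav⟩ := exists_split_of_idxOf_lt ha' h1
    obtain ⟨x, hxu, hxv⟩ := hr.exists_point u v huv
    -- The cut separating `b` from `a` need not separate `b` from `c`. If `c` lies before it, then
    -- the cut between `b` and `c` has `a` behind it as well and gives the contradiction instead.
    have hcv : c ∈ v := by
      rw [huv, List.mem_append] at hc'
      refine hc'.resolve_left fun hcu => ?_
      obtain ⟨u', v', huv', hbu', hcv'⟩ := exists_split_of_idxOf_lt (by rw [huv]; simp [hcu]) h2
      by_cases hl : r.idxOf a < r.idxOf c
      · have := idxOf_lt_of_split (huv ▸ hr.nodup) hcu hav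
        rw [← huv] at this
        omega
      · obtain ⟨x', hx1, hx2⟩ := hr.exists_point u' v' huv'
        have hac : a ∈ v' := by
          rw [huv', List.mem_append] at ha'
          refine ha'.resolve_left fun hau => ?_
          have := idxOf_lt_of_split (huv' ▸ hr.nodup) hau hcv'
          rw [← huv'] at this
          omega
        have := hx x'
        have := hx1 b hbu'
        have := mul_pos hα (hx2 a hac)
        have := mul_pos hβ (hx2 c hcv')
        linarith
    have := hx x
    have := hxu b hbu
    have := mul_pos hα (hxv a hav)
    have := mul_pos hβ (hxv c hcv)
    linarith
  have k2 : ¬ (r.idxOf a < r.idxOf b ∧ r.idxOf c < r.idxOf b) := by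
    rintro ⟨h1, h2⟩
    obtain ⟨u, v, huv, hau, hbv⟩ : ∃ u v, r = u ++ v ∧ a ∈ u ∧ b ∈ v :=
      exists_split_of_idxOf_lt hb' h1
    obtain ⟨u', v', huv', hcu', hbv'⟩ := exists_split_of_idxOf_lt hb' h2
    have main : ∃ x, f a x < 0 ∧ f c x < 0 ∧ 0 < f b x := by
      -- The longer of the two prefixes contains both `a` and `c` and still leaves `b` behind.
      rcases List.append_eq_append_iff.1 (huv.symm.trans huv') with ⟨w, hw, -⟩ | ⟨w, hw, -⟩
      · obtain ⟨x, hx1, hx2⟩ := hr.exists_point u' v' huv'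
        exact ⟨x, hx1 a (by rw [hw]; simp [hau]), hx1 c hcu', hx2 b hbv'⟩
      · obtain ⟨x, hx1, hx2⟩ := hr.exists_point u v huv
        exact ⟨x, hx1 a hau, hx1 c (by rw [hw]; simp [hcu']), hx2 b hbv⟩
    obtain ⟨x, hxa, hxc, hxb⟩ := main
    have := hx x
    have := mul_neg_of_pos_of_neg hα hxa
    have := mul_neg_of_pos_of_neg hβ hxc
    linarith
  omega

/-- Among three functionals of rank two, one is a positive combination of the other two. -/
theorem IsPosFamily.trichotomy (h : IsPosFamily f S x₀) {a b c : ι} (ha : a ∈ S) (hb : b ∈ S)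
    (hc : c ∈ S) (hab : a ≠ b) (hbc : b ≠ c) (hl : b ∈ line f S a c) :
    (∃ α β : ℝ, 0 < α ∧ 0 < β ∧ f b = α • f a + β • f c) ∨
    (∃ α β : ℝ, 0 < α ∧ 0 < β ∧ f a = α • f b + β • f c) ∨
    (∃ α β : ℝ, 0 < α ∧ 0 < β ∧ f c = α • f a + β • f b) := by
  obtain ⟨-, α, β, hl⟩ := hl
  have hα : α ≠ 0 := by
    rintro rfl
    exact hbc (h.inj b hb c hc β (by simpa using hl))
  have hβ : β ≠ 0 := by
    rintro rfl
    exact hab.symm (h.inj b hb a ha α (by simpa using hl))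
  have hx : f b x₀ = α * f a x₀ + β * f c x₀ := by rw [hl]; simp
  have pa := h.pos a ha
  have pb := h.pos b hb
  have pc := h.pos c hc
  rcases hα.lt_or_gt with h1 | h1 <;> rcases hβ.lt_or_gt with h2 | h2
  -- Two negative coefficients are impossible because all three functionals are positive at `x₀`.
  · have := mul_neg_of_neg_of_pos h1 pa
    have := mul_neg_of_neg_of_pos h2 pc
    linarith
  · refine Or.inr (Or.inr ⟨-α * β⁻¹, β⁻¹, mul_pos (by linarith) (inv_pos.2 h2), inv_pos.2 h2, ?_⟩)
    rw [hl, smul_add, smul_smul, smul_smul, inv_mul_cancel₀ hβ]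
    module
  · refine Or.inr (Or.inl ⟨α⁻¹, -β * α⁻¹, inv_pos.2 h1, mul_pos (by linarith) (inv_pos.2 h1), ?_⟩)
    rw [hl, smul_add, smul_smul, smul_smul, inv_mul_cancel₀ hα]
    module
  · exact Or.inl ⟨α, β, h1, h2, hl⟩

/-- Which of the three functionals lies in the middle is a property of the family, not of the
gallery. Once the middle is known, the order of one pair fixes the order of the triple. -/
theorem agree_step (h : IsPosFamily f S x₀) (hr : IsListGallery f S r)
    (hr' : IsListGallery f S r') {L : Set ι} (hL : L ∈ lines f S) {a b c : ι} (ha : a ∈ L)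
    (hb : b ∈ L) (hc : c ∈ L) (hab : a ≠ b) (hbc : b ≠ c) (hac : a ≠ c)
    (hag : r.idxOf a < r.idxOf b ↔ r'.idxOf a < r'.idxOf b) :
    (r.idxOf b < r.idxOf c ↔ r'.idxOf b < r'.idxOf c) ∧
      (r.idxOf a < r.idxOf c ↔ r'.idxOf a < r'.idxOf c) := by
  have haS := subset_of_mem_lines hL ha
  have hbS := subset_of_mem_lines hL hb
  have hcS := subset_of_mem_lines hL hc
  have hl : b ∈ line f S a c := by rw [← h.eq_line hL ha hc hac]; exact hb
  rcases h.trichotomy haS hbS hcS hab hbc hl with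
    ⟨α, β, hα, hβ, e⟩ | ⟨α, β, hα, hβ, e⟩ | ⟨α, β, hα, hβ, e⟩
  · have := hr.between haS hbS hcS hab hbc hα hβ e
    have := hr'.between haS hbS hcS hab hbc hα hβ e
    omega
  · have := hr.between hbS haS hcS hab.symm hac hα hβ e
    have := hr'.between hbS haS hcS hab.symm hac hα hβ e
    omega
  · have := hr.between haS hcS hbS hac hbc.symm hα hβ e
    have := hr'.between haS hcS hbS hac hbc.symm hα hβ e
    omega

theorem agree_all (h : IsPosFamily f S x₀) (hr : IsListGallery f S r)
    (hr' : IsListGallery f S r') {L : Set ι} (hL : L ∈ lines f S) {a b c d : ι} (ha : a ∈ L)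
    (hb : b ∈ L) (hab : a ≠ b) (hag : r.idxOf a < r.idxOf b ↔ r'.idxOf a < r'.idxOf b)
    (hc : c ∈ L) (hd : d ∈ L) (hcd : c ≠ d) :
    (r.idxOf c < r.idxOf d ↔ r'.idxOf c < r'.idxOf d) := by
  have flip : ∀ {x y : ι}, x ∈ L → y ∈ L → x ≠ y →
      ((r.idxOf x < r.idxOf y ↔ r'.idxOf x < r'.idxOf y) ↔
        (r.idxOf y < r.idxOf x ↔ r'.idxOf y < r'.idxOf x)) := by
    intro x y hx hy hxy
    have := idxOf_ne ((hr.mem_iff x).2 (subset_of_mem_lines hL hx)) hxy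
    have := idxOf_ne ((hr'.mem_iff x).2 (subset_of_mem_lines hL hx)) hxy
    omega
  -- all pairs containing `a`
  have step : ∀ x ∈ L, x ≠ a → (r.idxOf a < r.idxOf x ↔ r'.idxOf a < r'.idxOf x) := by
    intro x hx hxa
    by_cases hxb : x = b
    · exact hxb ▸ hag
    · exact (agree_step h hr hr' hL ha hb hx hab (Ne.symm hxb) hxa.symm hag).2
  by_cases hca : c = a
  · subst hca
    exact step d hd hcd.symm
  · by_cases hda : d = a
    · subst hda
      exact (flip hd hc hcd.symm).1 (step c hc hca)
    · exact (agree_step h hr hr' hL ha hc hd (Ne.symm hca) hcd (Ne.symm hda) (step c hc hca)).1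

theorem IsListGallery.mem_filter {L : Set ι} (hr : IsListGallery f S r) (hL : L ∈ lines f S)
    (k : ι) : k ∈ r.filter (· ∈ L) ↔ k ∈ L := by
  rw [List.mem_filter, hr.mem_iff]
  simpa using fun hk => subset_of_mem_lines hL hk

theorem IsListGallery.filter_perm {L : Set ι} (hr : IsListGallery f S r)
    (hr' : IsListGallery f S r') (hL : L ∈ lines f S) :
    (r.filter (· ∈ L)).Perm (r'.filter (· ∈ L)) :=
  perm_of_nodup_of_mem_iff (hr.nodup.filter _) (hr'.nodup.filter _) fun k => by
    rw [hr.mem_filter hL, hr'.mem_filter hL]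

theorem filter_eq_of_agree (h : IsPosFamily f S x₀) (hr : IsListGallery f S r)
    (hr' : IsListGallery f S r') {L : Set ι} (hL : L ∈ lines f S) {a b : ι} (ha : a ∈ L)
    (hb : b ∈ L) (hab : a ≠ b) (hag : r.idxOf a < r.idxOf b ↔ r'.idxOf a < r'.idxOf b) :
    r.filter (· ∈ L) = r'.filter (· ∈ L) := by
  have h1 : (r.filter (· ∈ L)).Pairwise (fun a b => r.idxOf a < r.idxOf b) :=
    (pairwise_idxOf hr.nodup).filter _
  have h2 : (r'.filter (· ∈ L)).Pairwise (fun a b => r'.idxOf a < r'.idxOf b) :=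
    (pairwise_idxOf hr'.nodup).filter _
  refine eq_of_pairwise_lt (fun a => r.idxOf a) h1 ?_ (hr.filter_perm hr' hL)
  refine h2.imp_of_mem ?_
  intro c d hc hd hcd
  rw [hr'.mem_filter hL] at hc hd
  exact (agree_all h hr hr' hL ha hb hab hag hc hd (by rintro rfl; simp at hcd)).2 hcd

/-- A gallery that disagrees with `r` on one pair agrees with it after reversal, and agreement on
one pair propagates to the flat. -/
theorem filter_eq_reverse_of_not_agree (h : IsPosFamily f S x₀) (hr : IsListGallery f S r)
    (hr' : IsListGallery f S r') {L : Set ι} (hL : L ∈ lines f S) {a b : ι} (ha : a ∈ L)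
    (hb : b ∈ L) (hab : a ≠ b) (hag : ¬ (r.idxOf a < r.idxOf b ↔ r'.idxOf a < r'.idxOf b)) :
    r.filter (· ∈ L) = (r'.filter (· ∈ L)).reverse := by
  rw [← List.filter_reverse]
  apply filter_eq_of_agree h hr hr'.reverse hL ha hb hab
  have hrev : r'.reverse.idxOf a < r'.reverse.idxOf b ↔ r'.idxOf b < r'.idxOf a := by
    have key : ∀ x y, y ∈ r' → r'.idxOf x < r'.idxOf y →
        r'.reverse.idxOf y < r'.reverse.idxOf x := by
      intro x y hy hxy
      obtain ⟨u, v, huv, hu, hv⟩ := exists_split_of_idxOf_lt hy hxy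
      have hnd := List.nodup_reverse.2 hr'.nodup
      rw [huv, List.reverse_append] at hnd ⊢
      exact idxOf_lt_of_split hnd (by simpa using hv) (by simpa using hu)
    have ha' := (hr'.mem_iff a).2 (subset_of_mem_lines hL ha)
    have hb' := (hr'.mem_iff b).2 (subset_of_mem_lines hL hb)
    refine ⟨fun hlt => ?_, key b a ha'⟩
    rcases (idxOf_ne ha' hab).lt_or_gt with h' | h'
    · have := key a b hb' h'
      omega
    · exact h'
  rw [hrev]
  have := idxOf_ne ((hr'.mem_iff a).2 (subset_of_mem_lines hL ha)) hab
  omega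

theorem agree_of_filter_eq (hr : IsListGallery f S r) (hr' : IsListGallery f S r') {L : Set ι}
    (hL : L ∈ lines f S) (h : r.filter (· ∈ L) = r'.filter (· ∈ L)) {a b : ι} (ha : a ∈ L)
    (hb : b ∈ L) (hab : a ≠ b) : (r.idxOf a < r.idxOf b ↔ r'.idxOf a < r'.idxOf b) := by
  have h1 : (r.filter (· ∈ L)).Pairwise (fun a b => r.idxOf a < r.idxOf b) :=
    (pairwise_idxOf hr.nodup).filter _
  have h2 : (r.filter (· ∈ L)).Pairwise (fun a b => r'.idxOf a < r'.idxOf b) := by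
    rw [h]; exact (pairwise_idxOf hr'.nodup).filter _
  -- The relation is symmetrized so that it can be read off for `a` and `b` without knowing which of
  -- them comes first.
  let Q : ι → ι → Prop := fun a b => (r.idxOf a < r.idxOf b ∧ r'.idxOf a < r'.idxOf b) ∨
    (r.idxOf b < r.idxOf a ∧ r'.idxOf b < r'.idxOf a)
  have : Std.Symm Q := ⟨fun x y hxy => hxy.symm⟩
  have h3 : (r.filter (· ∈ L)).Pairwise Q := (h1.and h2).imp fun hx => Or.inl hx
  have := h3.forall ((hr.mem_filter hL a).2 ha) ((hr.mem_filter hL b).2 hb) hab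
  simp only [Q] at this
  omega

theorem filter_eq_or_reverse (h : IsPosFamily f S x₀) (hr : IsListGallery f S r)
    (hr' : IsListGallery f S r') {L : Set ι} (hL : L ∈ lines f S) :
    r.filter (· ∈ L) = r'.filter (· ∈ L) ∨ r.filter (· ∈ L) = (r'.filter (· ∈ L)).reverse := by
  obtain ⟨a, ha, b, hb, hab, rfl⟩ := id hL
  by_cases hag : r.idxOf a < r.idxOf b ↔ r'.idxOf a < r'.idxOf b
  · exact Or.inl (filter_eq_of_agree h hr hr' hL (left_mem_line ha) (right_mem_line hb) hab hag)
  · exact Or.inr (filter_eq_reverse_of_not_agree h hr hr' hL (left_mem_line ha)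
      (right_mem_line hb) hab hag)

theorem filter_reverse_ne (hr : IsListGallery f S r) {L : Set ι} (hL : L ∈ lines f S) :
    (r.filter (· ∈ L)).reverse ≠ r.filter (· ∈ L) := by
  obtain ⟨a, ha, b, hb, hab, rfl⟩ := id hL
  exact reverse_ne_self (hr.nodup.filter _) ((hr.mem_filter hL a).2 (left_mem_line ha))
    ((hr.mem_filter hL b).2 (right_mem_line hb)) hab

end Betweenness

/-! ### Separation sets, reversal and flips. -/

section Separation

variable {r r' r'' : List ι}

theorem sepLines_self : sepLines f S r r = ∅ := by simp [sepLines]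

theorem sepLines_subset : sepLines f S r r' ⊆ lines f S := fun _ h => h.1

theorem sepLines_comm : sepLines f S r r' = sepLines f S r' r := by
  ext L; simp [sepLines, ne_comm]

theorem sepLines_triangle : sepLines f S r r'' ⊆ sepLines f S r r' ∪ sepLines f S r' r'' := by
  rintro L ⟨hL, h⟩
  by_contra hn
  simp only [sepLines, Set.mem_union, Set.mem_ofPred_eq, not_or, not_and, not_not] at hn
  exact h ((hn.1 hL).trans (hn.2 hL))

theorem sepLines_reverse_reverse : sepLines f S r.reverse r'.reverse = sepLines f S r r' := by
  ext L; simp [sepLines, List.filter_reverse]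

/-- Only two orders exist on each flat and they are distinct, so reversing one gallery exchanges
agreement and disagreement. -/
theorem sepLines_reverse_right (h : IsPosFamily f S x₀) (hr : IsListGallery f S r)
    (hr' : IsListGallery f S r') :
    sepLines f S r r'.reverse = lines f S \ sepLines f S r r' := by
  ext L
  simp only [sepLines, Set.mem_ofPred_eq, Set.mem_sdiff, List.filter_reverse]
  constructor
  · rintro ⟨hL, hne⟩
    exact ⟨hL, fun h' => hne ((filter_eq_or_reverse h hr hr' hL).resolve_left h'.2)⟩
  · rintro ⟨hL, hne⟩
    refine ⟨hL, fun heq => hne ⟨hL, ?_⟩⟩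
    rw [heq]
    exact filter_reverse_ne hr' hL

/-- Two distinct functionals determine their flat, so any flat other than `L` meets the reversed
block in at most one element. -/
theorem FlipAt.sepLines_eq (h : IsPosFamily f S x₀) {L : Set ι} (hf : FlipAt f S L r r') :
    sepLines f S r r' = {L} := by
  obtain ⟨hr, hr', hL, u, m, v, rfl, rfl, hm⟩ := hf
  have hmn : m.Nodup := (hr.nodup.of_append_left).of_append_right
  ext L'
  simp only [sepLines, Set.mem_ofPred_eq, Set.mem_singleton_iff, List.filter_append,
    List.append_assoc]
  constructor
  · rintro ⟨hL', hne⟩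
    by_contra hne'
    apply hne
    rw [filter_reverse_eq_of_subsingleton hmn]
    intro a ha b hb ha' hb'
    by_contra hab
    apply hne'
    rw [h.eq_line hL' (by simpa using ha') (by simpa using hb') hab,
      ← h.eq_line hL ((hm a).1 ha) ((hm b).1 hb) hab]
  · rintro rfl
    refine ⟨hL, fun heq => ?_⟩
    have heq' := List.append_cancel_left heq
    have heq'' := List.append_cancel_right heq'
    have hfm : m.filter (· ∈ L') = m := by
      rw [List.filter_eq_self]; intro a ha; simpa using (hm a).1 ha
    rw [List.filter_reverse, hfm] at heq''
    obtain ⟨a, ha, b, hb, hab, rfl⟩ := id hL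
    exact reverse_ne_self hmn ((hm a).2 (left_mem_line ha)) ((hm b).2 (right_mem_line hb)) hab
      heq''.symm

/-- With only two orders available on `L`, changing the order of a separating flat makes it agree;
all other flats are untouched. -/
theorem FlipAt.sepLines_diff (h : IsPosFamily f S x₀) {L : Set ι} (hf : FlipAt f S L r r')
    (hr'' : IsListGallery f S r'') (hL : L ∈ sepLines f S r r'') :
    sepLines f S r' r'' = sepLines f S r r'' \ {L} := by
  have hs := hf.sepLines_eq h
  have hLs : L ∈ sepLines f S r r' := by rw [hs]; rfl
  ext L'
  constructor
  · intro hL'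
    have hne : L' ≠ L := by
      rintro rfl
      have h1 := (filter_eq_or_reverse h hf.1 hr'' hL.1).resolve_left hL.2
      have h2 := (filter_eq_or_reverse h hf.1 hf.2.1 hL.1).resolve_left hLs.2
      exact hL'.2 (List.reverse_injective (h2.symm.trans h1))
    refine ⟨?_, hne⟩
    rcases sepLines_triangle (r' := r) hL' with h1 | h1
    · rw [sepLines_comm, hs] at h1
      exact absurd h1 hne
    · exact h1
  · rintro ⟨h1, hne⟩
    rcases sepLines_triangle (r' := r') h1 with h2 | h2
    · rw [hs] at h2
      exact absurd h2 hne
    · exact h2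

theorem FlipAt.reverse {L : Set ι} (hf : FlipAt f S L r r') :
    FlipAt f S L r.reverse r'.reverse := by
  obtain ⟨hr, hr', hL, u, m, v, rfl, rfl, hm⟩ := hf
  exact ⟨hr.reverse, hr'.reverse, hL, v.reverse, m.reverse, u.reverse, by simp, by simp,
    by simpa using hm⟩

/-- Every other gallery has a flip that brings it closer to `r₀`. -/
def IsAccessible (f : ι → Module.Dual ℝ V) (S : Set ι) (r₀ : List ι) : Prop :=
  IsListGallery f S r₀ ∧ ∀ r, IsListGallery f S r → r ≠ r₀ →
    ∃ L ∈ sepLines f S r r₀, ∃ r', FlipAt f S L r r'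

theorem IsAccessible.reverse {r₀ : List ι} (h : IsAccessible f S r₀) :
    IsAccessible f S r₀.reverse := by
  refine ⟨h.1.reverse, fun r hr hne => ?_⟩
  obtain ⟨L, hL, r', hf⟩ := h.2 r.reverse hr.reverse fun h' => hne (by rw [← h', List.reverse_reverse])
  refine ⟨L, ?_, r'.reverse, ?_⟩
  · rw [← sepLines_reverse_reverse, List.reverse_reverse] at hL
    exact hL
  · have := hf.reverse
    rwa [List.reverse_reverse] at this

end Separation

/-! ### From an accessible gallery to the diameter. -/

section Diameter

variable {R : Type*} {G : SimpleGraph R} {φ : R → List ι}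

/-- Each flip supplied by accessibility removes exactly one separating flat, so their number bounds
the distance by induction. -/
theorem edist_le_of_accessible (h : IsPosFamily f S x₀)
    (hgal : ∀ a, IsListGallery f S (φ a)) (hsurj : ∀ r, IsListGallery f S r → ∃ a, φ a = r)
    (hinj : Function.Injective φ) (hflip : ∀ a b L, FlipAt f S L (φ a) (φ b) → G.Adj a b)
    {a₀ : R} (h₀ : IsAccessible f S (φ a₀)) (a : R) :
    G.edist a a₀ ≤ (sepLines f S (φ a) (φ a₀)).encard := by
  have hfin : ∀ a, (sepLines f S (φ a) (φ a₀)).Finite :=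
    fun a => (lines_finite h₀.1.finite).subset sepLines_subset
  suffices ∀ n : ℕ, ∀ a, (sepLines f S (φ a) (φ a₀)).ncard = n → G.edist a a₀ ≤ n by
    have := this _ a rfl
    rwa [(hfin a).cast_ncard_eq] at this
  intro n
  induction n with
  | zero =>
    intro a ha
    by_cases hne : φ a = φ a₀
    · rw [hinj hne]; simp
    · obtain ⟨L, hL, -⟩ := h₀.2 _ (hgal a) hne
      rw [Set.ncard_eq_zero (hfin a)] at ha
      simp [ha] at hL
  | succ n ih =>
    intro a ha
    by_cases hne : φ a = φ a₀
    · rw [hinj hne]; simp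
    · obtain ⟨L, hL, r', hf⟩ := h₀.2 _ (hgal a) hne
      obtain ⟨b, rfl⟩ := hsurj r' hf.2.1
      have hd := hf.sepLines_diff h h₀.1 hL
      have hb := ih b (by rw [hd, Set.ncard_sdiff_singleton_of_mem hL]; omega)
      have hadj := hflip a b L hf
      calc G.edist a a₀ ≤ G.edist a b + G.edist b a₀ := SimpleGraph.edist_triangle
        _ ≤ 1 + n := add_le_add (SimpleGraph.edist_eq_one_iff_adj.2 hadj).le hb
        _ = _ := by push_cast; ring

theorem sepLines_encard_le_length (hadj : ∀ a b, G.Adj a b →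
    (sepLines f S (φ a) (φ b)).encard ≤ 1) {a b : R} (p : G.Walk a b) :
    (sepLines f S (φ a) (φ b)).encard ≤ p.length := by
  induction p with
  | nil => simp [sepLines_self]
  | @cons a b c hab p ih =>
    calc (sepLines f S (φ a) (φ c)).encard
        ≤ (sepLines f S (φ a) (φ b) ∪ sepLines f S (φ b) (φ c)).encard :=
          Set.encard_le_encard sepLines_triangle
      _ ≤ (sepLines f S (φ a) (φ b)).encard + (sepLines f S (φ b) (φ c)).encard :=
          Set.encard_union_le _ _
      _ ≤ 1 + p.length := add_le_add (hadj a b hab) ih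
      _ = _ := by simp [add_comm]

/-- A graph on the galleries that contains all flips, and whose edges separate at most one rank-two
flat, has the number of rank-two flats as its diameter once some gallery is accessible. -/
theorem ediam_eq (h : IsPosFamily f S x₀)
    (hgal : ∀ a, IsListGallery f S (φ a)) (hsurj : ∀ r, IsListGallery f S r → ∃ a, φ a = r)
    (hinj : Function.Injective φ) (hflip : ∀ a b L, FlipAt f S L (φ a) (φ b) → G.Adj a b)
    (hadj : ∀ a b, G.Adj a b → (sepLines f S (φ a) (φ b)).encard ≤ 1)
    {r₀ : List ι} (h₀ : IsAccessible f S r₀) : G.ediam = (lines f S).encard := by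
  obtain ⟨a₀, rfl⟩ := hsurj _ h₀.1
  obtain ⟨a₁, ha₁⟩ := hsurj _ h₀.1.reverse
  have hfin := lines_finite (f := f) h₀.1.finite
  apply le_antisymm
  · refine SimpleGraph.ediam_le_of_edist_le fun a b => ?_
    have e1 := edist_le_of_accessible h hgal hsurj hinj hflip h₀
    have e2 := edist_le_of_accessible h hgal hsurj hinj hflip (a₀ := a₁) (ha₁ ▸ h₀.reverse)
    -- The flats separating `c` from `a₀` and those separating it from the reversal `a₁` partition
    -- all flats. Hence the bounds through `a₀` and through `a₁` add up to twice the number of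
    -- flats, and the smaller is at most that number.
    have hsum : ∀ c, (sepLines f S (φ c) (φ a₀)).ncard + (sepLines f S (φ c) (φ a₁)).ncard =
        (lines f S).ncard := by
      intro c
      rw [ha₁, sepLines_reverse_right h (hgal c) (hgal a₀), add_comm]
      exact Set.ncard_sdiff_add_ncard_of_subset sepLines_subset hfin
    have cast : ∀ c c', (sepLines f S (φ c) (φ c')).encard =
        ((sepLines f S (φ c) (φ c')).ncard : ℕ∞) :=
      fun c c' => ((hfin.subset sepLines_subset).cast_ncard_eq).symm
    simp only [cast] at e1 e2
    rw [← hfin.cast_ncard_eq]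
    have t1 : G.edist a b ≤ G.edist a a₀ + G.edist b a₀ := by
      rw [G.edist_comm (u := b)]; exact SimpleGraph.edist_triangle
    have t2 : G.edist a b ≤ G.edist a a₁ + G.edist b a₁ := by
      rw [G.edist_comm (u := b)]; exact SimpleGraph.edist_triangle
    have u1 := t1.trans (add_le_add (e1 a) (e1 b))
    have u2 := t2.trans (add_le_add (e2 a) (e2 b))
    have s1 := hsum a
    have s2 := hsum b
    by_cases hc : (sepLines f S (φ a) (φ a₀)).ncard + (sepLines f S (φ b) (φ a₀)).ncard ≤
        (lines f S).ncard
    · exact u1.trans (by exact_mod_cast hc)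
    · exact u2.trans (by
        have : (sepLines f S (φ a) (φ a₁)).ncard + (sepLines f S (φ b) (φ a₁)).ncard ≤
          (lines f S).ncard := by omega
        exact_mod_cast this)
  -- A gallery and its reversal are separated by every flat, and each edge of a path accounts for at
  -- most one.
  · have hs : sepLines f S (φ a₀) (φ a₁) = lines f S := by
      rw [ha₁, sepLines_reverse_right h h₀.1 h₀.1, sepLines_self, Set.sdiff_empty]
    refine le_trans ?_ (SimpleGraph.edist_le_ediam (u := a₀) (v := a₁))
    by_cases htop : G.edist a₀ a₁ = ⊤
    · rw [htop]; exact le_top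
    · obtain ⟨p, hp⟩ := SimpleGraph.exists_walk_of_edist_ne_top htop
      rw [← hp, ← hs]
      exact sepLines_encard_le_length hadj p

end Diameter

end ListGallery

/-! ### Modular steps and the construction of accessible galleries. -/

namespace ListGallery

open scoped Classical

variable {V ι : Type*} [AddCommGroup V] [Module ℝ V]

/-- A subfamily `T` of `S` obtained by localizing at a modular coatom, spanned by a vector `e` in
the closure of the positive chamber. -/
structure IsModularStep (f : ι → Module.Dual ℝ V) (S T : Set ι) (e : V) : Prop where
  subset : T ⊆ S
  zero : ∀ k ∈ T, f k e = 0
  pos : ∀ k ∈ S, k ∉ T → 0 < f k e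
  modular : ∀ a ∈ S, a ∉ T → ∀ b ∈ S, b ∉ T → a ≠ b → ∃ K ∈ T, K ∈ line f S a b

/-- Families with a chain of modular steps down to the empty family. -/
inductive HasModularChain (f : ι → Module.Dual ℝ V) : Set ι → Prop
  | empty : HasModularChain f ∅
  | step {S T : Set ι} {e : V} (hfin : S.Finite) (h : IsModularStep f S T e)
      (hT : HasModularChain f T) : HasModularChain f S

variable {f : ι → Module.Dual ℝ V} {S T : Set ι} {x₀ e : V}

namespace IsModularStep

/-- `T` consists exactly of the members of `S` vanishing at `e`, so it is closed under taking spans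
within `S`. -/
theorem line_eq (h : IsModularStep f S T e) {a b : ι} (ha : a ∈ T) (hb : b ∈ T) :
    line f S a b = line f T a b := by
  ext k
  refine ⟨?_, fun hk => ⟨h.subset hk.1, hk.2⟩⟩
  rintro ⟨hk, α, β, hk'⟩
  refine ⟨?_, α, β, hk'⟩
  by_contra hkT
  have := h.pos k hk hkT
  rw [hk'] at this
  simp [h.zero a ha, h.zero b hb] at this

theorem lines_subset (h : IsModularStep f S T e) : lines f T ⊆ lines f S := by
  rintro L ⟨a, ha, b, hb, hab, rfl⟩
  exact ⟨a, h.subset ha, b, h.subset hb, hab, (h.line_eq ha hb).symm⟩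

/-- The heights at which a line in direction `e` meets two hyperplanes are compared by a functional
of `T`. -/
theorem exists_compare (h : IsModularStep f S T e) (hf : IsPosFamily f S x₀) {a b : ι} (ha : a ∈ S)
    (haT : a ∉ T) (hb : b ∈ S) (hbT : b ∉ T) (hab : a ≠ b) :
    ∃ K ∈ T, K ∈ line f S a b ∧ ∃ c : ℝ, c ≠ 0 ∧
      ∀ x, f a x / f a e - f b x / f b e = c * f K x := by
  obtain ⟨K, hK, hKS, α, β, hl⟩ := h.modular a ha haT b hb hbT hab
  have pa := h.pos a ha haT
  have pb := h.pos b hb hbT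
  have hz : α * f a e + β * f b e = 0 := by
    have := h.zero K hK
    rw [hl] at this
    simpa using this
  have hα : α ≠ 0 := by
    rintro rfl
    rw [zero_mul, zero_add] at hz
    have hβ := (mul_eq_zero.1 hz).resolve_right pb.ne'
    have := hf.pos K hKS
    rw [hl, hβ] at this
    simp at this
  -- Vanishing of `f K` at `e` fixes the ratio of the coefficients, so `f K` is the difference of
  -- heights scaled by `α * f a e`.
  have hβ : β = -(α * f a e / f b e) := by field_simp; linarith
  refine ⟨K, hK, ⟨hKS, α, β, hl⟩, (α * f a e)⁻¹, inv_ne_zero (mul_ne_zero hα pa.ne'), fun x => ?_⟩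
  rw [hl, hβ]
  simp only [LinearMap.add_apply, LinearMap.smul_apply, smul_eq_mul]
  field_simp
  ring

/-- A flat with two members in `T` would lie in `T` entirely; hence a flat that leaves `T` has at
most one member there. -/
theorem mem_unique (h : IsModularStep f S T e) (hf : IsPosFamily f S x₀) {a b K : ι} (ha : a ∈ S)
    (haT : a ∉ T) (hK : K ∈ T) (hb : b ∈ T) (hbl : b ∈ line f S K a) : b = K := by
  by_contra hne
  have hKS := h.subset hK
  have h1 := (hf.mem_line_of_mem hKS ha hne hbl (left_mem_line hKS)).2
  rw [h.line_eq hb hK] at h1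
  exact haT h1.1

end IsModularStep

/-- Moving a point along `e`. -/
theorem exists_shift (hpos : ∀ k ∈ S, k ∉ T → 0 < f k e) (y : V) (c d : List ι)
    (hc : ∀ k ∈ c, k ∈ S ∧ k ∉ T) (hd : ∀ k ∈ d, k ∈ S ∧ k ∉ T)
    (hcd : ∀ k ∈ c, ∀ l ∈ d, f k y / f k e < f l y / f l e) :
    ∃ s : ℝ, (∀ k ∈ c, f k (y - s • e) < 0) ∧ ∀ k ∈ d, 0 < f k (y - s • e) := by
  -- Subtracting `s • e` makes `f k` negative exactly when its height is below `s`, so it suffices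
  -- to separate two finite sets of heights by a real number.
  obtain ⟨s, h1, h2⟩ := Order.exists_between_finsets
    (c.map fun k => f k y / f k e).toFinset (d.map fun k => f k y / f k e).toFinset (by
      intro p hp q hq
      rw [List.mem_toFinset, List.mem_map] at hp hq
      obtain ⟨k, hk, rfl⟩ := hp
      obtain ⟨l, hl, rfl⟩ := hq
      exact hcd k hk l hl)
  refine ⟨s, fun k hk => ?_, fun k hk => ?_⟩
  · have := h1 (f k y / f k e) (by rw [List.mem_toFinset, List.mem_map]; exact ⟨k, hk, rfl⟩)
    rw [div_lt_iff₀ (hpos k (hc k hk).1 (hc k hk).2)] at this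
    simp only [map_sub, map_smul, smul_eq_mul]
    linarith
  · have := h2 (f k y / f k e) (by rw [List.mem_toFinset, List.mem_map]; exact ⟨k, hk, rfl⟩)
    rw [lt_div_iff₀ (hpos k (hd k hk).1 (hd k hk).2)] at this
    simp only [map_sub, map_smul, smul_eq_mul]
    linarith

namespace IsModularStep

/-- The fibre over the base chamber: `S \ T` ordered by height. -/
theorem exists_fibre (h : IsModularStep f S T e) (hf : IsPosFamily f S x₀) (hfin : S.Finite) :
    ∃ σ : List ι, σ.Nodup ∧ (∀ k, k ∈ σ ↔ k ∈ S ∧ k ∉ T) ∧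
      σ.Pairwise fun a b => f a x₀ / f a e < f b x₀ / f b e := by
  let τ : ι → ℝ := fun k => f k x₀ / f k e
  let le : ι → ι → Prop := fun a b => τ a ≤ τ b
  have : Std.Total le := ⟨fun a b => le_total _ _⟩
  have : IsTrans ι le := ⟨fun a b c => le_trans⟩
  let l := (hfin.subset (Set.sdiff_subset (t := T))).toFinset.toList
  have hp : (List.insertionSort le l).Perm l := List.perm_insertionSort _ _
  have hmem : ∀ k, k ∈ List.insertionSort le l ↔ k ∈ S ∧ k ∉ T := by
    intro k
    rw [hp.mem_iff]
    simp [l]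
  have hnd : (List.insertionSort le l).Nodup := hp.nodup_iff.2 (Finset.nodup_toList _)
  refine ⟨_, hnd, hmem, ?_⟩
  have := (List.pairwise_insertionSort le l).and hnd
  refine this.imp_of_mem ?_
  rintro a b ha hb ⟨hle, hne⟩
  rw [hmem] at ha hb
  refine lt_of_le_of_ne hle fun heq => ?_
  -- Equal heights at `x₀` would force some `f K`, `K ∈ T`, to vanish there.
  obtain ⟨K, hK, -, c, hc, hcmp⟩ := h.exists_compare hf ha.1 ha.2 hb.1 hb.2 hne
  have h1 := hcmp x₀
  have h2 : f a x₀ / f a e = f b x₀ / f b e := heq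
  rw [h2, sub_self] at h1
  exact mul_ne_zero hc (hf.pos K (h.subset hK)).ne' h1.symm

/-- Moving `x₀` along `-e` crosses all of `S \ T` by increasing height without affecting `T`; far
enough along `-e`, a gallery of `T` can then be followed. -/
theorem gallery_append (h : IsModularStep f S T e) (hf : IsPosFamily f S x₀) {σ ρ : List ι}
    (hσn : σ.Nodup) (hσ : ∀ k, k ∈ σ ↔ k ∈ S ∧ k ∉ T)
    (hσp : σ.Pairwise fun a b => f a x₀ / f a e < f b x₀ / f b e) (hρ : IsListGallery f T ρ) :
    IsListGallery f S (σ ++ ρ) := by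
  refine ⟨?_, fun k => ?_, fun u v huv => ?_⟩
  · refine hσn.append hρ.nodup fun k hk hk' => ?_
    exact ((hσ k).1 hk).2 ((hρ.mem_iff k).1 hk')
  · rw [List.mem_append, hσ, hρ.mem_iff]
    have := @h.subset k
    tauto
  · rcases List.append_eq_append_iff.1 huv with ⟨w, rfl, rfl⟩ | ⟨w, rfl, rfl⟩
    -- Cut inside `ρ`: its point is moved along `-e` until all of `σ` is negative.
    · obtain ⟨x, hx1, hx2⟩ := hρ.exists_point w v rfl
      obtain ⟨s, hs, -⟩ := exists_shift h.pos x σ [] (fun k hk => (hσ k).1 hk) (by simp) (by simp)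
      have hT : ∀ k ∈ T, f k (x - s • e) = f k x := fun k hk => by simp [h.zero k hk]
      refine ⟨x - s • e, fun k hk => ?_, fun k hk => ?_⟩
      · rcases List.mem_append.1 hk with hk | hk
        · exact hs k hk
        · rw [hT k ((hρ.mem_iff k).1 (by simp [hk]))]; exact hx1 k hk
      · rw [hT k ((hρ.mem_iff k).1 (by simp [hk]))]; exact hx2 k hk
    -- Cut inside `σ`: a point on the line through `x₀` in direction `e`, between two consecutive
    -- heights.
    · obtain ⟨s, hs1, hs2⟩ := exists_shift h.pos x₀ u w
        (fun k hk => (hσ k).1 (by simp [hk])) (fun k hk => (hσ k).1 (by simp [hk]))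
        (fun k hk l hl => (List.pairwise_append.1 hσp).2.2 k hk l hl)
      refine ⟨x₀ - s • e, hs1, fun k hk => ?_⟩
      rcases List.mem_append.1 hk with hk | hk
      · exact hs2 k hk
      · have hkT := (hρ.mem_iff k).1 hk
        have : f k (x₀ - s • e) = f k x₀ := by simp [h.zero k hkT]
        rw [this]
        exact hf.pos k (h.subset hkT)

/-- Within a run of elements of `S \ T`, a gallery crosses hyperplanes by increasing height. -/
theorem pairwise_run (h : IsModularStep f S T e) (hf : IsPosFamily f S x₀) {u B w : List ι}
    (hr : IsListGallery f S (u ++ (B ++ w))) (hB : ∀ k ∈ B, k ∉ T) {y : V}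
    (hy1 : ∀ k ∈ u, k ∈ T → f k y < 0) (hy2 : ∀ k ∈ w, k ∈ T → 0 < f k y) :
    B.Pairwise fun a b => f a y / f a e < f b y / f b e := by
  have hBn : B.Nodup := (hr.nodup.of_append_right).of_append_left
  refine (pairwise_idxOf hBn).imp_of_mem ?_
  intro a b ha hb hab
  have hne : a ≠ b := by rintro rfl; simp at hab
  obtain ⟨B1, B2, rfl, ha1, hb2⟩ := exists_split_of_idxOf_lt hb hab
  have haS : a ∈ S := (hr.mem_iff a).1 (by simp [ha1])
  have hbS : b ∈ S := (hr.mem_iff b).1 (by simp [hb2])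
  have haT := hB a ha
  have hbT := hB b hb
  obtain ⟨K, hK, -, c, hc, hcmp⟩ := h.exists_compare hf haS haT hbS hbT hne
  obtain ⟨z, hz1, hz2⟩ := hr.exists_point (u ++ B1) (B2 ++ w) (by simp)
  have e1 : f a z / f a e < 0 := div_neg_of_neg_of_pos (hz1 a (by simp [ha1])) (h.pos a haS haT)
  have e2 : 0 < f b z / f b e := div_pos (hz2 b (by simp [hb2])) (h.pos b hbS hbT)
  have e3 : c * f K z < 0 := by rw [← hcmp z]; linarith
  -- The run contains no member of `T`, so the comparing functional `K` lies in `u` or in `w` and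
  -- has the same sign at `y` as at `z`. The comparison of heights therefore transfers from `z` to
  -- `y`.
  have e4 : c * f K y < 0 := by
    have hKr := (hr.mem_iff K).2 (h.subset hK)
    rcases List.mem_append.1 hKr with hu | hu
    · have p1 := hz1 K (by simp [hu])
      have p2 := hy1 K hu hK
      have : 0 < c := by by_contra hcn; nlinarith
      exact mul_neg_of_pos_of_neg this p2
    · rcases List.mem_append.1 hu with hu | hu
      · exact absurd hK (hB K hu)
      · have p1 := hz2 K (by simp [hu])
        have p2 := hy2 K hu hK
        have : c < 0 := by by_contra hcn; nlinarith
        exact mul_neg_of_neg_of_pos this p2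
  have := hcmp y
  linarith

/-- Let `y` and `y'` be points just before and just after crossing `K`; among the functionals of `T`
only `K` changes sign between them. Hence the height order at `y` and `y'` differs exactly on pairs
whose flat contains `K`. The run after `K` is sorted by height at `y'` and starts with `H`. The rest
of the flat of `K` and `H` must lie in this run, and below everything else in it, so together with
`K` it forms a block. In the reversed block the fibre part is crossed over `y`, where its height
order is reversed, and only then `K`. -/
theorem exists_flip_of_descent (h : IsModularStep f S T e) (hf : IsPosFamily f S x₀)
    {u B w : List ι} {K H : ι} (hr : IsListGallery f S (u ++ K :: ((H :: B) ++ w))) (hK : K ∈ T)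
    (hB : ∀ k ∈ H :: B, k ∉ T) (hw : ∀ k ∈ w, k ∈ T) :
    ∃ r', FlipAt f S (line f S K H) (u ++ K :: ((H :: B) ++ w)) r' := by
  set C := H :: B with hC
  have hHC : H ∈ C := by simp [hC]
  have hrS := hr.mem_iff
  have hKS := h.subset hK
  have hCS : ∀ k ∈ C, k ∈ S := fun k hk => (hrS k).1 (by simp [hk])
  have hHS := hCS H hHC
  have hHT := hB H hHC
  have hKH : K ≠ H := by rintro rfl; exact hHT hK
  have hKu : K ∉ u := fun hk => List.disjoint_of_nodup_append hr.nodup hk (by simp)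
  obtain ⟨y, hy1, hy2⟩ := hr.exists_point u _ rfl
  obtain ⟨y', hy1', hy2'⟩ := hr.exists_point (u ++ [K]) (C ++ w) (by simp)
  set τ : V → ι → ℝ := fun x k => f k x / f k e with hτ
  -- the run `C` is ordered by height at `y'`
  have hsort : C.Pairwise fun a b => τ y' a < τ y' b := by
    have hr2 : IsListGallery f S ((u ++ [K]) ++ (C ++ w)) := by simpa using hr
    exact h.pairwise_run hf hr2 hB (fun k hk _ => hy1' k hk) (fun k hk _ => hy2' k (by simp [hk]))
  have hyK : 0 < f K y := hy2 K (by simp)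
  have hyK' : f K y' < 0 := hy1' K (by simp)
  -- comparisons at `y` and `y'`
  have hcomp_same : ∀ a ∈ S, a ∉ T → ∀ b ∈ S, b ∉ T → a ≠ b → K ∉ line f S a b →
      (τ y a < τ y b ↔ τ y' a < τ y' b) := by
    intro a ha haT b hb hbT hab hKl
    obtain ⟨K', hK', hK'l, c, hc, hcmp⟩ := h.exists_compare hf ha haT hb hbT hab
    have hne : K' ≠ K := by rintro rfl; exact hKl hK'l
    have e1 := hcmp y
    have e2 := hcmp y'
    have hKr := (hrS K').2 (h.subset hK')
    have hs : (f K' y < 0 ∧ f K' y' < 0) ∨ (0 < f K' y ∧ 0 < f K' y') := by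
      rcases List.mem_append.1 hKr with hu | hu
      · exact Or.inl ⟨hy1 K' hu, hy1' K' (by simp [hu])⟩
      · refine Or.inr ⟨hy2 K' hu, hy2' K' ?_⟩
        exact (List.mem_cons.1 hu).resolve_left hne
    have i1 : τ y a < τ y b ↔ c * f K' y < 0 := by
      rw [← e1]; constructor <;> intro h <;> simp only [hτ] at * <;> linarith
    have i2 : τ y' a < τ y' b ↔ c * f K' y' < 0 := by
      rw [← e2]; constructor <;> intro h <;> simp only [hτ] at * <;> linarith
    rw [i1, i2]
    simp only [mul_neg_iff]
    rcases hs with ⟨p, q⟩ | ⟨p, q⟩ <;> simp [p, q, not_lt_of_gt]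
  have hcomp_flip : ∀ a ∈ S, a ∉ T → ∀ b ∈ S, b ∉ T → a ≠ b → K ∈ line f S a b →
      (τ y a < τ y b ↔ τ y' b < τ y' a) := by
    intro a ha haT b hb hbT hab hKl
    obtain ⟨K', hK', hK'l, c, hc, hcmp⟩ := h.exists_compare hf ha haT hb hbT hab
    -- The flat of `a` and `b` leaves `T`, so `K` is its only member in `T` and must be the
    -- comparing functional.
    have hK'K : K' = K := by
      refine h.mem_unique hf ha haT hK hK' ?_
      have hKa : K ≠ a := by rintro rfl; exact haT hK
      rw [hf.line_eq ha hb hKa hKl (left_mem_line ha)]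
      exact hK'l
    subst hK'K
    have e1 := hcmp y
    have e2 := hcmp y'
    have i1 : τ y a < τ y b ↔ c * f K' y < 0 := by
      rw [← e1]; constructor <;> intro h <;> simp only [hτ] at * <;> linarith
    have i2 : τ y' b < τ y' a ↔ 0 < c * f K' y' := by
      rw [← e2]; constructor <;> intro h <;> simp only [hτ] at * <;> linarith
    rw [i1, i2, mul_neg_iff, mul_pos_iff]
    simp [hyK, hyK', not_lt_of_gt]
  have hLmem : ∀ a ∈ S, a ∉ T → ∀ b ∈ S, b ∉ T → a ≠ b → a ∈ line f S K H →
      (K ∈ line f S a b ↔ b ∈ line f S K H) := by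
    intro a ha haT b hb hbT hab haL
    have hKa : K ≠ a := by rintro rfl; exact haT hK
    have hL : line f S K a = line f S K H := hf.line_eq hKS hHS hKa (left_mem_line hKS) haL
    rw [← hL]
    constructor
    · intro hKl
      rw [hf.line_eq ha hb hKa hKl (left_mem_line ha)]
      exact right_mem_line hb
    · intro hbl
      rw [hf.line_eq hKS ha hab (right_mem_line ha) hbl]
      exact left_mem_line hKS
  have hHL : H ∈ line f S K H := right_mem_line hHS
  have hhead : ∀ a ∈ C, a ≠ H → τ y' H < τ y' a := by
    intro a ha hne
    have := (List.pairwise_cons.1 (hC ▸ hsort)).1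
    exact this a ((List.mem_cons.1 (hC ▸ ha)).resolve_left hne)
  -- all of the flat except `K` lies in the run
  have hLC : ∀ a ∈ line f S K H, a ≠ K → a ∈ C := by
    intro a ha hne
    have haT : a ∉ T := fun haT => hne (h.mem_unique hf hHS hHT hK haT ha)
    have har := (hrS a).2 ha.1
    rcases List.mem_append.1 har with hu | hu
    -- A member crossed before `K` would have negative height, and `H` positive height, at both `y`
    -- and `y'`; but crossing `K` reverses their comparison.
    · exfalso
      have haH : a ≠ H := by
        rintro rfl
        exact List.disjoint_of_nodup_append hr.nodup hu (by simp [hC])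
      have hKl := (hLmem a ha.1 haT H hHS hHT haH ha).2 hHL
      have pa := h.pos a ha.1 haT
      have pH := h.pos H hHS hHT
      have e1 : τ y a < τ y H := lt_trans (div_neg_of_neg_of_pos (hy1 a hu) pa)
        (div_pos (hy2 H (by simp [hC])) pH)
      have e2 : τ y' a < τ y' H := lt_trans (div_neg_of_neg_of_pos (hy1' a (by simp [hu])) pa)
        (div_pos (hy2' H (by simp [hC])) pH)
      exact lt_asymm e2 ((hcomp_flip a ha.1 haT H hHS hHT haH hKl).1 e1)
    · rcases List.mem_cons.1 hu with hu | hu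
      · exact absurd hu hne
      · exact (List.mem_append.1 hu).resolve_right fun hw' => haT (hw a hw')
  -- the flat comes first, at `y` and at `y'`
  have hfirst : ∀ a ∈ C, a ∈ line f S K H → ∀ b ∈ C, b ∉ line f S K H →
      τ y a < τ y b ∧ τ y' a < τ y' b := by
    intro a ha haL b hb hbL
    have hbH : b ≠ H := by rintro rfl; exact hbL hHL
    -- `H` heads the run at `y'`, and its comparison with `b` does not involve `K`.
    have hHb : τ y H < τ y b :=
      (hcomp_same H hHS hHT b (hCS b hb) (hB b hb) hbH.symm
        fun hKl => hbL ((hLmem H hHS hHT b (hCS b hb) (hB b hb) hbH.symm hHL).1 hKl)).2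
        (hhead b hb hbH)
    have hab : a ≠ b := by rintro rfl; exact hbL haL
    have h1 : τ y a < τ y b := by
      by_cases haH : a = H
      · rw [haH]; exact hHb
      · refine lt_trans ((hcomp_flip a (hCS a ha) (hB a ha) H hHS hHT haH ?_).2
          (hhead a ha haH)) hHb
        exact (hLmem a (hCS a ha) (hB a ha) H hHS hHT haH haL).2 hHL
    refine ⟨h1, (hcomp_same a (hCS a ha) (hB a ha) b (hCS b hb) (hB b hb) hab fun hKl =>
      hbL ((hLmem a (hCS a ha) (hB a ha) b (hCS b hb) (hB b hb) hab haL).1 hKl)).1 h1⟩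
  set C1 := C.filter (· ∈ line f S K H) with hC1
  set C2 := C.filter (fun k => !decide (k ∈ line f S K H)) with hC2
  have mC1 : ∀ k, k ∈ C1 ↔ k ∈ C ∧ k ∈ line f S K H := fun k => by simp [hC1]
  have mC2 : ∀ k, k ∈ C2 ↔ k ∈ C ∧ k ∉ line f S K H := fun k => by simp [hC2]
  -- The run is sorted at `y'` and the flat lies below the rest there, so the flat is an initial
  -- segment of the run.
  have hsplit : C = C1 ++ C2 := by
    refine (eq_of_pairwise_lt (τ y') ?_ hsort (List.filter_append_perm _ C)).symm
    refine List.pairwise_append.2 ⟨hsort.filter _, hsort.filter _, fun a ha b hb => ?_⟩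
    exact (hfirst a ((mC1 a).1 ha).1 ((mC1 a).1 ha).2 b ((mC2 b).1 hb).1 ((mC2 b).1 hb).2).2
  have hC1sort : C1.reverse.Pairwise fun a b => τ y a < τ y b := by
    rw [List.pairwise_reverse]
    refine (hsort.filter (· ∈ line f S K H)).imp_of_mem ?_
    intro a b ha hb hab
    have ha' := (mC1 a).1 ha
    have hb' := (mC1 b).1 hb
    have hne : b ≠ a := by rintro rfl; exact lt_irrefl _ hab
    refine (hcomp_flip b (hCS b hb'.1) (hB b hb'.1) a (hCS a ha'.1) (hB a ha'.1) hne ?_).2 hab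
    exact (hLmem b (hCS b hb'.1) (hB b hb'.1) a (hCS a ha'.1) (hB a ha'.1) hne hb'.2).2 ha'.2
  -- the chambers of the fibre through `y`
  have hfib : ∀ c d, C1.reverse = c ++ d →
      ∃ x, (∀ k ∈ u ++ c, f k x < 0) ∧ ∀ k ∈ d ++ K :: (C2 ++ w), 0 < f k x := by
    intro c d hcd
    have hcC : ∀ k ∈ c, k ∈ C ∧ k ∈ line f S K H := fun k hk =>
      (mC1 k).1 (List.mem_reverse.1 (by rw [hcd]; simp [hk]))
    have hdC : ∀ k ∈ d, k ∈ C ∧ k ∈ line f S K H := fun k hk =>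
      (mC1 k).1 (List.mem_reverse.1 (by rw [hcd]; simp [hk]))
    have hdC' : ∀ k ∈ d ++ C2, k ∈ C := by
      intro k hk
      rcases List.mem_append.1 hk with hk | hk
      · exact (hdC k hk).1
      · exact ((mC2 k).1 hk).1
    have muT : ∀ k, k ∈ u.filter (fun k => !decide (k ∈ T)) ↔ k ∈ u ∧ k ∉ T := fun k => by simp
    -- Over `y` the heights of `u \ T` are negative and those of the run positive, with `C1.reverse`
    -- lowest and increasing; a cut inside `C1.reverse` is thus a cut of heights.
    obtain ⟨s, hs1, hs2⟩ := exists_shift h.pos y (u.filter (fun k => !decide (k ∈ T)) ++ c) (d ++ C2)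
      (by
        intro k hk
        rcases List.mem_append.1 hk with hk | hk
        · exact ⟨(hrS k).1 (by simp [((muT k).1 hk).1]), ((muT k).1 hk).2⟩
        · exact ⟨hCS k (hcC k hk).1, hB k (hcC k hk).1⟩)
      (fun k hk => ⟨hCS k (hdC' k hk), hB k (hdC' k hk)⟩)
      (by
        intro k hk l hl
        have hlC := hdC' l hl
        rcases List.mem_append.1 hk with hk | hk
        · have hku := (muT k).1 hk
          exact lt_trans (div_neg_of_neg_of_pos (hy1 k hku.1)
            (h.pos k ((hrS k).1 (by simp [hku.1])) hku.2))
            (div_pos (hy2 l (by simp [hlC])) (h.pos l (hCS l hlC) (hB l hlC)))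
        · rcases List.mem_append.1 hl with hl | hl
          · exact (List.pairwise_append.1 (hcd ▸ hC1sort)).2.2 k hk l hl
          · exact (hfirst k (hcC k hk).1 (hcC k hk).2 l hlC ((mC2 l).1 hl).2).1)
    have hT : ∀ k ∈ T, f k (y - s • e) = f k y := fun k hk => by simp [h.zero k hk]
    refine ⟨y - s • e, fun k hk => ?_, fun k hk => ?_⟩
    · rcases List.mem_append.1 hk with hk | hk
      · by_cases hkT : k ∈ T
        · rw [hT k hkT]; exact hy1 k hk
        · exact hs1 k (List.mem_append_left _ ((muT k).2 ⟨hk, hkT⟩))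
      · exact hs1 k (by simp [hk])
    · simp only [List.mem_append, List.mem_cons] at hk
      rcases hk with hk | rfl | hk | hk
      · exact hs2 k (by simp [hk])
      · rw [hT k hK]; exact hyK
      · exact hs2 k (by simp [hk])
      · rw [hT k (hw k hk)]; exact hy2 k (by simp [hk])
  have hre : u ++ K :: (C ++ w) = u ++ (K :: C1) ++ (C2 ++ w) := by
    conv_lhs => rw [hsplit]
    simp
  have hperm : (u ++ (K :: C1).reverse ++ (C2 ++ w)).Perm (u ++ (K :: C1) ++ (C2 ++ w)) :=
    ((List.reverse_perm _).append_left u).append_right _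
  refine ⟨u ++ (K :: C1).reverse ++ (C2 ++ w), hr, ⟨?_, fun k => ?_, fun p q hpq => ?_⟩,
    line_mem_lines hKS hHS hKH, u, K :: C1, C2 ++ w, hre, rfl, fun k => ?_⟩
  · exact hperm.nodup_iff.2 (hre ▸ hr.nodup)
  · rw [hperm.mem_iff, ← hre, hrS]
  · have hpq' : (u ++ C1.reverse) ++ K :: (C2 ++ w) = p ++ q := by rw [← hpq]; simp
    -- Cuts before the block, or at or after its end, have the same prefix set as a cut of the
    -- original gallery. Cuts within the reversed flat, up to just before `K`, are realized over
    -- `y`.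
    rcases List.append_eq_append_iff.1 hpq' with ⟨t, rfl, ht⟩ | ⟨t, ht, rfl⟩
    · cases t with
      | nil =>
        obtain ⟨x, hx1, hx2⟩ := hfib C1.reverse [] (by simp)
        rw [List.nil_append] at ht
        exact ⟨x, by simpa using hx1, by rw [← ht]; simpa using hx2⟩
      | cons K' t =>
        rw [List.cons_append, List.cons.injEq] at ht
        obtain ⟨rfl, ht⟩ := ht
        obtain ⟨x, hx1, hx2⟩ := hr.exists_point (u ++ (K :: C1) ++ t) q (by
          rw [hre, ht]; simp)
        refine ⟨x, fun k hk => hx1 k ?_, hx2⟩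
        simp only [List.mem_append, List.mem_cons, List.mem_reverse] at hk ⊢
        tauto
    · rcases List.append_eq_append_iff.1 ht with ⟨a, rfl, ha⟩ | ⟨a, rfl, rfl⟩
      · exact hfib a t ha
      · obtain ⟨x, hx1, hx2⟩ := hr.exists_point p (a ++ (K :: C1) ++ (C2 ++ w)) (by
          rw [hre]; simp)
        refine ⟨x, hx1, fun k hk => hx2 k ?_⟩
        simp only [List.mem_append, List.mem_cons, List.mem_reverse] at hk ⊢
        tauto
  · rw [List.mem_cons, mC1]
    constructor
    · rintro (rfl | hk)
      · exact left_mem_line hKS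
      · exact hk.2
    · intro hk
      by_cases hkK : k = K
      · exact Or.inl hkK
      · exact Or.inr ⟨hLC k hk hkK, hk⟩

/-- The gallery `σ ++ ρ₀` crosses `S \ T` before `T`. Thus any gallery in which some `K ∈ T`
precedes a later `H ∉ T` disagrees with it on the flat of `K` and `H`, and the last descent provides
a flip there. -/
theorem exists_accessible (h : IsModularStep f S T e) (hf : IsPosFamily f S x₀) (hfin : S.Finite)
    {ρ₀ : List ι} (hρ₀ : IsAccessible f T ρ₀) : ∃ r₀, IsAccessible f S r₀ := by
  obtain ⟨σ, hσn, hσ, hσp⟩ := h.exists_fibre hf hfin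
  have hg₀ := h.gallery_append hf hσn hσ hσp hρ₀.1
  refine ⟨σ ++ ρ₀, hg₀, fun r hr hne => ?_⟩
  rcases last_descent (· ∈ T) r with ⟨s, t, rfl, hs, ht⟩ | ⟨u, K, H, B, w, rfl, hK, hB, hw⟩
  · have hst : ∀ k, k ∈ s ↔ k ∈ σ := by
      intro k
      rw [hσ, ← hr.mem_iff, List.mem_append]
      have h1 := hs k
      have h2 := ht k
      tauto
    -- No functional of `T` has been crossed yet, so the run `s` is sorted by height at the base
    -- point, which forces it to be `σ`. The problem reduces to the tail in `T`.
    have hsort : s.Pairwise fun a b => f a x₀ / f a e < f b x₀ / f b e :=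
      h.pairwise_run hf (u := []) hr hs (by simp) fun k _ hkT => hf.pos k (h.subset hkT)
    obtain rfl : s = σ := eq_of_pairwise_lt (fun k => f k x₀ / f k e) hsort hσp
      (perm_of_nodup_of_mem_iff hr.nodup.of_append_left hσn hst)
    have htg : IsListGallery f T t := by
      refine ⟨hr.nodup.of_append_right, fun k => ⟨ht k, fun hk => ?_⟩, fun u v huv => ?_⟩
      · have := (hr.mem_iff k).2 (h.subset hk)
        exact (List.mem_append.1 this).resolve_left fun hks => hs k hks hk
      · obtain ⟨x, hx1, hx2⟩ := hr.exists_point (s ++ u) v (by rw [huv]; simp)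
        exact ⟨x, fun k hk => hx1 k (by simp [hk]), hx2⟩
    obtain ⟨L, hL, t', hf'⟩ := hρ₀.2 t htg fun ht' => hne (by rw [ht'])
    refine ⟨L, ⟨h.lines_subset hL.1, fun heq => hL.2 ?_⟩, s ++ t', hr,
      h.gallery_append hf hσn hσ hσp hf'.2.1, h.lines_subset hL.1, ?_⟩
    · rw [List.filter_append, List.filter_append] at heq
      exact List.append_cancel_left heq
    · obtain ⟨-, -, -, u, m, v, rfl, rfl, hm⟩ := hf'
      exact ⟨s ++ u, m, v, by simp, by simp, hm⟩
  · obtain ⟨r', hr'⟩ := h.exists_flip_of_descent hf hr hK hB hw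
    refine ⟨_, ⟨hr'.2.2.1, fun heq => ?_⟩, r', hr'⟩
    have hKS := h.subset hK
    have hHS : H ∈ S := (hr.mem_iff H).1 (by simp)
    have hHT := hB H (by simp)
    have hKH : K ≠ H := by rintro rfl; exact hHT hK
    -- The flat of `K` and `H` does separate: `K` precedes `H` in the given gallery and follows it
    -- in `σ ++ ρ₀`.
    have hag := agree_of_filter_eq hr hg₀ hr'.2.2.1 heq (left_mem_line hKS) (right_mem_line hHS) hKH
    have h1 : (u ++ K :: (H :: B ++ w)).idxOf K < (u ++ K :: (H :: B ++ w)).idxOf H := by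
      have hnd := hr.nodup
      have e : u ++ K :: (H :: B ++ w) = (u ++ [K]) ++ (H :: B ++ w) := by simp
      rw [e] at hnd ⊢
      exact idxOf_lt_of_split hnd (by simp) (by simp)
    have h2 : (σ ++ ρ₀).idxOf H < (σ ++ ρ₀).idxOf K :=
      idxOf_lt_of_split hg₀.nodup ((hσ H).2 ⟨hHS, hHT⟩) ((hρ₀.1.mem_iff K).2 hK)
    have := hag.1 h1
    omega

end IsModularStep

theorem HasModularChain.exists_accessible (hS : HasModularChain f S) (hf : IsPosFamily f S x₀) :
    ∃ r₀, IsAccessible f S r₀ := by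
  induction hS with
  | empty =>
    refine ⟨[], ⟨List.nodup_nil, by simp, fun u v huv => ?_⟩, fun r hr hne => ?_⟩
    · obtain ⟨rfl, rfl⟩ := List.append_eq_nil_iff.1 huv.symm
      exact ⟨0, by simp⟩
    · exact absurd (List.eq_nil_iff_forall_not_mem.2 fun k hk => (hr.mem_iff k).1 hk) hne
  | step hfin h hT ih =>
    obtain ⟨ρ₀, hρ₀⟩ := ih (hf.mono h.subset)
    exact h.exists_accessible hf hfin hρ₀

end ListGallery

/-! ### Codimension-two intersection subspaces as rank-two flats. -/

namespace ListGallery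

open scoped Classical

section Flats

variable {V ι : Type*} [AddCommGroup V] [Module ℝ V]

theorem exists_eq_smul_of_ker_le {g h : Module.Dual ℝ V}
    (hk : LinearMap.ker g ≤ LinearMap.ker h) : ∃ α : ℝ, h = α • g := by
  by_cases hg : ∃ x, g x ≠ 0
  · obtain ⟨x, hx⟩ := hg
    refine ⟨h x / g x, LinearMap.ext fun z => ?_⟩
    have hz : z - (g z / g x) • x ∈ LinearMap.ker g := by
      rw [LinearMap.mem_ker, map_sub, map_smul, smul_eq_mul, div_mul_cancel₀ _ hx, sub_self]
    have := hk hz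
    rw [LinearMap.mem_ker, map_sub, map_smul, smul_eq_mul, sub_eq_zero] at this
    rw [this, LinearMap.smul_apply, smul_eq_mul]
    ring
  · push Not at hg
    refine ⟨0, LinearMap.ext fun z => ?_⟩
    have : z ∈ LinearMap.ker h := hk (hg z)
    simpa using this

variable {f : ι → Module.Dual ℝ V} {S : Set ι} {x₀ : V}

theorem IsPosFamily.not_ker_le (h : IsPosFamily f S x₀) {a b : ι} (ha : a ∈ S) (hb : b ∈ S)
    (hab : a ≠ b) : ¬ LinearMap.ker (f a) ≤ LinearMap.ker (f b) := by
  intro hle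
  obtain ⟨α, hα⟩ := exists_eq_smul_of_ker_le hle
  exact hab (h.inj b hb a ha α hα).symm

/-- Dual vectors to two non-proportional functionals. -/
theorem IsPosFamily.exists_dual (h : IsPosFamily f S x₀) {a b : ι} (ha : a ∈ S) (hb : b ∈ S)
    (hab : a ≠ b) : ∃ x, f a x = 0 ∧ f b x = 1 := by
  obtain ⟨x, hx, hx'⟩ := Set.not_subset.1 (h.not_ker_le ha hb hab)
  have hx1 : f a x = 0 := hx
  have hx2 : f b x ≠ 0 := hx'
  exact ⟨(f b x)⁻¹ • x, by simp [hx1], by simp [hx2]⟩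

/-- Vectors dual to `f a` and `f b` reduce any `z` modulo the common kernel; the coefficients are
the values of `f k` at them. This matches containment of subspaces with linear combination of
functionals. -/
theorem IsPosFamily.mem_line_iff (h : IsPosFamily f S x₀) {a b k : ι} (ha : a ∈ S) (hb : b ∈ S)
    (hab : a ≠ b) (hk : k ∈ S) :
    k ∈ line f S a b ↔ LinearMap.ker (f a) ⊓ LinearMap.ker (f b) ≤ LinearMap.ker (f k) := by
  constructor
  · rintro ⟨-, α, β, hl⟩ x ⟨hxa, hxb⟩
    have h1 : f a x = 0 := hxa
    have h2 : f b x = 0 := hxb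
    rw [LinearMap.mem_ker, hl]
    simp [h1, h2]
  · intro hle
    obtain ⟨x, hxa, hxb⟩ := h.exists_dual ha hb hab
    obtain ⟨y, hyb, hya⟩ := h.exists_dual hb ha hab.symm
    refine ⟨hk, f k y, f k x, LinearMap.ext fun z => ?_⟩
    have hz : z - f a z • y - f b z • x ∈ LinearMap.ker (f k) := by
      apply hle
      constructor
      · change f a _ = 0
        simp [hxa, hya]
      · change f b _ = 0
        simp [hxb, hyb]
    rw [LinearMap.mem_ker] at hz
    simp only [map_sub, map_smul, smul_eq_mul, LinearMap.add_apply, LinearMap.smul_apply] at hz ⊢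
    linarith

theorem IsPosFamily.finrank_quotient (h : IsPosFamily f S x₀) {a b : ι} (ha : a ∈ S) (hb : b ∈ S)
    (hab : a ≠ b) :
    Module.finrank ℝ (V ⧸ (LinearMap.ker (f a) ⊓ LinearMap.ker (f b))) = 2 := by
  have hsurj : Function.Surjective ((f a).prod (f b)) := by
    rintro ⟨p, q⟩
    obtain ⟨x, hxa, hxb⟩ := h.exists_dual ha hb hab
    obtain ⟨y, hyb, hya⟩ := h.exists_dual hb ha hab.symm
    exact ⟨p • y + q • x, by simp [hxa, hxb, hya, hyb]⟩
  rw [← LinearMap.ker_prod, (LinearMap.quotKerEquivOfSurjective _ hsurj).finrank_eq]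
  simp

theorem IsPosFamily.finrank_quotient_ker (h : IsPosFamily f S x₀) {a : ι} (ha : a ∈ S) :
    Module.finrank ℝ (V ⧸ LinearMap.ker (f a)) = 1 := by
  have hsurj : Function.Surjective (f a) :=
    LinearMap.surjective fun h0 => by have := h.pos a ha; simp [h0] at this
  rw [((f a).quotKerEquivOfSurjective hsurj).finrank_eq]
  simp

variable {A : Set (Submodule ℝ V)}

/-- An intersection of codimension two involves two distinct hyperplanes of its defining set; their
intersection already has codimension two and contains it. -/
theorem mem_flats_two_iff [FiniteDimensional ℝ V] (h : IsPosFamily f S x₀)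
    (hA : A = (fun k => LinearMap.ker (f k)) '' S) {X : Submodule ℝ V} :
    X ∈ flats A 2 ↔ ∃ a ∈ S, ∃ b ∈ S, a ≠ b ∧ X = LinearMap.ker (f a) ⊓ LinearMap.ker (f b) := by
  constructor
  · rintro ⟨⟨A', hA', rfl⟩, hX⟩
    obtain ⟨H, hH⟩ : A'.Nonempty := by
      by_contra hne
      rw [Set.not_nonempty_iff_eq_empty] at hne
      rw [hne, sInf_empty] at hX
      have := Submodule.finrank_quotient_add_finrank (⊤ : Submodule ℝ V)
      rw [finrank_top] at this
      omega
    obtain ⟨a, ha, rfl⟩ : H ∈ (fun k => LinearMap.ker (f k)) '' S := hA ▸ hA' hH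
    obtain ⟨H', hH', hle⟩ : ∃ H' ∈ A', ¬ LinearMap.ker (f a) ≤ H' := by
      by_contra hcon
      push Not at hcon
      have : sInf A' = LinearMap.ker (f a) := le_antisymm (sInf_le hH) (le_sInf hcon)
      rw [this, h.finrank_quotient_ker ha] at hX
      omega
    obtain ⟨b, hb, rfl⟩ : H' ∈ (fun k => LinearMap.ker (f k)) '' S := hA ▸ hA' hH'
    have hab : a ≠ b := by rintro rfl; exact hle le_rfl
    refine ⟨a, ha, b, hb, hab, Submodule.eq_of_le_of_finrank_eq (le_inf (sInf_le hH) (sInf_le hH')) ?_⟩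
    have h1 := Submodule.finrank_quotient_add_finrank (sInf A')
    have h2 := Submodule.finrank_quotient_add_finrank (LinearMap.ker (f a) ⊓ LinearMap.ker (f b))
    rw [h.finrank_quotient ha hb hab] at h2
    omega
  · rintro ⟨a, ha, b, hb, hab, rfl⟩
    refine ⟨⟨{LinearMap.ker (f a), LinearMap.ker (f b)}, ?_, by simp⟩,
      h.finrank_quotient ha hb hab⟩
    rw [hA]
    rintro _ (rfl | rfl)
    · exact ⟨a, ha, rfl⟩
    · exact ⟨b, hb, rfl⟩

/-- The functionals vanishing on `X`. -/
def above (f : ι → Module.Dual ℝ V) (S : Set ι) (X : Submodule ℝ V) : Set ι :=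
  {k | k ∈ S ∧ X ≤ LinearMap.ker (f k)}

theorem above_inf (h : IsPosFamily f S x₀) {a b : ι} (ha : a ∈ S) (hb : b ∈ S) (hab : a ≠ b) :
    above f S (LinearMap.ker (f a) ⊓ LinearMap.ker (f b)) = line f S a b := by
  ext k
  constructor
  · rintro ⟨hk, hle⟩
    exact (h.mem_line_iff ha hb hab hk).2 hle
  · intro hk
    exact ⟨hk.1, (h.mem_line_iff ha hb hab hk.1).1 hk⟩

theorem above_image_flats [FiniteDimensional ℝ V] (h : IsPosFamily f S x₀)
    (hA : A = (fun k => LinearMap.ker (f k)) '' S) : above f S '' flats A 2 = lines f S := by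
  ext L
  constructor
  · rintro ⟨X, hX, rfl⟩
    obtain ⟨a, ha, b, hb, hab, rfl⟩ := (mem_flats_two_iff h hA).1 hX
    exact ⟨a, ha, b, hb, hab, above_inf h ha hb hab⟩
  · rintro ⟨a, ha, b, hb, hab, rfl⟩
    exact ⟨_, (mem_flats_two_iff h hA).2 ⟨a, ha, b, hb, hab, rfl⟩, above_inf h ha hb hab⟩

theorem above_injOn [FiniteDimensional ℝ V] (h : IsPosFamily f S x₀)
    (hA : A = (fun k => LinearMap.ker (f k)) '' S) : Set.InjOn (above f S) (flats A 2) := by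
  have key : ∀ X ∈ flats A 2, ∀ Y ∈ flats A 2, above f S X = above f S Y → Y ≤ X := by
    intro X hX Y hY hXY
    obtain ⟨a, ha, b, hb, hab, rfl⟩ := (mem_flats_two_iff h hA).1 hX
    rw [above_inf h ha hb hab] at hXY
    have h1 : a ∈ above f S Y := hXY ▸ left_mem_line ha
    have h2 : b ∈ above f S Y := hXY ▸ right_mem_line hb
    exact le_inf h1.2 h2.2
  exact fun X hX Y hY hXY => le_antisymm (key Y hY X hX hXY.symm) (key X hX Y hY hXY)

theorem flats_two_encard [FiniteDimensional ℝ V] (h : IsPosFamily f S x₀)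
    (hA : A = (fun k => LinearMap.ker (f k)) '' S) :
    (flats A 2).encard = (lines f S).encard := by
  rw [← above_image_flats h hA, (above_injOn h hA).encard_image]

end Flats

end ListGallery

/-! ### Chambers determined by signs. -/

namespace HyperplaneArrangement

open ListGallery

section Cut

variable {W : Type*} [AddCommGroup W] [Module ℝ W] [TopologicalSpace W]

theorem Chamber.pos_of_pos {B : Set (Submodule ℝ W)} (c : Chamber B) {g : Module.Dual ℝ W}
    (hg : Continuous g) (hB : LinearMap.ker g ∈ B) {x y : W} (hx : x ∈ c.1) (hy : y ∈ c.1)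
    (h : 0 < g x) : 0 < g y := by
  have hpre : IsPreconnected c.1 := by
    obtain ⟨c, x, hx, rfl⟩ := c
    exact isPreconnected_connectedComponentIn
  by_contra hn
  obtain ⟨z, hz, hz0⟩ := hpre.intermediate_value hy hx hg.continuousOn ⟨not_lt.1 hn, h.le⟩
  exact c.subset hz _ hB hz0

theorem Chamber.apply_ne_zero {B : Set (Submodule ℝ W)} (c : Chamber B) {g : Module.Dual ℝ W}
    (hB : LinearMap.ker g ∈ B) {x : W} (hx : x ∈ c.1) : g x ≠ 0 :=
  fun h => c.subset hx _ hB h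

theorem Chamber.neg_of_neg {B : Set (Submodule ℝ W)} (c : Chamber B) {g : Module.Dual ℝ W}
    (hg : Continuous g) (hB : LinearMap.ker g ∈ B) {x y : W} (hx : x ∈ c.1) (hy : y ∈ c.1)
    (h : g x < 0) : g y < 0 := by
  by_contra hn
  have := lt_of_le_of_ne (not_lt.1 hn) (c.apply_ne_zero hB hy).symm
  exact lt_asymm h (c.pos_of_pos hg hB hy hx this)

/-- Any functional with the same kernel is a nonzero multiple and signs are constant on chambers, so
separation can be tested at one point of each chamber with one fixed functional. -/
theorem separates_iff {B : Set (Submodule ℝ W)} {c c' : Chamber B} {g : Module.Dual ℝ W}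
    (hg : Continuous g) (hB : LinearMap.ker g ∈ B) {x y : W} (hx : x ∈ c.1) (hy : y ∈ c'.1) :
    Separates (LinearMap.ker g) c.1 c'.1 ↔ g x * g y < 0 := by
  constructor
  · rintro ⟨g', hk, h1, h2⟩
    obtain ⟨α, rfl⟩ := exists_eq_smul_of_ker_le hk.le
    have hα : α ≠ 0 := by
      rintro rfl
      exact c.apply_ne_zero hB hx (by simp)
    have := mul_neg_of_pos_of_neg (h1 x hx) (h2 y hy)
    simp only [LinearMap.smul_apply, smul_eq_mul]
    nlinarith [mul_self_pos.2 hα]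
  · intro h
    rcases mul_neg_iff.1 h with ⟨p, q⟩ | ⟨p, q⟩
    · exact ⟨g, rfl, fun z hz => c.pos_of_pos hg hB hx hz p, fun z hz => c'.neg_of_neg hg hB hy hz q⟩
    · refine Separates.symm ⟨g, rfl, fun z hz => c'.pos_of_pos hg hB hy hz q, fun z hz =>
        c.neg_of_neg hg hB hx hz p⟩

theorem separates_trans_iff {B : Set (Submodule ℝ W)} {c c' c'' : Chamber B} {g : Module.Dual ℝ W}
    (hg : Continuous g) (hB : LinearMap.ker g ∈ B) :
    Separates (LinearMap.ker g) c.1 c''.1 ↔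
      ¬ (Separates (LinearMap.ker g) c.1 c'.1 ↔ Separates (LinearMap.ker g) c'.1 c''.1) := by
  obtain ⟨x, hx⟩ := c.nonempty
  obtain ⟨y, hy⟩ := c'.nonempty
  obtain ⟨z, hz⟩ := c''.nonempty
  rw [separates_iff hg hB hx hy, separates_iff hg hB hy hz, separates_iff hg hB hx hz]
  simp only [mul_neg_iff]
  rcases (c.apply_ne_zero hB hx).lt_or_gt with h1 | h1 <;>
  rcases (c'.apply_ne_zero hB hy).lt_or_gt with h2 | h2 <;>
  rcases (c''.apply_ne_zero hB hz).lt_or_gt with h3 | h3 <;>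
  simp [h1, h2, h3, not_lt_of_gt]

/-- The segment joining points of two unseparated chambers avoids every hyperplane, since a convex
combination of two nonzero reals of equal sign is nonzero. Hence both chambers are the same
component. -/
theorem Chamber.eq_of_not_separates [IsTopologicalAddGroup W] [ContinuousSMul ℝ W]
    {B : Set (Submodule ℝ W)} (hcut : ∀ H ∈ B, ∃ g : Module.Dual ℝ W, Continuous g ∧ LinearMap.ker g = H)
    {c c' : Chamber B} (h : ∀ H ∈ B, ¬ Separates H c.1 c'.1) : c = c' := by
  obtain ⟨x, hx⟩ := c.nonempty
  obtain ⟨y, hy⟩ := c'.nonempty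
  have hcx : c.1 = connectedComponentIn (complement B) x := by
    obtain ⟨c, z, hz, rfl⟩ := c
    exact connectedComponentIn_eq hx
  have hcy : c'.1 = connectedComponentIn (complement B) y := by
    obtain ⟨c', z, hz, rfl⟩ := c'
    exact connectedComponentIn_eq hy
  have hseg : segment ℝ x y ⊆ complement B := by
    rintro z ⟨p, q, hp, hq, hpq, rfl⟩ H hH hz
    obtain ⟨g, hg, rfl⟩ := hcut H hH
    have hs := h _ hH
    rw [separates_iff hg hH hx hy] at hs
    have hxn := c.apply_ne_zero hH hx
    have hyn := c'.apply_ne_zero hH hy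
    have hz' : p * g x + q * g y = 0 := by simpa using hz
    have hpos : 0 < g x * g y := lt_of_le_of_ne (not_lt.1 hs) (mul_ne_zero hxn hyn).symm
    have e1 : p * (g x * g x) + q * (g x * g y) = 0 := by linear_combination g x * hz'
    have h1 := mul_self_pos.2 hxn
    have h2 := mul_nonneg hp h1.le
    have h3 := mul_nonneg hq hpos.le
    have p0 : p = 0 := (mul_eq_zero.1 (by linarith : p * (g x * g x) = 0)).resolve_right h1.ne'
    have q0 : q = 0 := (mul_eq_zero.1 (by linarith : q * (g x * g y) = 0)).resolve_right hpos.ne'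
    rw [p0, q0] at hpq
    norm_num at hpq
  have hmem : y ∈ connectedComponentIn (complement B) x :=
    (convex_segment x y).isPreconnected.subset_connectedComponentIn (left_mem_segment ℝ x y) hseg
      (right_mem_segment ℝ x y)
  exact Subtype.ext (by rw [hcx, hcy, connectedComponentIn_eq hmem])

end Cut

end HyperplaneArrangement

/-! ### Walks of chambers, the hyperplanes they cross, and localization. -/

namespace HyperplaneArrangement

open ListGallery

open scoped Classical

section Projection

variable {V : Type*} [AddCommGroup V] [Module ℝ V] [TopologicalSpace V]
  {A : Set (Submodule ℝ V)}

/-- Every hyperplane of `A` is the kernel of a continuous functional. -/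
def IsCut (A : Set (Submodule ℝ V)) : Prop :=
  ∀ H ∈ A, ∃ g : Module.Dual ℝ V, Continuous g ∧ LinearMap.ker g = H

theorem exists_liftQ (X : Submodule ℝ V) {g : Module.Dual ℝ V} (hg : Continuous g)
    (hX : X ≤ LinearMap.ker g) : ∃ g' : Module.Dual ℝ (V ⧸ X), Continuous g' ∧
      LinearMap.ker g' = (LinearMap.ker g).map X.mkQ ∧ ∀ x, g' (X.mkQ x) = g x :=
  ⟨X.liftQ g hX, hg.quotient_lift _, Submodule.ker_liftQ _ _ _, fun _ => rfl⟩

theorem IsCut.localization (h : IsCut A) (X : Submodule ℝ V) : IsCut (localization A X) := by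
  rintro K ⟨H, hH, hX, rfl⟩
  obtain ⟨g, hg, rfl⟩ := h H hH
  obtain ⟨g', hg', hk, -⟩ := exists_liftQ X hg hX
  exact ⟨g', hg', hk⟩

theorem IsCut.separates_proj_iff (h : IsCut A) {X H : Submodule ℝ V} (hH : H ∈ A) (hX : X ≤ H)
    (c c' : Chamber A) :
    Separates (H.map X.mkQ) (c.proj X).1 (c'.proj X).1 ↔ Separates H c.1 c'.1 := by
  obtain ⟨g, hg, rfl⟩ := h H hH
  obtain ⟨g', hg', hk, hgg'⟩ := exists_liftQ X hg hX
  obtain ⟨x, hx⟩ := c.nonempty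
  obtain ⟨y, hy⟩ := c'.nonempty
  have hk' : LinearMap.ker g' ∈ HyperplaneArrangement.localization A X := ⟨_, hH, hX, hk⟩
  rw [← hk, separates_iff hg' hk' (c.mkQ_image_subset X ⟨x, hx, rfl⟩)
    (c'.mkQ_image_subset X ⟨y, hy, rfl⟩), separates_iff hg hH hx hy, hgg', hgg']

theorem IsCut.separates_trans_iff (h : IsCut A) {H : Submodule ℝ V} (hH : H ∈ A)
    (c c' c'' : Chamber A) :
    Separates H c.1 c''.1 ↔ ¬ (Separates H c.1 c'.1 ↔ Separates H c'.1 c''.1) := by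
  obtain ⟨g, hg, rfl⟩ := h H hH
  exact HyperplaneArrangement.separates_trans_iff hg hH

theorem not_separates_self (H : Submodule ℝ V) (c : Chamber A) : ¬ Separates H c.1 c.1 := by
  rintro ⟨g, -, h1, h2⟩
  obtain ⟨x, hx⟩ := c.nonempty
  exact lt_asymm (h1 x hx) (h2 x hx)

theorem IsCut.proj_eq_iff [IsTopologicalAddGroup V] [ContinuousSMul ℝ V] 
    (h : IsCut A) {X : Submodule ℝ V} (c c' : Chamber A) :
    c.proj X = c'.proj X ↔ ∀ H ∈ A, X ≤ H → ¬ Separates H c.1 c'.1 := by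
  constructor
  · intro heq H hH hX hs
    rw [← h.separates_proj_iff hH hX, heq] at hs
    exact not_separates_self _ _ hs
  · intro hs
    refine Chamber.eq_of_not_separates (h.localization X) ?_
    rintro K ⟨H, hH, hX, rfl⟩
    rw [h.separates_proj_iff hH hX]
    exact hs H hH hX

/-- The hyperplane separating two adjacent chambers. -/
noncomputable def crossed (c c' : Chamber A) : Submodule ℝ V :=
  if h : ∃ H, sepHyperplanes A c c' = {H} then h.choose else ⊥

theorem sepHyperplanes_eq_crossed {c c' : Chamber A} (h : (chamberGraph A).Adj c c') :
    sepHyperplanes A c c' = {crossed c c'} := by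
  have h' : ∃ H, sepHyperplanes A c c' = {H} := Set.encard_eq_one.1 h
  rw [crossed, dif_pos h']
  exact h'.choose_spec

theorem separates_iff_eq_crossed {c c' : Chamber A} (h : (chamberGraph A).Adj c c')
    {H : Submodule ℝ V} (hH : H ∈ A) : Separates H c.1 c'.1 ↔ H = crossed c c' := by
  have : H ∈ sepHyperplanes A c c' ↔ H = crossed c c' := by
    rw [sepHyperplanes_eq_crossed h]; rfl
  rw [← this]
  exact ⟨fun hs => ⟨hH, hs⟩, fun hs => hs.2⟩

theorem crossed_mem {c c' : Chamber A} (h : (chamberGraph A).Adj c c') : crossed c c' ∈ A := by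
  have : crossed c c' ∈ sepHyperplanes A c c' := by rw [sepHyperplanes_eq_crossed h]; rfl
  exact this.1

/-- The hyperplanes crossed by a gallery, in order. -/
noncomputable def crossings : ∀ {c c' : Chamber A}, (chamberGraph A).Walk c c' →
    List (Submodule ℝ V)
  | _, _, .nil => []
  | _, _, .cons (u := c) (v := d) _ p => crossed c d :: crossings p

theorem length_crossings {c c' : Chamber A} (p : (chamberGraph A).Walk c c') :
    (crossings p).length = p.length := by
  induction p with
  | nil => rfl
  | cons h p ih => simp [crossings, ih]

theorem mem_of_mem_crossings {c c' : Chamber A} (p : (chamberGraph A).Walk c c')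
    {H : Submodule ℝ V} (hH : H ∈ crossings p) : H ∈ A := by
  induction p with
  | nil => simp [crossings] at hH
  | cons h p ih =>
    rcases List.mem_cons.1 hH with rfl | hH
    · exact crossed_mem h
    · exact ih hH

/-- Each crossing of `H` switches the side of `H`, so only the parity of the number of crossings
matters. -/
theorem IsCut.separates_iff_odd (hA : IsCut A) {c c' : Chamber A}
    (p : (chamberGraph A).Walk c c') {H : Submodule ℝ V} (hH : H ∈ A) :
    Separates H c.1 c'.1 ↔ Odd ((crossings p).count H) := by
  induction p with
  | nil => simp [crossings, not_separates_self]
  | @cons c d c' h p ih =>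
    rw [hA.separates_trans_iff hH c d c', ih, separates_iff_eq_crossed h hH, crossings,
      List.count_cons]
    by_cases heq : H = crossed c d
    · simp [heq, Nat.odd_add_one]
    · simp [heq, Ne.symm heq]

theorem exists_walk_of_crossings_eq_append {c c' : Chamber A} (p : (chamberGraph A).Walk c c')
    {u v : List (Submodule ℝ V)} (h : crossings p = u ++ v) :
    ∃ (d : Chamber A) (q : (chamberGraph A).Walk c d), crossings q = u := by
  induction p generalizing u with
  | nil =>
    obtain ⟨rfl, -⟩ := List.append_eq_nil_iff.1 h.symm
    exact ⟨_, .nil, rfl⟩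
  | @cons c d c' hadj p ih =>
    cases u with
    | nil => exact ⟨c, .nil, rfl⟩
    | cons H u =>
      rw [crossings, List.cons_append, List.cons.injEq] at h
      obtain ⟨e, q, hq⟩ := ih h.2
      exact ⟨e, .cons hadj q, by rw [crossings, hq, h.1]⟩

/-- The chamber across a given wall of a given chamber is unique, so the crossed hyperplanes
reconstruct the walk step by step. -/
theorem IsCut.crossings_injective [IsTopologicalAddGroup V] [ContinuousSMul ℝ V] 
    (hA : IsCut A) {c c' : Chamber A}
    (p q : (chamberGraph A).Walk c c') (h : crossings p = crossings q) : p = q := by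
  induction p with
  | nil =>
    cases q with
    | nil => rfl
    | cons hadj q => simp [crossings] at h
  | @cons c d c' hadj p ih =>
    cases q with
    | nil => simp [crossings] at h
    | @cons _ d' _ hadj' q =>
      rw [crossings, crossings, List.cons.injEq] at h
      have hdd : d = d' := by
        refine Chamber.eq_of_not_separates hA fun H hH hs => ?_
        rw [hA.separates_trans_iff hH d c d'] at hs
        apply hs
        rw [separates_iff_eq_crossed hadj' hH, separates_iff_eq_crossed hadj.symm hH, ← h.1,
          ← separates_iff_eq_crossed hadj.symm hH, ← separates_iff_eq_crossed hadj hH]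
        exact ⟨Separates.symm, Separates.symm⟩
      subst hdd
      rw [ih q h.2]

/-- The sequence of chambers of `A_X` visited by a walk and the hyperplanes containing `X` it
crosses determine each other. -/
theorem IsCut.destutter_eq_iff [IsTopologicalAddGroup V] [ContinuousSMul ℝ V] 
    (hA : IsCut A) (X : Submodule ℝ V) {c c' d d' : Chamber A}
    (p : (chamberGraph A).Walk c c') (q : (chamberGraph A).Walk d d')
    (hcd : c.proj X = d.proj X) :
    (p.support.map (Chamber.proj X)).destutter (· ≠ ·) =
        (q.support.map (Chamber.proj X)).destutter (· ≠ ·) ↔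
      (crossings p).filter (X ≤ ·) = (crossings q).filter (X ≤ ·) := by
  -- A step is visible in `A_X` exactly when the crossed hyperplane contains `X`. So `keep` and
  -- `drop` describe how a step affects both the destuttered sequence and the filtered crossings.
  have hne : ∀ {a b : Chamber A} (h : (chamberGraph A).Adj a b),
      a.proj X ≠ b.proj X ↔ X ≤ crossed a b := by
    intro a b h
    rw [Ne, hA.proj_eq_iff]
    push Not
    constructor
    · rintro ⟨H, hH, hX, hs⟩
      rwa [← (separates_iff_eq_crossed h hH).1 hs]
    · intro hX
      exact ⟨_, crossed_mem h, hX, (separates_iff_eq_crossed h (crossed_mem h)).2 rfl⟩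
  have keep : ∀ {a b e : Chamber A} (h : (chamberGraph A).Adj a b) (p : (chamberGraph A).Walk b e),
      X ≤ crossed a b → ((SimpleGraph.Walk.cons h p).support.map (Chamber.proj X)).destutter (· ≠ ·) =
        a.proj X :: (p.support.map (Chamber.proj X)).destutter (· ≠ ·) := by
    intro a b e h p hX
    rw [SimpleGraph.Walk.support_cons, ← SimpleGraph.Walk.cons_tail_support p]
    simp only [List.map_cons, List.destutter]
    rw [List.destutter'_cons, if_pos ((hne h).2 hX)]
  have drop : ∀ {a b e : Chamber A} (h : (chamberGraph A).Adj a b) (p : (chamberGraph A).Walk b e),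
      ¬ X ≤ crossed a b → ((SimpleGraph.Walk.cons h p).support.map (Chamber.proj X)).destutter (· ≠ ·) =
        (p.support.map (Chamber.proj X)).destutter (· ≠ ·) := by
    intro a b e h p hX
    rw [SimpleGraph.Walk.support_cons, ← SimpleGraph.Walk.cons_tail_support p]
    simp only [List.map_cons, List.destutter]
    have heq : a.proj X = b.proj X := not_not.1 fun hn => hX ((hne h).1 hn)
    rw [List.destutter'_cons, if_neg (not_not.2 heq), heq]
  have hhead : ∀ {a e : Chamber A} (p : (chamberGraph A).Walk a e),
      ((p.support.map (Chamber.proj X)).destutter (· ≠ ·)).head? = some (a.proj X) := by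
    intro a e p
    induction p with
    | nil => simp
    | @cons a b e h p ih =>
      by_cases hX : X ≤ crossed a b
      · rw [keep h p hX]; rfl
      · rw [drop h p hX, ih, not_not.1 fun hn => hX ((hne h).1 hn)]
  -- The counts settle the cases where one of the walks is already at its end.
  have hlen : ∀ {a e : Chamber A} (p : (chamberGraph A).Walk a e),
      ((p.support.map (Chamber.proj X)).destutter (· ≠ ·)).length =
        ((crossings p).filter (X ≤ ·)).length + 1 := by
    intro a e p
    induction p with
    | nil => simp [crossings]
    | @cons a b e h p ih =>
      by_cases hX : X ≤ crossed a b
      · rw [keep h p hX, crossings, List.filter_cons_of_pos (by simpa using hX)]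
        simp only [List.length_cons, ih]
      · rw [drop h p hX, crossings, List.filter_cons_of_neg (by simpa using hX), ih]
  induction p generalizing d with
  | @nil c =>
    have h1 := hlen (SimpleGraph.Walk.nil (G := chamberGraph A) (u := c))
    have h2 := hlen q
    constructor
    · intro h
      rw [h] at h1
      have : ((crossings q).filter (X ≤ ·)).length = 0 := by
        simp only [crossings, List.filter_nil, List.length_nil] at h1
        omega
      rw [List.length_eq_zero_iff.1 this]
      simp [crossings]
    · intro h
      rw [← h] at h2
      simp only [crossings, List.filter_nil, List.length_nil] at h2
      obtain ⟨z, hz⟩ := List.length_eq_one_iff.1 (by simpa using h2)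
      have h3 := hhead q
      rw [hz] at h3
      rw [hz]
      simp only [List.head?_cons, Option.some.injEq] at h3
      simp [h3, hcd]
  | @cons c c₁ c' h p ih =>
    by_cases hX : X ≤ crossed c c₁
    · -- skip the steps of `q` that are not seen in the localization
      rw [keep h p hX, crossings, List.filter_cons_of_pos (by simpa using hX)]
      induction q with
      | @nil d =>
        constructor
        · intro heq
          have := congrArg List.length heq
          simp only [List.length_cons, hlen] at this
          simp [crossings] at this
        · intro heq
          simp [crossings] at heq
      | @cons d d₁ d' h' q ih' =>
        by_cases hX' : X ≤ crossed d d₁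
        · rw [keep h' q hX', crossings, List.filter_cons_of_pos (by simpa using hX'),
            List.cons.injEq, List.cons.injEq]
          -- From a common chamber of `A_X`, the next visible chamber and the hyperplane crossed
          -- determine each other.
          have hcross : c₁.proj X = d₁.proj X ↔ crossed c c₁ = crossed d d₁ := by
            constructor
            · intro heq
              have hs := (separates_iff_eq_crossed h (crossed_mem h)).2 rfl
              rw [← hA.separates_proj_iff (crossed_mem h) hX, hcd, heq,
                hA.separates_proj_iff (crossed_mem h) hX] at hs
              exact (separates_iff_eq_crossed h' (crossed_mem h)).1 hs
            · intro heq
              refine Chamber.eq_of_not_separates (hA.localization X) ?_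
              rintro K ⟨H, hH, hXH, rfl⟩ hs
              obtain ⟨g, hg, hgk⟩ := hA.localization X (H.map X.mkQ) ⟨H, hH, hXH, rfl⟩
              have hmem : LinearMap.ker g ∈ HyperplaneArrangement.localization A X :=
                ⟨H, hH, hXH, hgk⟩
              rw [← hgk, HyperplaneArrangement.separates_trans_iff (c' := c.proj X) hg hmem] at hs
              apply hs
              rw [hgk]
              have e1 : Separates (H.map X.mkQ) (c₁.proj X).1 (c.proj X).1 ↔ H = crossed c c₁ := by
                rw [hA.separates_proj_iff hH hXH, ← separates_iff_eq_crossed h hH]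
                exact ⟨Separates.symm, Separates.symm⟩
              have e2 : Separates (H.map X.mkQ) (c.proj X).1 (d₁.proj X).1 ↔ H = crossed d d₁ := by
                rw [hcd, hA.separates_proj_iff hH hXH, ← separates_iff_eq_crossed h' hH]
              rw [e1, e2, heq]
          constructor
          · rintro ⟨-, heq⟩
            have hp := hhead p
            rw [heq, hhead q, Option.some.injEq] at hp
            exact ⟨hcross.1 hp.symm, (ih q hp.symm).1 heq⟩
          · rintro ⟨heq, heq'⟩
            exact ⟨hcd, (ih q (hcross.2 heq)).2 heq'⟩
        · rw [drop h' q hX', crossings, List.filter_cons_of_neg (by simpa using hX')]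
          exact ih' (fun q h => ih q h) (hcd.trans (not_not.1 fun hn => hX' ((hne h').1 hn)))
    · rw [drop h p hX, crossings, List.filter_cons_of_neg (by simpa using hX)]
      exact ih q ((not_not.1 fun hn => hX ((hne h).1 hn) : c.proj X = c₁.proj X).symm.trans hcd)

end Projection

/-! ### The gallery graph of an arrangement with an incident modular flag. -/

section Main

variable {V : Type*} [AddCommGroup V] [Module ℝ V] [TopologicalSpace V] {A : Set (Submodule ℝ V)}

/-- Functionals defining the hyperplanes of `A`, positive on the chamber `c₀`. -/
structure IsDefiningFamily (f : Submodule ℝ V → Module.Dual ℝ V) (c₀ : Chamber A) : Prop where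
  cont : ∀ H ∈ A, Continuous (f H)
  ker : ∀ H ∈ A, LinearMap.ker (f H) = H
  pos : ∀ H ∈ A, ∀ x ∈ c₀.1, 0 < f H x

variable {c₀ : Chamber A} {f : Submodule ℝ V → Module.Dual ℝ V}

namespace IsDefiningFamily

theorem isCut (hf : IsDefiningFamily f c₀) : IsCut A :=
  fun H hH => ⟨f H, hf.cont H hH, hf.ker H hH⟩

theorem isPosFamily (hf : IsDefiningFamily f c₀) {x₀ : V} (hx₀ : x₀ ∈ c₀.1) :
    IsPosFamily f A x₀ := by
  refine ⟨fun H hH => hf.pos H hH x₀ hx₀, fun H hH H' hH' α h => ?_⟩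
  have hα : α ≠ 0 := by
    rintro rfl
    have := hf.pos H hH x₀ hx₀
    simp [h] at this
  rw [← hf.ker H hH, ← hf.ker H' hH', h, LinearMap.ker_smul _ _ hα]

theorem separates_iff (hf : IsDefiningFamily f c₀) {H : Submodule ℝ V} (hH : H ∈ A)
    {c c' : Chamber A} {x y : V} (hx : x ∈ c.1) (hy : y ∈ c'.1) :
    Separates H c.1 c'.1 ↔ f H x * f H y < 0 := by
  have hk := hf.ker H hH
  have hkA : LinearMap.ker (f H) ∈ A := by rwa [hk]
  have := HyperplaneArrangement.separates_iff (hf.cont H hH) hkA hx hy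
  rwa [hk] at this

variable [IsTopologicalAddGroup V]

theorem separates_neg (hf : IsDefiningFamily f c₀) {H : Submodule ℝ V} (hH : H ∈ A) :
    Separates H c₀.1 c₀.neg.1 := by
  obtain ⟨x, hx⟩ := c₀.nonempty
  have hx' : -x ∈ c₀.neg.1 := ⟨x, hx, rfl⟩
  rw [hf.separates_iff hH hx hx', map_neg]
  have := hf.pos H hH x hx
  nlinarith

theorem exists_walk [ContinuousSMul ℝ V] (hf : IsDefiningFamily f c₀) {u v : List (Submodule ℝ V)}
    (hr : IsListGallery f A (u ++ v)) {c : Chamber A} {x : V} (hx : x ∈ c.1)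
    (hu : ∀ H ∈ u, f H x < 0) (hv : ∀ H ∈ v, 0 < f H x) :
    ∃ p : (chamberGraph A).Walk c c₀.neg, crossings p = v := by
  induction v generalizing u c x with
  | nil =>
    have hc : c = c₀.neg := by
      refine Chamber.eq_of_not_separates hf.isCut fun H hH => ?_
      obtain ⟨z, hz⟩ := c₀.nonempty
      have hz' : -z ∈ c₀.neg.1 := ⟨z, hz, rfl⟩
      rw [hf.separates_iff hH hx hz', map_neg, not_lt]
      have h1 := hf.pos H hH z hz
      have h2 := hu H (by simpa using (hr.mem_iff H).2 hH)
      nlinarith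
    subst hc
    exact ⟨.nil, rfl⟩
  | cons H v ih =>
    obtain ⟨y, hy1, hy2⟩ := hr.exists_point (u ++ [H]) v (by simp)
    have hmem : ∀ K ∈ A, K ∈ u ∨ K = H ∨ K ∈ v := fun K hK => by
      simpa using (hr.mem_iff K).2 hK
    have hyc : y ∈ complement A := by
      intro K hK hyK
      rw [← hf.ker K hK, LinearMap.mem_ker] at hyK
      rcases hmem K hK with h | h | h
      · exact (hy1 K (by simp [h])).ne hyK
      · exact (hy1 K (by simp [h])).ne hyK
      · exact (hy2 K h).ne' hyK
    let d : Chamber A := ⟨connectedComponentIn (complement A) y, y, hyc, rfl⟩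
    have hyd : y ∈ d.1 := mem_connectedComponentIn hyc
    have hHA : H ∈ A := (hr.mem_iff H).1 (by simp)
    have hsep : sepHyperplanes A c d = {H} := by
      ext K
      rw [Set.mem_singleton_iff]
      constructor
      · rintro ⟨hK, hs⟩
        rw [hf.separates_iff hK hx hyd] at hs
        rcases hmem K hK with h | h | h
        · have h1 := hu K h
          have h2 := hy1 K (by simp [h])
          nlinarith
        · exact h
        · have h1 := hv K (by simp [h])
          have h2 := hy2 K h
          nlinarith
      · rintro rfl
        refine ⟨hHA, (hf.separates_iff hHA hx hyd).2 ?_⟩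
        exact mul_neg_of_pos_of_neg (hv K (by simp)) (hy1 K (by simp))
    have hadj : (chamberGraph A).Adj c d := by
      change (sepHyperplanes A c d).encard = 1
      rw [hsep, Set.encard_singleton]
    obtain ⟨p, hp⟩ := ih (u := u ++ [H]) (by simpa using hr) hyd hy1 hy2
    refine ⟨.cons hadj p, ?_⟩
    rw [crossings, hp]
    have := sepHyperplanes_eq_crossed hadj
    rw [hsep, Set.singleton_eq_singleton_iff] at this
    rw [← this]

/-- Every hyperplane separates `c₀` from `-c₀`, hence is crossed at least once. -/
theorem ncard_le_length (hf : IsDefiningFamily f c₀) (p : (chamberGraph A).Walk c₀ c₀.neg) :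
    A.ncard ≤ p.length := by
  have hsub : A ⊆ (crossings p).toFinset := by
    intro H hH
    have h1 := (hf.isCut.separates_iff_odd p hH).1 (hf.separates_neg hH)
    simpa using List.count_pos_iff.1 h1.pos
  calc A.ncard ≤ ((crossings p).toFinset : Set (Submodule ℝ V)).ncard :=
        Set.ncard_le_ncard hsub (Finset.finite_toSet _)
    _ = (crossings p).toFinset.card := Set.ncard_coe_finset _
    _ ≤ (crossings p).length := List.toFinset_card_le _
    _ = p.length := length_crossings p

/-- A walk whose length is the number of hyperplanes, all of which it must cross, crosses each once.
The chamber reached after a prefix is then separated from `c₀` exactly by that prefix, and any of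
its points serves for the cut. -/
theorem isListGallery_crossings (hf : IsDefiningFamily f c₀)
    (p : (chamberGraph A).Walk c₀ c₀.neg) (hp : p.length = A.ncard) :
    IsListGallery f A (crossings p) := by
  have hmem : ∀ H, H ∈ crossings p ↔ H ∈ A := fun H =>
    ⟨mem_of_mem_crossings p, fun hH => List.count_pos_iff.1
      ((hf.isCut.separates_iff_odd p hH).1 (hf.separates_neg hH)).pos⟩
  have hnd : (crossings p).Nodup := by
    rw [← Multiset.coe_nodup, ← Multiset.toFinset_card_eq_card_iff_nodup, Multiset.coe_card,
      length_crossings, hp, ← Set.ncard_coe_finset]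
    congr 1
    ext H
    simp [hmem]
  refine ⟨hnd, hmem, fun u v huv => ?_⟩
  obtain ⟨d, q, hq⟩ := exists_walk_of_crossings_eq_append p huv
  obtain ⟨x, hx⟩ := c₀.nonempty
  obtain ⟨y, hy⟩ := d.nonempty
  rw [huv] at hnd
  refine ⟨y, fun H hH => ?_, fun H hH => ?_⟩
  · have hHA : H ∈ A := (hmem H).1 (by rw [huv]; simp [hH])
    have hs : Separates H c₀.1 d.1 := by
      rw [hf.isCut.separates_iff_odd q hHA, hq, List.count_eq_one_of_mem hnd.of_append_left hH]
      exact odd_one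
    rw [hf.separates_iff hHA hx hy] at hs
    have := hf.pos H hHA x hx
    by_contra hn
    nlinarith
  · have hHA : H ∈ A := (hmem H).1 (by rw [huv]; simp [hH])
    have hs : ¬ Separates H c₀.1 d.1 := by
      rw [hf.isCut.separates_iff_odd q hHA, hq, List.count_eq_zero_of_not_mem]
      · simp
      · exact fun hu => List.disjoint_of_nodup_append hnd hu hH
    rw [hf.separates_iff hHA hx hy] at hs
    have h1 := hf.pos H hHA x hx
    have h2 : f H y ≠ 0 := d.apply_ne_zero (by rwa [hf.ker H hHA]) hy
    by_contra hn
    exact hs (mul_neg_of_pos_of_neg h1 (lt_of_le_of_ne (not_lt.1 hn) h2))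

theorem dist_eq [ContinuousSMul ℝ V] (hf : IsDefiningFamily f c₀) {r : List (Submodule ℝ V)}
    (hr : IsListGallery f A r) : (chamberGraph A).dist c₀ c₀.neg = A.ncard := by
  obtain ⟨x, hx⟩ := c₀.nonempty
  obtain ⟨p, hp⟩ := hf.exists_walk (u := []) (v := r) hr hx (by simp)
    fun H hH => hf.pos H ((hr.mem_iff H).1 hH) x hx
  have hlen : p.length = A.ncard := by
    rw [← length_crossings, hp, ← List.toFinset_card_of_nodup hr.nodup, ← Set.ncard_coe_finset]
    congr 1
    ext H
    simp [hr.mem_iff]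
  apply le_antisymm
  · rw [← hlen]; exact SimpleGraph.dist_le p
  · obtain ⟨q, hq⟩ := p.reachable.exists_walk_length_eq_dist
    rw [← hq]
    exact hf.ncard_le_length q

end IsDefiningFamily

variable [FiniteDimensional ℝ V]

/-- Incidence makes the closed cone span `Y`, so it contains some `e ∈ Y` outside `X`. Since `Y` is
then `X` plus the line of `e`, a hyperplane through `X` contains `Y` exactly when its functional
vanishes at `e`; otherwise that functional is positive at `e`, being nonnegative on the closure of
`c₀`. -/
theorem IsDefiningFamily.isModularStep (hf : IsDefiningFamily f c₀) {X Y : Submodule ℝ V}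
    (hXY : X ≤ Y) (hdim : Module.finrank ℝ Y = Module.finrank ℝ X + 1)
    (hmod : IsModularCoatom (localization A X) (Y.map X.mkQ)) (hinc : c₀.IsIncident Y) :
    ∃ e, IsModularStep f {H | H ∈ A ∧ X ≤ H} {H | H ∈ A ∧ Y ≤ H} e := by
  obtain ⟨x₀, hx₀⟩ := c₀.nonempty
  have hpos := hf.isPosFamily hx₀
  obtain ⟨e, ⟨he, heY⟩, heX⟩ : ∃ e ∈ closure c₀.1 ∩ (Y : Set V), e ∉ X := by
    by_contra hcon
    push Not at hcon
    have hle : Submodule.span ℝ (closure c₀.1 ∩ (Y : Set V)) ≤ X := Submodule.span_le.2 hcon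
    have := Submodule.finrank_mono hle
    rw [hinc, hdim] at this
    omega
  have hYe : X ⊔ Submodule.span ℝ {e} = Y := by
    refine Submodule.eq_of_le_of_finrank_le (sup_le hXY (by simpa using heY)) ?_
    rw [hdim]
    refine Submodule.finrank_lt_finrank_of_lt (lt_of_le_of_ne le_sup_left fun h => heX ?_)
    rw [h]
    exact Submodule.mem_sup_right (Submodule.mem_span_singleton_self e)
  refine ⟨e, fun H hH => ⟨hH.1, hXY.trans hH.2⟩, fun H hH => ?_, fun H hH hHY => ?_, ?_⟩
  · have : e ∈ H := hH.2 heY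
    rwa [← hf.ker H hH.1] at this
  · refine lt_of_le_of_ne ?_ fun h0 => hHY ⟨hH.1, ?_⟩
    · have hcl : IsClosed {x | 0 ≤ f H x} := isClosed_le continuous_const (hf.cont H hH.1)
      exact closure_minimal (fun x hx => (hf.pos H hH.1 x hx).le) hcl he
    · rw [← hYe]
      refine sup_le hH.2 ?_
      rw [Submodule.span_singleton_le_iff_mem, ← hf.ker H hH.1]
      exact h0.symm
  · intro H hH hHY H' hH' hHY' hne
    have hmap : ∀ {P Q : Submodule ℝ V}, X ≤ Q → (P.map X.mkQ ≤ Q.map X.mkQ ↔ P ≤ Q) := by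
      intro P Q hQ
      rw [Submodule.map_le_iff_le_comap, Submodule.comap_map_mkQ, sup_eq_right.2 hQ]
    obtain ⟨K, ⟨H'', hH'', hX'', rfl⟩, h1, h2⟩ := hmod.modular (H.map X.mkQ) ⟨H, hH.1, hH.2, rfl⟩
      (H'.map X.mkQ) ⟨H', hH'.1, hH'.2, rfl⟩
      (fun h => hne (le_antisymm ((hmap hH'.2).1 h.le) ((hmap hH.2).1 h.ge)))
      (fun h => hHY ⟨hH.1, (hmap hH.2).1 h⟩) (fun h => hHY' ⟨hH'.1, (hmap hH'.2).1 h⟩)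
    refine ⟨H'', ⟨hH'', (hmap hX'').1 h1⟩, ⟨hH'', hX''⟩, ?_⟩
    have h3 : H ⊓ H' ≤ H'' :=
      (hmap hX'').1 ((le_inf (Submodule.map_mono inf_le_left)
        (Submodule.map_mono inf_le_right)).trans h2)
    have := (hpos.mem_line_iff hH.1 hH'.1 hne hH'').2 (by
      rwa [hf.ker H hH.1, hf.ker H' hH'.1, hf.ker H'' hH''])
    exact this.2

/-- The chain consists of the hyperplanes containing `X i`: none for `X i = V`, all of them for `X i
= 0`. -/
theorem IsDefiningFamily.hasModularChain (hf : IsDefiningFamily f c₀)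
    (hA : IsEssentialArrangement A) {X : Fin (Module.finrank ℝ V + 1) → Submodule ℝ V}
    (hX : IsModularFlag A X) (hinc : ∀ i, c₀.IsIncident (X i)) : HasModularChain f A := by
  have key : ∀ i, HasModularChain f {H | H ∈ A ∧ X i ≤ H} := by
    intro i
    induction i using Fin.reverseInduction with
    | last =>
      have htop : X (Fin.last _) = ⊤ := Submodule.eq_top_of_finrank_eq (by rw [hX.dim]; simp)
      have : {H | H ∈ A ∧ X (Fin.last _) ≤ H} = ∅ := by
        refine Set.eq_empty_iff_forall_notMem.2 ?_
        rintro H ⟨hH, hle⟩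
        have h1 := hA.hyperplane H hH
        rw [htop, top_le_iff] at hle
        have h2 := Submodule.finrank_quotient_add_finrank H
        rw [hle, finrank_top] at h2
        rw [hle] at h1
        omega
      rw [this]
      exact .empty
    | cast i ih =>
      obtain ⟨e, he⟩ := hf.isModularStep (hX.mono Fin.castSucc_lt_succ).le
        (by rw [hX.dim, hX.dim]; simp) (hX.modular i) (hinc i.succ)
      exact .step (hA.finite.subset fun H hH => hH.1) he ih
  have h0 : X 0 = ⊥ := by
    rw [← Submodule.finrank_eq_zero (R := ℝ), hX.dim]
    simp
  have := key 0
  simpa [h0] using this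

variable [IsTopologicalAddGroup V] [ContinuousSMul ℝ V]

theorem IsDefiningFamily.ediam_galleryGraph (hf : IsDefiningFamily f c₀)
    (hchain : HasModularChain f A) : (galleryGraph A c₀).ediam = (flats A 2).encard := by
  obtain ⟨x₀, hx₀⟩ := c₀.nonempty
  have hpos := hf.isPosFamily hx₀
  obtain ⟨r₀, hr₀⟩ := hchain.exists_accessible hpos
  have hdist := hf.dist_eq hr₀.1
  have hAf : A = (fun H => LinearMap.ker (f H)) '' A := by
    ext H
    constructor
    · exact fun hH => ⟨H, hH, hf.ker H hH⟩
    · rintro ⟨K, hK, rfl⟩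
      simpa [hf.ker K hK] using hK
  have hsep : ∀ r r' : Gallery A c₀, (sepFlats A c₀ r r').encard =
      (sepLines f A (crossings r.1) (crossings r'.1)).encard := by
    intro r r'
    -- Localizing a gallery at `X` amounts to restricting its crossings to the hyperplanes through
    -- `X`, so both notions of separation correspond under `above`.
    have himg : above f A '' sepFlats A c₀ r r' =
        sepLines f A (crossings r.1) (crossings r'.1) := by
      have key : ∀ X, r.proj X ≠ r'.proj X ↔
          (crossings r.1).filter (· ∈ above f A X) ≠ (crossings r'.1).filter (· ∈ above f A X) := by
        intro X
        have hfil : ∀ {c c' : Chamber A} (p : (chamberGraph A).Walk c c'),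
            (crossings p).filter (X ≤ ·) = (crossings p).filter (· ∈ above f A X) := by
          intro c c' p
          refine List.filter_congr fun H hH => ?_
          have hHA := mem_of_mem_crossings p hH
          simp [above, hHA, hf.ker H hHA]
        rw [← hfil, ← hfil, Ne, Ne, not_iff_not]
        exact hf.isCut.destutter_eq_iff X r.1 r'.1 rfl
      rw [sepLines, ← above_image_flats hpos hAf]
      ext L
      constructor
      · rintro ⟨X, ⟨hX, hne⟩, rfl⟩
        exact ⟨⟨X, hX, rfl⟩, (key X).1 hne⟩
      · rintro ⟨⟨X, hX, rfl⟩, hne⟩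
        exact ⟨X, ⟨hX, (key X).2 hne⟩, rfl⟩
    rw [← himg, ((above_injOn hpos hAf).mono fun X hX => hX.1).encard_image]
  rw [flats_two_encard hpos hAf]
  refine ediam_eq (φ := fun r : Gallery A c₀ => crossings r.1) hpos (fun r => ?_) (fun r hr => ?_)
    (fun r r' h => ?_) (fun r r' L h => ?_) (fun r r' h => ?_) hr₀
  · exact hf.isListGallery_crossings r.1 (r.2.trans hdist)
  · obtain ⟨p, hp⟩ := hf.exists_walk (u := []) (v := r) hr hx₀ (by simp)
      fun H hH => hf.pos H ((hr.mem_iff H).1 hH) x₀ hx₀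
    refine ⟨⟨p, ?_⟩, hp⟩
    rw [hdist, ← length_crossings, hp, ← List.toFinset_card_of_nodup hr.nodup,
      ← Set.ncard_coe_finset]
    congr 1
    ext H
    simp [hr.mem_iff]
  · exact Subtype.ext (hf.isCut.crossings_injective _ _ h)
  · change (sepFlats A c₀ r r').encard = 1
    rw [hsep, h.sepLines_eq hpos, Set.encard_singleton]
  · rw [← hsep]
    exact le_of_eq h

theorem exists_isDefiningFamily [T2Space V] (hA : IsEssentialArrangement A) (c₀ : Chamber A) :
    ∃ f, IsDefiningFamily f c₀ := by
  obtain ⟨x₀, hx₀⟩ := c₀.nonempty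
  have hex : ∀ H : Submodule ℝ V, ∃ g : Module.Dual ℝ V, H ∈ A → LinearMap.ker g = H ∧ 0 < g x₀ := by
    intro H
    by_cases hH : H ∈ A
    · have e := LinearEquiv.ofFinrankEq (V ⧸ H) ℝ (by rw [hA.hyperplane H hH]; simp)
      let g : Module.Dual ℝ V := e.toLinearMap ∘ₗ H.mkQ
      have hk : LinearMap.ker g = H := by
        rw [LinearMap.ker_comp, LinearEquiv.ker, ← LinearMap.ker, Submodule.ker_mkQ]
      have hne : g x₀ ≠ 0 := by
        intro h0
        have : x₀ ∈ LinearMap.ker g := h0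
        rw [hk] at this
        exact c₀.subset hx₀ H hH this
      rcases hne.lt_or_gt with h | h
      · refine ⟨-g, fun _ => ⟨?_, by simpa using h⟩⟩
        rw [← hk]; ext x; simp
      · exact ⟨g, fun _ => ⟨hk, h⟩⟩
    · exact ⟨0, fun h => absurd h hH⟩
  choose f hf using hex
  refine ⟨f, fun H _ => LinearMap.continuous_of_finiteDimensional _, fun H hH => (hf H hH).1,
    fun H hH x hx => ?_⟩
  exact c₀.pos_of_pos (LinearMap.continuous_of_finiteDimensional (f H))
    (by rwa [(hf H hH).1]) hx₀ hx (hf H hH).2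

end Main

end HyperplaneArrangement

/-! ### Reduced words: inversions, walls and galleries. -/

namespace ReducedWords

open ListGallery CoxeterSystem

open scoped Classical

section Alternating

variable {J G : Type*} [Group G] {s : J → G}

theorem prod_alternatingWord_even (x y : J) (k : ℕ) :
    ((alternatingWord x y (2 * k)).map s).prod = (s x * s y) ^ k := by
  induction k with
  | zero => simp [alternatingWord]
  | succ k ih =>
    rw [show 2 * (k + 1) = 2 * k + 1 + 1 by ring, alternatingWord_succ', alternatingWord_succ',
      if_neg (by simp), if_pos (by simp)]
    simp only [List.map_cons, List.prod_cons, ih, pow_succ', mul_assoc]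

theorem prod_alternatingWord_odd (x y : J) (k : ℕ) :
    ((alternatingWord x y (2 * k + 1)).map s).prod = s y * (s x * s y) ^ k := by
  rw [alternatingWord_succ', if_pos (by simp)]
  simp only [List.map_cons, List.prod_cons, prod_alternatingWord_even]

/-- For involutions, `s y * s x` is the inverse of `s x * s y`; moving one alternating product to
the other side leaves a power of `s x * s y`. -/
theorem prod_alternatingWord_eq_iff (hs : ∀ j, s j * s j = 1) (x y : J) (n : ℕ) :
    ((alternatingWord x y n).map s).prod = ((alternatingWord y x n).map s).prod ↔
      (s x * s y) ^ n = 1 := by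
  have hinv : ∀ j, (s j)⁻¹ = s j := fun j => inv_eq_of_mul_eq_one_left (hs j)
  have hyx : s y * s x = (s x * s y)⁻¹ := by rw [mul_inv_rev, hinv, hinv]
  rcases Nat.even_or_odd' n with ⟨k, rfl | rfl⟩
  · rw [prod_alternatingWord_even, prod_alternatingWord_even, hyx, inv_pow, eq_inv_iff_mul_eq_one,
      ← pow_add, two_mul]
  · rw [prod_alternatingWord_odd, prod_alternatingWord_odd, hyx, inv_pow,
      ← mul_right_inj (s x), ← mul_assoc, ← mul_assoc, hs, one_mul, eq_inv_iff_mul_eq_one,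
      ← pow_succ', ← pow_add]
    ring_nf

theorem eq_alternatingWord {x y : J} {l : List J} (hl : ∀ j ∈ l, j = x ∨ j = y)
    (hc : l.IsChain (· ≠ ·)) :
    l = alternatingWord x y l.length ∨ l = alternatingWord y x l.length := by
  induction l with
  | nil => simp [alternatingWord]
  | cons j l ih =>
    have ih' := ih (fun k hk => hl k (by simp [hk])) hc.tail
    have hj := hl j (by simp)
    cases l with
    | nil =>
      rcases hj with rfl | rfl
      · right; rfl
      · left; rfl
    | cons h l =>
      have hne : j ≠ h := by simpa using (List.isChain_cons_cons.1 hc).1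
      have hh := hl h (by simp)
      simp only [List.length_cons] at ih' ⊢
      rw [alternatingWord_succ' x y (l.length + 1), alternatingWord_succ' y x (l.length + 1)]
      simp only [Nat.even_add_one]
      rcases ih' with e | e
      · left
        rw [← e]
        rw [alternatingWord_succ', List.cons.injEq] at e
        congr 1
        have := e.1
        split_ifs at this ⊢ with hev <;> grind
      · right
        rw [← e]
        rw [alternatingWord_succ', List.cons.injEq] at e
        congr 1
        have := e.1
        split_ifs at this ⊢ with hev <;> grind

theorem exists_prefix_alternatingWord (x y : J) {m n : ℕ} (h : m ≤ n) :
    ∃ l, alternatingWord x y n = l ++ alternatingWord x y m := by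
  induction n, h using Nat.le_induction with
  | base => exact ⟨[], rfl⟩
  | succ n _ ih =>
    obtain ⟨l, hl⟩ := ih
    exact ⟨(if Even n then y else x) :: l, by rw [alternatingWord_succ', hl]; rfl⟩

end Alternating

theorem exists_word_of_sq {J G : Type*} [Group G] {s : J → G} (hs : ∀ j, s j * s j = 1) {w : G}
    (hw : w ∈ Subgroup.closure (Set.range s)) : ∃ l : List J, (l.map s).prod = w := by
  induction hw using Subgroup.closure_induction with
  | mem x hx =>
    obtain ⟨j, rfl⟩ := hx
    exact ⟨[j], by simp⟩
  | one => exact ⟨[], rfl⟩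
  | mul x y _ _ ih ih' =>
    obtain ⟨l, rfl⟩ := ih
    obtain ⟨l', rfl⟩ := ih'
    exact ⟨l ++ l', by simp⟩
  | inv x _ ih =>
    obtain ⟨l, rfl⟩ := ih
    refine ⟨l.reverse, ?_⟩
    rw [List.prod_inv_reverse, List.map_reverse, List.map_map]
    congr 2
    exact List.map_congr_left fun j _ => (inv_eq_of_mul_eq_one_left (hs j)).symm

variable {J G ι V : Type*} [Group G] [AddCommGroup V] [Module ℝ V]

/-- A group generated by involutions `s j` acting on `V` by reflections, which permute up to sign a
finite family of functionals `f k`, `k ∈ S`, with simple members `f (α j)`. -/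
structure IsRootFamily (s : J → G) (ρ : G →* Module.End ℝ V) (f : ι → Module.Dual ℝ V)
    (S : Set ι) (α : J → ι) (x₀ : V) : Prop where
  posFamily : IsPosFamily f S x₀
  finite : S.Finite
  simple_mem : ∀ j, α j ∈ S
  simple_inj : Function.Injective α
  sq : ∀ j, s j * s j = 1
  refl : ∀ j, ∃ v, f (α j) v = -2 ∧ ∀ x, ρ (s j) x = x + f (α j) x • v
  perm : ∀ j, ∀ k ∈ S, k ≠ α j → ∃ k' ∈ S, f k ∘ₗ ρ (s j) = f k'
  dominant : ∀ x, (∀ j, 0 < f (α j) x) → ∀ k ∈ S, 0 < f k x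
  faithful : ∀ w ∈ Subgroup.closure (Set.range s), (∀ k ∈ S, 0 < f k (ρ w x₀)) → w = 1

/-- The members of the family that `w` makes negative. -/
def inversions (ρ : G →* Module.End ℝ V) (f : ι → Module.Dual ℝ V) (S : Set ι) (x₀ : V) (w : G) :
    Set ι := {k | k ∈ S ∧ f k (ρ w x₀) < 0}

/-- The member of the family whose hyperplane separates the chambers of `w` and `w * s j`. -/
noncomputable def wall (ρ : G →* Module.End ℝ V) (f : ι → Module.Dual ℝ V) (S : Set ι) (α : J → ι)
    (w : G) (j : J) : ι :=
  if h : ∃ β ∈ S, f β ∘ₗ ρ w = f (α j) ∨ f β ∘ₗ ρ w = -f (α j) then h.choose else α j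

/-- The sequence of walls crossed by a word, starting from `w`. -/
noncomputable def walls (s : J → G) (ρ : G →* Module.End ℝ V) (f : ι → Module.Dual ℝ V) (S : Set ι)
    (α : J → ι) : G → List J → List ι
  | _, [] => []
  | w, j :: l => wall ρ f S α w j :: walls s ρ f S α (w * s j) l

namespace IsRootFamily

variable {s : J → G} {ρ : G →* Module.End ℝ V} {f : ι → Module.Dual ℝ V} {S : Set ι} {α : J → ι}
  {x₀ : V} {w w' : G} {j : J} {k : ι} {l l' : List J}

theorem gen_mem (s : J → G) (j : J) : s j ∈ Subgroup.closure (Set.range s) :=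
  Subgroup.subset_closure ⟨j, rfl⟩

theorem prod_mem (s : J → G) (l : List J) : (l.map s).prod ∈ Subgroup.closure (Set.range s) := by
  induction l with
  | nil => simp
  | cons j l ih => simpa using mul_mem (gen_mem s j) ih

section

variable (h : IsRootFamily s ρ f S α x₀)
include h

theorem simple_reflect (j : J) : f (α j) ∘ₗ ρ (s j) = -f (α j) := by
  obtain ⟨v, hv, hx⟩ := h.refl j
  ext x
  simp only [LinearMap.comp_apply, hx, map_add, map_smul, hv, LinearMap.neg_apply, smul_eq_mul]
  ring

theorem exists_word (hw : w ∈ Subgroup.closure (Set.range s)) : ∃ l : List J, (l.map s).prod = w :=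
  exists_word_of_sq h.sq hw

theorem comp_eq (hw : w ∈ Subgroup.closure (Set.range s)) (hk : k ∈ S) :
    ∃ k' ∈ S, f k ∘ₗ ρ w = f k' ∨ f k ∘ₗ ρ w = -f k' := by
  obtain ⟨l, rfl⟩ := h.exists_word hw
  clear hw
  induction l generalizing k with
  | nil => exact ⟨k, hk, Or.inl (by simp; rfl)⟩
  | cons j l ih =>
    have e : f k ∘ₗ ρ ((List.map s (j :: l)).prod) = (f k ∘ₗ ρ (s j)) ∘ₗ ρ ((l.map s).prod) := by
      rw [List.map_cons, List.prod_cons, map_mul, Module.End.mul_eq_comp, LinearMap.comp_assoc]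
    rw [e]
    by_cases hkj : k = α j
    · subst hkj
      rw [h.simple_reflect]
      obtain ⟨k', hk', e' | e'⟩ := ih hk
      · exact ⟨k', hk', Or.inr (by rw [LinearMap.neg_comp, e'])⟩
      · exact ⟨k', hk', Or.inl (by rw [LinearMap.neg_comp, e', neg_neg])⟩
    · obtain ⟨k', hk', e'⟩ := h.perm j k hk hkj
      rw [e']
      exact ih hk'

omit h in
theorem comp_inv_cancel (g : Module.Dual ℝ V) (w : G) : (g ∘ₗ ρ w⁻¹) ∘ₗ ρ w = g := by
  rw [LinearMap.comp_assoc, ← Module.End.mul_eq_comp, ← map_mul, inv_mul_cancel, map_one]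
  rfl

omit h in
theorem inv_apply (w : G) (x : V) : ρ w⁻¹ (ρ w x) = x := by
  rw [← Module.End.mul_apply, ← map_mul, inv_mul_cancel, map_one]
  rfl

omit h in
theorem apply_inv (w : G) (x : V) : ρ w (ρ w⁻¹ x) = x := by
  simp

omit h in
theorem comp_right_injective (w : G) {g g' : Module.Dual ℝ V} (e : g ∘ₗ ρ w = g' ∘ₗ ρ w) :
    g = g' := by
  ext x
  have := LinearMap.congr_fun e (ρ w⁻¹ x)
  simpa [apply_inv] using this

theorem apply_ne_zero (hw : w ∈ Subgroup.closure (Set.range s)) (hk : k ∈ S) :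
    f k (ρ w x₀) ≠ 0 := by
  obtain ⟨k', hk', e | e⟩ := h.comp_eq hw hk
  · rw [← LinearMap.comp_apply, e]
    exact (h.posFamily.pos k' hk').ne'
  · rw [← LinearMap.comp_apply, e, LinearMap.neg_apply, neg_ne_zero]
    exact (h.posFamily.pos k' hk').ne'

theorem wall_spec (hw : w ∈ Subgroup.closure (Set.range s)) (j : J) :
    wall ρ f S α w j ∈ S ∧ (f (wall ρ f S α w j) ∘ₗ ρ w = f (α j) ∨
      f (wall ρ f S α w j) ∘ₗ ρ w = -f (α j)) := by
  have hex : ∃ β ∈ S, f β ∘ₗ ρ w = f (α j) ∨ f β ∘ₗ ρ w = -f (α j) := by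
    obtain ⟨β, hβ, e | e⟩ := h.comp_eq (inv_mem hw) (h.simple_mem j)
    · exact ⟨β, hβ, Or.inl (by rw [← e, comp_inv_cancel])⟩
    · refine ⟨β, hβ, Or.inr ?_⟩
      rw [← comp_inv_cancel (f (α j)) w, e, LinearMap.neg_comp, neg_neg]
  rw [wall, dif_pos hex]
  exact hex.choose_spec

theorem eq_of_comp (hk : k ∈ S) {k' : ι} (hk' : k' ∈ S)
    (e : f k = f k' ∨ f k = -f k') : k = k' := by
  rcases e with e | e
  · exact h.posFamily.inj k hk k' hk' 1 (by simpa using e)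
  · exact h.posFamily.inj k hk k' hk' (-1) (by rw [e]; module)

theorem wall_injective (hw : w ∈ Subgroup.closure (Set.range s)) {i j : J}
    (e : wall ρ f S α w i = wall ρ f S α w j) : i = j := by
  apply h.simple_inj
  have h1 := (h.wall_spec hw i).2
  have h2 := (h.wall_spec hw j).2
  rw [e] at h1
  refine h.eq_of_comp (h.simple_mem i) (h.simple_mem j) ?_
  rcases h1 with h1 | h1 <;> rcases h2 with h2 | h2 <;> rw [h1] at h2
  · exact Or.inl h2
  · exact Or.inr h2
  · exact Or.inr (by rw [← h2, neg_neg])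
  · exact Or.inl (neg_injective h2)

theorem apply_mul_gen_wall (hw : w ∈ Subgroup.closure (Set.range s)) (j : J) :
    f (wall ρ f S α w j) (ρ (w * s j) x₀) = -f (wall ρ f S α w j) (ρ w x₀) := by
  have hr := LinearMap.congr_fun (h.simple_reflect j) x₀
  rw [map_mul, Module.End.mul_apply]
  rw [LinearMap.comp_apply, LinearMap.neg_apply] at hr
  rcases (h.wall_spec hw j).2 with e | e
  all_goals
    have a1 := LinearMap.congr_fun e (ρ (s j) x₀)
    have a2 := LinearMap.congr_fun e x₀
    simp only [LinearMap.comp_apply, LinearMap.neg_apply] at a1 a2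
    rw [a1, a2, hr]

/-- The reflection `s j` permutes all positive members other than `α j`. Transported by `w`, right
multiplication by `s j` changes the sign of its wall and of nothing else. -/
theorem apply_mul_gen_neg_iff (hw : w ∈ Subgroup.closure (Set.range s)) (hk : k ∈ S)
    (hkj : k ≠ wall ρ f S α w j) : f k (ρ (w * s j) x₀) < 0 ↔ f k (ρ w x₀) < 0 := by
  obtain ⟨k', hk', e⟩ := h.comp_eq hw hk
  have hne : k' ≠ α j := by
    rintro rfl
    apply hkj
    have hwl := h.wall_spec hw j
    refine h.eq_of_comp hk hwl.1 ?_
    rcases e with e | e <;> rcases hwl.2 with e' | e'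
    · exact Or.inl (comp_right_injective w (e.trans e'.symm))
    · exact Or.inr (comp_right_injective w (by rw [e, LinearMap.neg_comp, e', neg_neg]))
    · exact Or.inr (comp_right_injective w (by rw [e, LinearMap.neg_comp, e']))
    · exact Or.inl (comp_right_injective w (e.trans e'.symm))
  obtain ⟨k'', hk'', e''⟩ := h.perm j k' hk' hne
  have e3 := LinearMap.congr_fun e'' x₀
  rw [LinearMap.comp_apply] at e3
  have p1 := h.posFamily.pos k' hk'
  have p2 := h.posFamily.pos k'' hk''
  rw [map_mul, Module.End.mul_apply]
  rcases e with e | e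
  all_goals
    have a1 := LinearMap.congr_fun e (ρ (s j) x₀)
    have a2 := LinearMap.congr_fun e x₀
    simp only [LinearMap.comp_apply, LinearMap.neg_apply] at a1 a2
    rw [a1, a2, e3]
  · exact ⟨fun h => absurd h (lt_asymm p2), fun h => absurd h (lt_asymm p1)⟩
  · exact ⟨fun _ => by linarith, fun _ => by linarith⟩

theorem inversions_mul_gen_of_notMem (hw : w ∈ Subgroup.closure (Set.range s))
    (hj : wall ρ f S α w j ∉ inversions ρ f S x₀ w) :
    inversions ρ f S x₀ (w * s j) = insert (wall ρ f S α w j) (inversions ρ f S x₀ w) := by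
  have hwl := (h.wall_spec hw j).1
  ext k
  rw [Set.mem_insert_iff]
  by_cases hk : k = wall ρ f S α w j
  · subst hk
    refine ⟨fun _ => Or.inl rfl, fun _ => ⟨hwl, ?_⟩⟩
    rw [h.apply_mul_gen_wall hw]
    have h1 : ¬ f (wall ρ f S α w j) (ρ w x₀) < 0 := fun hlt => hj ⟨hwl, hlt⟩
    have := lt_of_le_of_ne (not_lt.1 h1) (h.apply_ne_zero hw hwl).symm
    linarith
  · simp only [hk, false_or]
    constructor
    · rintro ⟨hkS, hlt⟩; exact ⟨hkS, (h.apply_mul_gen_neg_iff hw hkS hk).1 hlt⟩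
    · rintro ⟨hkS, hlt⟩; exact ⟨hkS, (h.apply_mul_gen_neg_iff hw hkS hk).2 hlt⟩

theorem inversions_mul_gen_of_mem (hw : w ∈ Subgroup.closure (Set.range s))
    (hj : wall ρ f S α w j ∈ inversions ρ f S x₀ w) :
    inversions ρ f S x₀ (w * s j) = inversions ρ f S x₀ w \ {wall ρ f S α w j} := by
  ext k
  rw [Set.mem_sdiff, Set.mem_singleton_iff]
  by_cases hk : k = wall ρ f S α w j
  · subst hk
    refine ⟨fun hlt => ?_, fun hn => absurd rfl hn.2⟩
    have h1 := hlt.2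
    have h2 := hj.2
    rw [h.apply_mul_gen_wall hw] at h1
    linarith
  · constructor
    · rintro ⟨hkS, hlt⟩; exact ⟨⟨hkS, (h.apply_mul_gen_neg_iff hw hkS hk).1 hlt⟩, hk⟩
    · rintro ⟨⟨hkS, hlt⟩, -⟩; exact ⟨hkS, (h.apply_mul_gen_neg_iff hw hkS hk).2 hlt⟩

theorem inversions_finite (w : G) : (inversions ρ f S x₀ w).Finite :=
  h.finite.subset fun _ hk => hk.1

theorem inversions_one : inversions ρ f S x₀ 1 = ∅ := by
  refine Set.eq_empty_iff_forall_notMem.2 fun k hk => ?_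
  have := hk.2
  rw [map_one] at this
  exact lt_asymm this (h.posFamily.pos k hk.1)

theorem ncard_inversions_mul_gen_le (hw : w ∈ Subgroup.closure (Set.range s)) (j : J) :
    (inversions ρ f S x₀ (w * s j)).ncard ≤ (inversions ρ f S x₀ w).ncard + 1 := by
  by_cases hj : wall ρ f S α w j ∈ inversions ρ f S x₀ w
  · rw [h.inversions_mul_gen_of_mem hw hj]
    exact (Set.ncard_le_ncard Set.sdiff_subset (h.inversions_finite w)).trans (by omega)
  · rw [h.inversions_mul_gen_of_notMem hw hj]
    exact Set.ncard_insert_le _ _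

theorem ncard_inversions_mul_prod_le (hw : w ∈ Subgroup.closure (Set.range s)) (l : List J) :
    (inversions ρ f S x₀ (w * (l.map s).prod)).ncard ≤
      (inversions ρ f S x₀ w).ncard + l.length := by
  induction l generalizing w with
  | nil => simp
  | cons j l ih =>
    have h1 := ih (mul_mem hw (gen_mem s j))
    have h2 := h.ncard_inversions_mul_gen_le hw j
    rw [List.map_cons, List.prod_cons, ← mul_assoc, List.length_cons]
    omega

/-- If no wall of `w` is inverted, `w⁻¹` maps the base point to a point positive on all simple
functionals, hence on the whole family, and faithfulness gives `w = 1`. -/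
theorem exists_descent (hw : w ∈ Subgroup.closure (Set.range s)) (h1 : w ≠ 1) :
    ∃ j, wall ρ f S α w j ∈ inversions ρ f S x₀ w := by
  obtain ⟨j, hj⟩ : ∃ j, f (α j) (ρ w⁻¹ x₀) < 0 := by
    by_contra hcon
    push Not at hcon
    apply h1
    rw [← inv_eq_one]
    refine h.faithful _ (inv_mem hw) (h.dominant _ fun j => ?_)
    exact lt_of_le_of_ne (hcon j) (h.apply_ne_zero (inv_mem hw) (h.simple_mem j)).symm
  refine ⟨j, (h.wall_spec hw j).1, ?_⟩
  have hp := h.posFamily.pos _ (h.wall_spec hw j).1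
  have hpj := h.posFamily.pos _ (h.simple_mem j)
  rcases (h.wall_spec hw j).2 with e | e
  · have := LinearMap.congr_fun e (ρ w⁻¹ x₀)
    rw [LinearMap.comp_apply, apply_inv] at this
    linarith
  · rw [← LinearMap.comp_apply, e, LinearMap.neg_apply]
    linarith

theorem exists_word_of_length (hw : w ∈ Subgroup.closure (Set.range s)) :
    ∃ l : List J, (l.map s).prod = w ∧ l.length = (inversions ρ f S x₀ w).ncard := by
  induction hn : (inversions ρ f S x₀ w).ncard generalizing w with
  | zero =>
    by_cases h1 : w = 1
    · exact ⟨[], by simp [h1]⟩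
    · obtain ⟨j, hj⟩ := h.exists_descent hw h1
      rw [Set.ncard_eq_zero (h.inversions_finite w)] at hn
      simp [hn] at hj
  | succ n ih =>
    have h1 : w ≠ 1 := by
      rintro rfl
      simp [h.inversions_one] at hn
    obtain ⟨j, hj⟩ := h.exists_descent hw h1
    obtain ⟨l, hl, hlen⟩ := ih (mul_mem hw (gen_mem s j)) (by
      rw [h.inversions_mul_gen_of_mem hw hj, Set.ncard_sdiff_singleton_of_mem hj]
      omega)
    exact ⟨l ++ [j], by simp [hl, mul_assoc, h.sq], by simp [hlen]⟩

/-- A generator changes the number of inversions by at most one, and a descent lowers it by one as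
long as `w ≠ 1`. -/
theorem wordLength_eq (hw : w ∈ Subgroup.closure (Set.range s)) :
    wordLength s w = (inversions ρ f S x₀ w).ncard := by
  obtain ⟨l, hl, hlen⟩ := h.exists_word_of_length hw
  apply le_antisymm
  · exact Nat.sInf_le ⟨l, hl, hlen⟩
  · obtain ⟨l', hl', hlen'⟩ := Nat.sInf_mem (s := {k | ∃ l : List J, (l.map s).prod = w ∧ l.length = k})
      ⟨_, l, hl, rfl⟩
    have := h.ncard_inversions_mul_prod_le (one_mem (Subgroup.closure (Set.range s))) l'
    rw [one_mul, hl', h.inversions_one, Set.ncard_empty, zero_add, hlen'] at this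
    exact this

/-- Equal inversion sets mean that `w x₀` and `w' x₀` have equal signs throughout, so `w⁻¹ w'` keeps
the base point positive. -/
theorem inversions_injective (hw : w ∈ Subgroup.closure (Set.range s))
    (hw' : w' ∈ Subgroup.closure (Set.range s))
    (e : inversions ρ f S x₀ w = inversions ρ f S x₀ w') : w = w' := by
  rw [← inv_mul_eq_one]
  refine h.faithful _ (mul_mem (inv_mem hw) hw') fun k hk => ?_
  obtain ⟨k', hk', e'⟩ := h.comp_eq (inv_mem hw) hk
  have hiff : f k' (ρ w x₀) < 0 ↔ f k' (ρ w' x₀) < 0 := by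
    have : k' ∈ inversions ρ f S x₀ w ↔ k' ∈ inversions ρ f S x₀ w' := by rw [e]
    exact ⟨fun hl => (this.1 ⟨hk', hl⟩).2, fun hl => (this.2 ⟨hk', hl⟩).2⟩
  have hp := h.posFamily.pos k hk
  have n1 := h.apply_ne_zero hw hk'
  have n2 := h.apply_ne_zero hw' hk'
  rw [map_mul, Module.End.mul_apply, ← LinearMap.comp_apply]
  rcases e' with e' | e'
  · have e2 := LinearMap.congr_fun e' (ρ w x₀)
    rw [LinearMap.comp_apply, inv_apply] at e2
    rw [e']
    rw [e2] at hp
    exact lt_of_le_of_ne (not_lt.1 fun hl => lt_asymm hp (hiff.2 hl)) n2.symm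
  · have e2 := LinearMap.congr_fun e' (ρ w x₀)
    rw [LinearMap.comp_apply, inv_apply, LinearMap.neg_apply] at e2
    rw [e', LinearMap.neg_apply, neg_pos]
    exact hiff.1 (by linarith)

/-- For an element `w` with the most inversions, every wall is already inverted, that is, `w⁻¹ x₀`
is negative on all simple functionals. Dominance applied to its negative makes it negative on the
whole family, so `w⁻¹` is the required element. -/
theorem exists_inversions_eq : ∃ w ∈ Subgroup.closure (Set.range s), inversions ρ f S x₀ w = S := by
  let N : Set ℕ := {n | ∃ w ∈ Subgroup.closure (Set.range s), (inversions ρ f S x₀ w).ncard = n}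
  have hne : N.Nonempty := ⟨_, 1, one_mem _, rfl⟩
  have hbdd : BddAbove N := by
    refine ⟨S.ncard, ?_⟩
    rintro n ⟨w, -, rfl⟩
    exact Set.ncard_le_ncard (fun _ hk => hk.1) h.finite
  obtain ⟨w, hw, hmax⟩ := Nat.sSup_mem hne hbdd
  have hneg : ∀ j, f (α j) (ρ w⁻¹ x₀) < 0 := by
    intro j
    by_contra hcon
    have hpos := lt_of_le_of_ne (not_lt.1 hcon) (h.apply_ne_zero (inv_mem hw) (h.simple_mem j)).symm
    have hj : wall ρ f S α w j ∉ inversions ρ f S x₀ w := by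
      rintro ⟨hS, hlt⟩
      have hp := h.posFamily.pos _ hS
      have hpj := h.posFamily.pos _ (h.simple_mem j)
      rcases (h.wall_spec hw j).2 with e | e
      · rw [← LinearMap.comp_apply, e] at hlt
        linarith
      · have := LinearMap.congr_fun e (ρ w⁻¹ x₀)
        rw [LinearMap.comp_apply, apply_inv, LinearMap.neg_apply] at this
        linarith
    have h1 : (inversions ρ f S x₀ (w * s j)).ncard ≤ sSup N :=
      le_csSup hbdd ⟨_, mul_mem hw (gen_mem s j), rfl⟩
    rw [h.inversions_mul_gen_of_notMem hw hj,
      Set.ncard_insert_of_notMem hj (h.inversions_finite w)] at h1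
    omega
  refine ⟨w⁻¹, inv_mem hw, Set.ext fun k => ⟨fun hk => hk.1, fun hk => ⟨hk, ?_⟩⟩⟩
  have := h.dominant (-(ρ w⁻¹ x₀)) (fun j => by simpa using hneg j) k hk
  simpa using this

theorem isLongest_iff {w₀ : G} (hw₀ : w₀ ∈ Subgroup.closure (Set.range s))
    (hS : inversions ρ f S x₀ w₀ = S) (w : G) : IsLongest s w ↔ w = w₀ := by
  constructor
  · rintro ⟨hw, hmax⟩
    have h1 := hmax w₀ hw₀
    rw [h.wordLength_eq hw, h.wordLength_eq hw₀, hS] at h1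
    have h2 : inversions ρ f S x₀ w = S :=
      Set.eq_of_subset_of_ncard_le (fun _ hk => hk.1) h1 h.finite
    exact h.inversions_injective hw hw₀ (h2.trans hS.symm)
  · rintro rfl
    refine ⟨hw₀, fun v hv => ?_⟩
    rw [h.wordLength_eq hv, h.wordLength_eq hw₀, hS]
    exact Set.ncard_le_ncard (fun _ hk => hk.1) h.finite

omit h in
theorem walls_append (w : G) (l l' : List J) : walls s ρ f S α w (l ++ l') =
    walls s ρ f S α w l ++ walls s ρ f S α (w * (l.map s).prod) l' := by
  induction l generalizing w with
  | nil => simp [walls]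
  | cons j l ih => simp [walls, ih, mul_assoc]

omit h in
theorem length_walls (w : G) (l : List J) : (walls s ρ f S α w l).length = l.length := by
  induction l generalizing w with
  | nil => rfl
  | cons j l ih => simp [walls, ih]

omit h in
theorem exists_of_walls_eq_append {u v : List ι} (e : walls s ρ f S α w l = u ++ v) :
    ∃ l₁ l₂, l = l₁ ++ l₂ ∧ walls s ρ f S α w l₁ = u ∧
      walls s ρ f S α (w * (l₁.map s).prod) l₂ = v := by
  induction u generalizing w l with
  | nil => exact ⟨[], l, rfl, rfl, by simpa using e⟩
  | cons a u ih =>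
    cases l with
    | nil => simp [walls] at e
    | cons j l =>
      rw [walls, List.cons_append, List.cons.injEq] at e
      obtain ⟨l₁, l₂, rfl, h1, h2⟩ := ih e.2
      exact ⟨j :: l₁, l₂, rfl, by rw [walls, h1, e.1], by simpa [mul_assoc] using h2⟩

theorem walls_injective (hw : w ∈ Subgroup.closure (Set.range s))
    (e : walls s ρ f S α w l = walls s ρ f S α w l') : l = l' := by
  induction l generalizing w l' with
  | nil =>
    cases l' with
    | nil => rfl
    | cons j l' => simp [walls] at e
  | cons j l ih =>
    cases l' with
    | nil => simp [walls] at e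
    | cons j' l' =>
      rw [walls, walls, List.cons.injEq] at e
      obtain rfl := h.wall_injective hw e.1
      rw [ih (mul_mem hw (gen_mem s j)) e.2]

theorem mem_of_mem_walls (hw : w ∈ Subgroup.closure (Set.range s))
    (hk : k ∈ walls s ρ f S α w l) : k ∈ S := by
  induction l generalizing w with
  | nil => simp [walls] at hk
  | cons j l ih =>
    rcases List.mem_cons.1 hk with rfl | hk
    · exact (h.wall_spec hw j).1
    · exact ih (mul_mem hw (gen_mem s j)) hk

end

/-- The word `l` is reduced when continued from `w`. -/
def Tight (s : J → G) (ρ : G →* Module.End ℝ V) (f : ι → Module.Dual ℝ V) (S : Set ι) (x₀ : V)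
    (w : G) (l : List J) : Prop :=
  (inversions ρ f S x₀ (w * (l.map s).prod)).ncard = (inversions ρ f S x₀ w).ncard + l.length

section

variable (h : IsRootFamily s ρ f S α x₀)
include h

theorem Tight.append (hw : w ∈ Subgroup.closure (Set.range s))
    (ht : Tight s ρ f S x₀ w (l ++ l')) :
    Tight s ρ f S x₀ w l ∧ Tight s ρ f S x₀ (w * (l.map s).prod) l' := by
  have h1 := h.ncard_inversions_mul_prod_le hw l
  have h2 := h.ncard_inversions_mul_prod_le (mul_mem hw (prod_mem s l)) l'
  unfold Tight at *
  rw [List.map_append, List.prod_append, ← mul_assoc, List.length_append] at ht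
  omega

theorem Tight.cons (hw : w ∈ Subgroup.closure (Set.range s))
    (ht : Tight s ρ f S x₀ w (j :: l)) :
    wall ρ f S α w j ∉ inversions ρ f S x₀ w ∧ Tight s ρ f S x₀ (w * s j) l := by
  obtain ⟨h1, h2⟩ := Tight.append (l := [j]) (l' := l) h hw ht
  refine ⟨fun hj => ?_, by simpa using h2⟩
  have h3 := h.inversions_mul_gen_of_mem hw hj
  have h4 := Set.ncard_sdiff_singleton_of_mem hj
  unfold Tight at h1
  simp only [List.map_cons, List.map_nil, List.prod_cons, List.prod_nil, mul_one,
    List.length_cons, List.length_nil, h3] at h1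
  omega

theorem Tight.walls (hw : w ∈ Subgroup.closure (Set.range s)) (ht : Tight s ρ f S x₀ w l) :
    (walls s ρ f S α w l).Nodup ∧
    (∀ k ∈ ReducedWords.walls s ρ f S α w l, k ∉ inversions ρ f S x₀ w) ∧
    ∀ k, k ∈ inversions ρ f S x₀ (w * (l.map s).prod) ↔
      k ∈ inversions ρ f S x₀ w ∨ k ∈ ReducedWords.walls s ρ f S α w l := by
  induction l generalizing w with
  | nil => simp [ReducedWords.walls]
  | cons j l ih =>
    obtain ⟨hj, ht'⟩ := Tight.cons h hw ht
    obtain ⟨h1, h2, h3⟩ := ih (mul_mem hw (gen_mem s j)) ht'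
    have e := h.inversions_mul_gen_of_notMem hw hj
    rw [e] at h2
    simp only [e, Set.mem_insert_iff] at h3
    refine ⟨List.nodup_cons.2 ⟨fun hm => h2 _ hm (Set.mem_insert _ _), h1⟩, ?_, ?_⟩
    · intro k hk
      rcases List.mem_cons.1 hk with rfl | hk
      · exact hj
      · exact fun hk' => h2 k hk (Set.mem_insert_of_mem _ hk')
    · intro k
      rw [List.map_cons, List.prod_cons, ← mul_assoc, h3, ReducedWords.walls, List.mem_cons]
      tauto

theorem Tight.isChain (hw : w ∈ Subgroup.closure (Set.range s)) (ht : Tight s ρ f S x₀ w l) :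
    l.IsChain (· ≠ ·) := by
  induction l generalizing w with
  | nil => exact List.isChain_nil
  | cons i l ih =>
    have ht' := (Tight.cons h hw ht).2
    cases l with
    | nil => exact List.isChain_singleton _
    | cons j l =>
      refine List.isChain_cons_cons.2 ⟨?_, ih (mul_mem hw (gen_mem s i)) ht'⟩
      rintro rfl
      have h1 := (Tight.append (l := [i, i]) (l' := l) h hw ht).1
      unfold Tight at h1
      simp [h.sq] at h1

/-- The images of the base point under the prefixes of the word are the points required at the cuts.
-/
theorem isListGallery_walls {w₀ : G} (hS : inversions ρ f S x₀ w₀ = S)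
    (hl : (l.map s).prod = w₀) (hlen : l.length = S.ncard) :
    IsListGallery f S (walls s ρ f S α 1 l) := by
  have h1 := one_mem (Subgroup.closure (Set.range s))
  have ht : Tight s ρ f S x₀ 1 l := by
    unfold Tight
    rw [one_mul, hl, hS, h.inversions_one, hlen]
    simp
  obtain ⟨hnd, -, hmem⟩ := Tight.walls h h1 ht
  have hmem' : ∀ k, k ∈ walls s ρ f S α 1 l ↔ k ∈ S := by
    intro k
    have := hmem k
    rw [one_mul, hl, hS, h.inversions_one] at this
    simpa using this.symm
  refine ⟨hnd, hmem', fun u v e => ?_⟩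
  obtain ⟨l₁, l₂, rfl, hu, hv⟩ := exists_of_walls_eq_append e
  have hm1 := (Tight.walls h h1 (Tight.append h h1 ht).1).2.2
  simp only [one_mul, h.inversions_one, Set.mem_empty_iff_false, false_or, hu] at hm1
  rw [e] at hnd
  refine ⟨ρ ((l₁.map s).prod) x₀, fun k hk => ((hm1 k).2 hk).2, fun k hk => ?_⟩
  have hkS : k ∈ S := (hmem' k).1 (by rw [e]; simp [hk])
  refine lt_of_le_of_ne (not_lt.1 fun hlt => ?_) (h.apply_ne_zero (prod_mem s l₁) hkS).symm
  exact List.disjoint_of_nodup_append hnd ((hm1 k).1 ⟨hkS, hlt⟩) hk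

/-- Extends a word along a gallery: the next functional `β` must be a wall of the current chamber
`w`. Otherwise the next point `x` would have the same signs as `w x₀` on all walls of that chamber,
so `w⁻¹ x` would be dominant and `β` could not change sign. -/
theorem exists_word_of_prefix {r : List ι} (hr : IsListGallery f S r) (u v : List ι)
    (e : r = u ++ v) : ∃ l : List J, walls s ρ f S α 1 l = u ∧
      ∀ k, k ∈ inversions ρ f S x₀ ((l.map s).prod) ↔ k ∈ u := by
  induction u using List.reverseRecOn generalizing v with
  | nil => exact ⟨[], rfl, by simp [h.inversions_one]⟩
  | append_singleton u β ih =>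
    obtain ⟨l, hl, hinv⟩ := ih (β :: v) (by simp [e])
    set w := (l.map s).prod with hwdef
    have hw : w ∈ Subgroup.closure (Set.range s) := prod_mem s l
    obtain ⟨x, hx1, hx2⟩ := hr.exists_point (u ++ [β]) v e
    have hnd := hr.nodup
    have hβS : β ∈ S := (hr.mem_iff β).1 (by rw [e]; simp)
    have hβu : β ∉ u := by
      intro hβ
      rw [e, List.append_assoc] at hnd
      exact List.disjoint_of_nodup_append hnd hβ (by simp)
    obtain ⟨j, hj⟩ : ∃ j, wall ρ f S α w j = β := by
      by_contra hcon
      push Not at hcon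
      have hsame : ∀ k ∈ S, k ≠ β → (f k x < 0 ∧ f k (ρ w x₀) < 0) ∨ (0 < f k x ∧ 0 < f k (ρ w x₀)) := by
        intro k hk hne
        have hkr := (hr.mem_iff k).2 hk
        rw [e] at hkr
        rcases List.mem_append.1 hkr with hku | hkv
        · have hku' : k ∈ u := by
            rcases List.mem_append.1 hku with h' | h'
            · exact h'
            · exact absurd (List.mem_singleton.1 h') hne
          exact Or.inl ⟨hx1 k hku, ((hinv k).2 hku').2⟩
        · refine Or.inr ⟨hx2 k hkv, lt_of_le_of_ne (not_lt.1 fun hlt => ?_) (h.apply_ne_zero hw hk).symm⟩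
          have := (hinv k).1 ⟨hk, hlt⟩
          rw [e] at hnd
          exact List.disjoint_of_nodup_append hnd (List.mem_append_left _ this) hkv
      have hdom := h.dominant (ρ w⁻¹ x) (fun j => by
        obtain ⟨hS, e'⟩ := h.wall_spec hw j
        have hs := hsame _ hS (hcon j)
        have hp := h.posFamily.pos _ (h.simple_mem j)
        rcases e' with e' | e'
        · have a1 := LinearMap.congr_fun e' (ρ w⁻¹ x)
          have a2 := LinearMap.congr_fun e' x₀
          rw [LinearMap.comp_apply, apply_inv] at a1
          rw [LinearMap.comp_apply] at a2
          rw [a1, a2] at hs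
          rcases hs with hs | hs
          · exact absurd hs.2 (lt_asymm hp)
          · exact hs.1
        · have a1 := LinearMap.congr_fun e' (ρ w⁻¹ x)
          have a2 := LinearMap.congr_fun e' x₀
          rw [LinearMap.comp_apply, apply_inv, LinearMap.neg_apply] at a1
          rw [LinearMap.comp_apply, LinearMap.neg_apply] at a2
          rw [a1, a2] at hs
          rcases hs with hs | hs
          · linarith [hs.1]
          · linarith [hs.2])
      obtain ⟨γ, hγ, eγ⟩ := h.comp_eq hw hβS
      have hβx := hx1 β (by simp)
      have hβw : ¬ f β (ρ w x₀) < 0 := fun hlt => hβu ((hinv β).1 ⟨hβS, hlt⟩)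
      have hγ1 := hdom γ hγ
      have hγ2 := h.posFamily.pos γ hγ
      rcases eγ with eγ | eγ
      · have a1 := LinearMap.congr_fun eγ (ρ w⁻¹ x)
        rw [LinearMap.comp_apply, apply_inv] at a1
        linarith
      · have a2 := LinearMap.congr_fun eγ x₀
        rw [LinearMap.comp_apply, LinearMap.neg_apply] at a2
        rw [a2] at hβw
        exact hβw (by linarith)
    refine ⟨l ++ [j], ?_, fun k => ?_⟩
    · rw [walls_append, hl, one_mul, ← hwdef]
      simp [walls, hj]
    · have hn : wall ρ f S α w j ∉ inversions ρ f S x₀ w := by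
        rw [hj, hinv]; exact hβu
      have := h.inversions_mul_gen_of_notMem hw hn
      rw [List.map_append, List.prod_append, ← hwdef]
      simp only [List.map_cons, List.map_nil, List.prod_cons, List.prod_nil, mul_one, this,
        Set.mem_insert_iff, hj, hinv, List.mem_append, List.mem_singleton]
      tauto

theorem exists_word_of_gallery {w₀ : G} (hw₀ : w₀ ∈ Subgroup.closure (Set.range s))
    (hS : inversions ρ f S x₀ w₀ = S) {r : List ι} (hr : IsListGallery f S r) :
    ∃ l : List J, walls s ρ f S α 1 l = r ∧ (l.map s).prod = w₀ ∧ l.length = S.ncard := by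
  obtain ⟨l, hl, hinv⟩ := h.exists_word_of_prefix hr r [] (by simp)
  refine ⟨l, hl, h.inversions_injective (prod_mem s l) hw₀ ?_, ?_⟩
  · rw [hS]
    ext k
    rw [hinv, hr.mem_iff]
  · rw [← length_walls (s := s) (ρ := ρ) (f := f) (S := S) (α := α) 1 l, hl,
      ← List.toFinset_card_of_nodup hr.nodup, ← Set.ncard_coe_finset]
    congr 1
    ext k
    simp [hr.mem_iff]

end

end IsRootFamily

end ReducedWords

/-! ### Braid moves and flips. -/

namespace ReducedWords

open ListGallery CoxeterSystem

open scoped Classical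

variable {J G ι V : Type*} [Group G] [AddCommGroup V] [Module ℝ V]

namespace IsRootFamily

variable {s : J → G} {ρ : G →* Module.End ℝ V} {f : ι → Module.Dual ℝ V} {S : Set ι} {α : J → ι}
  {x₀ : V} {w w' : G} {i i' j : J} {k : ι} {l l' : List J}

/-- The functional `f k` lies in the plane of the `w`-translates of two simple ones. -/
def InPlane (ρ : G →* Module.End ℝ V) (f : ι → Module.Dual ℝ V) (α : J → ι) (i i' : J) (w : G)
    (k : ι) : Prop :=
  ∃ a b : ℝ, f k ∘ₗ ρ w = a • f (α i) + b • f (α i')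

section

variable (h : IsRootFamily s ρ f S α x₀)
include h

theorem simple_apply_pos (hij : i ≠ j) : 0 < f (α i) (ρ (s j) x₀) := by
  obtain ⟨k', hk', e⟩ := h.perm j (α i) (h.simple_mem i) fun e => hij (h.simple_inj e)
  rw [← LinearMap.comp_apply, e]
  exact h.posFamily.pos k' hk'

theorem simple_apply_neg (j : J) : f (α j) (ρ (s j) x₀) < 0 := by
  rw [← LinearMap.comp_apply, h.simple_reflect, LinearMap.neg_apply, neg_lt_zero]
  exact h.posFamily.pos _ (h.simple_mem j)

/-- A generator makes its own simple functional negative and keeps the other simple ones positive.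
Evaluating at `x₀` and its images under `s j`, `s i`, `s i'` rules out every sign pattern of `a` and
`b`. -/
theorem simple_indep (hii : i ≠ i') {a b : ℝ} (e : f (α j) = a • f (α i) + b • f (α i')) :
    j = i ∨ j = i' := by
  by_contra hcon
  push Not at hcon
  have hx : ∀ x, f (α j) x = a * f (α i) x + b * f (α i') x := fun x => by rw [e]; simp
  have e0 := hx x₀
  have e1 := hx (ρ (s j) x₀)
  have e2 := hx (ρ (s i) x₀)
  have e3 := hx (ρ (s i') x₀)
  have p0 := h.posFamily.pos _ (h.simple_mem j)
  have q0 := h.posFamily.pos _ (h.simple_mem i)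
  have r0 := h.posFamily.pos _ (h.simple_mem i')
  have p1 := h.simple_apply_neg j
  have q1 := h.simple_apply_pos hcon.1.symm
  have r1 := h.simple_apply_pos hcon.2.symm
  have p2 := h.simple_apply_pos hcon.1
  have q2 := h.simple_apply_neg i
  have r2 := h.simple_apply_pos hii.symm
  have p3 := h.simple_apply_pos hcon.2
  have q3 := h.simple_apply_pos hii
  have r3 := h.simple_apply_neg i'
  rcases lt_or_ge a 0 with ha | ha
  · have := mul_neg_of_neg_of_pos ha q0
    have hb : 0 < b := by
      by_contra hb
      have := mul_nonpos_of_nonpos_of_nonneg (not_lt.1 hb) r0.le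
      linarith
    have := mul_neg_of_neg_of_pos ha q3
    have := mul_neg_of_pos_of_neg hb r3
    linarith
  · rcases lt_or_ge b 0 with hb | hb
    · have := mul_neg_of_neg_of_pos hb r2
      have := mul_nonpos_of_nonneg_of_nonpos ha q2.le
      linarith
    · have := mul_nonneg ha q1.le
      have := mul_nonneg hb r1.le
      linarith

/-- A reflection alters a functional only by a multiple of its simple functional, so `s i` and `s
i'` preserve the plane spanned by their own two. -/
theorem inPlane_mul_gen (hj : j = i ∨ j = i') (hk : InPlane ρ f α i i' w k) :
    InPlane ρ f α i i' (w * s j) k := by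
  obtain ⟨a, b, e⟩ := hk
  obtain ⟨v, -, hv⟩ := h.refl j
  have hcomp : ∀ x, f k (ρ (w * s j) x) =
      a * f (α i) x + b * f (α i') x + (a * f (α i) v + b * f (α i') v) * f (α j) x := by
    intro x
    have := LinearMap.congr_fun e (ρ (s j) x)
    rw [LinearMap.comp_apply] at this
    rw [map_mul, Module.End.mul_apply, this, hv]
    simp only [LinearMap.add_apply, LinearMap.smul_apply, map_add, map_smul, smul_eq_mul]
    ring
  rcases hj with rfl | rfl
  · refine ⟨a + (a * f (α j) v + b * f (α i') v), b, LinearMap.ext fun x => ?_⟩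
    rw [LinearMap.comp_apply, hcomp]
    simp only [LinearMap.add_apply, LinearMap.smul_apply, smul_eq_mul]
    ring
  · refine ⟨a, b + (a * f (α i) v + b * f (α j) v), LinearMap.ext fun x => ?_⟩
    rw [LinearMap.comp_apply, hcomp]
    simp only [LinearMap.add_apply, LinearMap.smul_apply, smul_eq_mul]
    ring

theorem inPlane_of_mul_gen (hj : j = i ∨ j = i') (hk : InPlane ρ f α i i' (w * s j) k) :
    InPlane ρ f α i i' w k := by
  have := h.inPlane_mul_gen hj hk
  rwa [mul_assoc, h.sq, mul_one] at this

theorem inPlane_walls (hw : w ∈ Subgroup.closure (Set.range s)) (hl : ∀ j ∈ l, j = i ∨ j = i') :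
    ∀ k ∈ walls s ρ f S α w l, InPlane ρ f α i i' w k := by
  induction l generalizing w with
  | nil => simp [walls]
  | cons j l ih =>
    intro k hk
    have hj := hl j (by simp)
    rcases List.mem_cons.1 hk with rfl | hk
    · rcases (h.wall_spec hw j).2 with e | e <;> rcases hj with rfl | rfl
      · exact ⟨1, 0, by rw [e]; simp⟩
      · exact ⟨0, 1, by rw [e]; simp⟩
      · exact ⟨-1, 0, by rw [e]; module⟩
      · exact ⟨0, -1, by rw [e]; module⟩
    · exact h.inPlane_of_mul_gen hj
        (ih (mul_mem hw (gen_mem s j)) (fun j' hj' => hl j' (by simp [hj'])) k hk)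

theorem letters_of_inPlane (hw : w ∈ Subgroup.closure (Set.range s)) (hii : i ≠ i')
    (hl : ∀ k ∈ walls s ρ f S α w l, InPlane ρ f α i i' w k) : ∀ j ∈ l, j = i ∨ j = i' := by
  induction l generalizing w with
  | nil => simp
  | cons j l ih =>
    have hj : j = i ∨ j = i' := by
      obtain ⟨a, b, e⟩ := hl _ (List.mem_cons_self)
      rcases (h.wall_spec hw j).2 with e' | e' <;> rw [e'] at e
      · exact h.simple_indep hii e
      · refine h.simple_indep (a := -a) (b := -b) hii ?_
        rw [← neg_neg (f (α j)), e]
        module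
    intro j' hj'
    rcases List.mem_cons.1 hj' with rfl | hj'
    · exact hj
    · exact ih (mul_mem hw (gen_mem s j))
        (fun k hk => h.inPlane_mul_gen hj (hl k (List.mem_cons_of_mem _ hk))) j' hj'

/-- An alternating word of length `m + 1`, with `m` the order of the product, equals one of length
`m - 1` by the braid relation and a cancellation; it cannot occur in a reduced word. -/
theorem le_orderOf_of_tight {x y : J} {n : ℕ} (hw : w ∈ Subgroup.closure (Set.range s))
    (hn : (s x * s y) ^ n = 1) (hn0 : 0 < n) (ht : Tight s ρ f S x₀ w (alternatingWord x y n)) :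
    n ≤ orderOf (s x * s y) := by
  by_contra hlt
  push Not at hlt
  set m := orderOf (s x * s y) with hm
  have hm0 : 0 < m := orderOf_pos_iff.2 (isOfFinOrder_iff_pow_eq_one.2 ⟨n, hn0, hn⟩)
  obtain ⟨p, hp⟩ := exists_prefix_alternatingWord x y (Nat.succ_le_of_lt hlt)
  rw [hp] at ht
  have ht' := (Tight.append h hw ht).2
  have hprod : ((alternatingWord x y (m + 1)).map s).prod =
      ((alternatingWord y x (m - 1)).map s).prod := by
    have e1 := (prod_alternatingWord_eq_iff h.sq x y m).2 (pow_orderOf_eq_one _)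
    obtain ⟨m', hm'⟩ : ∃ m', m = m' + 1 := ⟨m - 1, by omega⟩
    rw [alternatingWord_succ', List.map_cons, List.prod_cons, e1, hm', alternatingWord_succ',
      List.map_cons, List.prod_cons, ← mul_assoc, Nat.add_sub_cancel]
    have : (if Even (m' + 1) then y else x) = if Even m' then x else y := by
      simp only [Nat.even_add_one]
      split_ifs <;> rfl
    rw [this, h.sq, one_mul]
  have hle := h.ncard_inversions_mul_prod_le (mul_mem hw (prod_mem s p)) (alternatingWord y x (m - 1))
  unfold Tight at ht'
  rw [Nat.succ_eq_add_one, hprod, length_alternatingWord] at ht'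
  rw [length_alternatingWord] at hle
  omega

/-- The two words agree outside the flipped block. Inside it all walls lie in one plane, spanned by
the two first walls, so only two letters occur. Reducedness makes both subwords alternating, and
their equal products force the length to be the order of the product of the two generators. -/
theorem braidMove_of_flipAt {w₀ : G} (hS : inversions ρ f S x₀ w₀ = S) {L : Set ι}
    (hl : (l.map s).prod = w₀) (hlen : l.length = S.ncard)
    (hl' : (l'.map s).prod = w₀) (hlen' : l'.length = S.ncard)
    (hf : FlipAt f S L (walls s ρ f S α 1 l) (walls s ρ f S α 1 l')) : BraidMove s l l' := by
  have h1 := one_mem (Subgroup.closure (Set.range s))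
  have htight : ∀ l : List J, (l.map s).prod = w₀ → l.length = S.ncard →
      Tight s ρ f S x₀ 1 l := by
    intro l hl hlen
    unfold Tight
    rw [one_mul, hl, hS, h.inversions_one, hlen]
    simp
  have ht := htight l hl hlen
  have ht' := htight l' hl' hlen'
  obtain ⟨hr, hr', hL, u, m, v, e, e', hm⟩ := hf
  obtain ⟨l₁₂, l₃, rfl, e12, e3⟩ := exists_of_walls_eq_append e
  obtain ⟨l₁, l₂, rfl, e1, e2⟩ := exists_of_walls_eq_append e12
  obtain ⟨l₁₂', l₃', rfl, e12', e3'⟩ := exists_of_walls_eq_append e'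
  obtain ⟨l₁', l₂', rfl, e1', e2'⟩ := exists_of_walls_eq_append e12'
  obtain rfl : l₁ = l₁' := h.walls_injective h1 (e1.trans e1'.symm)
  rw [one_mul] at e2 e2'
  set w := (l₁.map s).prod with hwdef
  have hw : w ∈ Subgroup.closure (Set.range s) := prod_mem s l₁
  have t12 := (Tight.append h h1 ht).1
  have t12' := (Tight.append h h1 ht').1
  have t2 : Tight s ρ f S x₀ w l₂ := by simpa using (Tight.append h h1 t12).2
  have t2' : Tight s ρ f S x₀ w l₂' := by simpa using (Tight.append h h1 t12').2
  have hprod : w * (l₂.map s).prod = w * (l₂'.map s).prod := by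
    refine h.inversions_injective (mul_mem hw (prod_mem s _)) (mul_mem hw (prod_mem s _)) ?_
    ext k
    rw [(Tight.walls h hw t2).2.2, (Tight.walls h hw t2').2.2, e2, e2', List.mem_reverse]
  obtain rfl : l₃ = l₃' := by
    refine h.walls_injective (w := w * (l₂.map s).prod) (mul_mem hw (prod_mem s _)) ?_
    rw [one_mul, List.map_append, List.prod_append, ← hwdef] at e3 e3'
    rw [e3, hprod, e3']
  have hmn : m.Nodup := e2 ▸ (Tight.walls h hw t2).1
  obtain ⟨a₀, ha₀, b₀, hb₀, hab₀, hL₀⟩ := id hL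
  have ha₀m : a₀ ∈ m := (hm a₀).2 (hL₀ ▸ left_mem_line ha₀)
  have hb₀m : b₀ ∈ m := (hm b₀).2 (hL₀ ▸ right_mem_line hb₀)
  obtain ⟨i, t, rfl⟩ : ∃ i t, l₂ = i :: t := by
    cases l₂ with
    | nil => rw [← e2] at ha₀m; simp [walls] at ha₀m
    | cons i t => exact ⟨i, t, rfl⟩
  obtain ⟨i', t', rfl⟩ : ∃ i t, l₂' = i :: t := by
    cases l₂' with
    | nil => rw [← List.mem_reverse, ← e2'] at ha₀m; simp [walls] at ha₀m
    | cons i t => exact ⟨i, t, rfl⟩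
  rw [walls] at e2 e2'
  -- Equal first letters would give equal first walls of `m` and of its reversal. Then `m`, being
  -- duplicate-free, would have a single element, but it contains a whole flat.
  have hne : i ≠ i' := by
    rintro rfl
    have hrev := congrArg List.reverse e2'
    rw [List.reverse_reverse, List.reverse_cons] at hrev
    rw [← e2] at hrev hmn ha₀m hb₀m
    have hnil : walls s ρ f S α (w * s i) t = [] := by
      cases hc : walls s ρ f S α (w * s i) t using List.reverseRecOn with
      | nil => rfl
      | append_singleton t₀ y =>
        rw [hc] at hrev hmn
        rw [← List.cons_append] at hrev
        have := (List.append_inj' hrev rfl).2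
        simp at this
        simp [this] at hmn
    rw [hnil] at ha₀m hb₀m
    simp at ha₀m hb₀m
    exact hab₀ (ha₀m.trans hb₀m.symm)
  set a := wall ρ f S α w i with ha
  set b := wall ρ f S α w i' with hb
  have ham : a ∈ m := by rw [← e2]; simp
  have hbm : b ∈ m := by rw [← List.mem_reverse, ← e2']; simp
  have hab : a ≠ b := fun hab => hne (h.wall_injective hw hab)
  have hLab := h.posFamily.eq_line hL ((hm a).1 ham) ((hm b).1 hbm) hab
  have hplane : ∀ k ∈ m, InPlane ρ f α i i' w k := by
    intro k hk
    have hkL := (hm k).1 hk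
    rw [hLab] at hkL
    obtain ⟨-, p, q, hpq⟩ := hkL
    have hk' : f k ∘ₗ ρ w = p • (f a ∘ₗ ρ w) + q • (f b ∘ₗ ρ w) := by
      rw [hpq]; rfl
    rcases (h.wall_spec hw i).2 with c | c <;> rcases (h.wall_spec hw i').2 with d | d <;>
      rw [c, d] at hk'
    · exact ⟨p, q, hk'⟩
    · exact ⟨p, -q, by rw [hk']; module⟩
    · exact ⟨-p, q, by rw [hk']; module⟩
    · exact ⟨-p, -q, by rw [hk']; module⟩
  have hlet := h.letters_of_inPlane (l := i :: t) hw hne (by rw [walls, e2]; exact hplane)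
  have hlet' := h.letters_of_inPlane (l := i' :: t') hw hne (by
    rw [walls, e2']; exact fun k hk => hplane k (List.mem_reverse.1 hk))
  have hlen2 : (i :: t).length = (i' :: t').length := by
    have q1 := congrArg List.length e2
    have q2 := congrArg List.length e2'
    simp only [List.length_cons, length_walls, List.length_reverse] at q1 q2
    simp only [List.length_cons]
    omega
  have hmain : ∀ x y n, 0 < n → i :: t = alternatingWord x y n → i' :: t' = alternatingWord y x n →
      x ≠ y → BraidMove s (l₁ ++ (i :: t) ++ l₃) (l₁ ++ (i' :: t') ++ l₃) := by
    intro x y n hn0 hx hy hxy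
    have hpow : (s x * s y) ^ n = 1 := by
      rw [← prod_alternatingWord_eq_iff h.sq, ← hx, ← hy]
      exact mul_left_cancel hprod
    have hle := h.le_orderOf_of_tight hw hpow hn0 (hx ▸ t2)
    have hn : n = orderOf (s x * s y) :=
      le_antisymm hle (orderOf_le_of_pow_eq_one hn0 hpow)
    exact ⟨x, y, l₁, l₃, hxy, by rw [hx, hn], by rw [hy, hn]⟩
  have halt := eq_alternatingWord hlet (Tight.isChain h hw t2)
  have halt' := eq_alternatingWord hlet' (Tight.isChain h hw t2')
  rw [← hlen2] at halt'
  have hdiff : i :: t ≠ i' :: t' := fun hc => hne (List.cons.inj hc).1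
  rcases halt with c | c <;> rcases halt' with d | d
  · exact absurd (c.trans d.symm) hdiff
  · exact hmain i i' _ (by simp) c d hne
  · exact hmain i' i _ (by simp) c d hne.symm
  · exact absurd (c.trans d.symm) hdiff

/-- The walls crossed by either alternating word lie in the flat of its two first walls, so no other
flat contains two of them. -/
theorem sepLines_encard_le_of_braidMove
    (hr : IsListGallery f S (walls s ρ f S α 1 l)) (hr' : IsListGallery f S (walls s ρ f S α 1 l'))
    (hb : BraidMove s l l') :
    (sepLines f S (walls s ρ f S α 1 l) (walls s ρ f S α 1 l')).encard ≤ 1 := by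
  obtain ⟨i, j, u, v, hij, rfl, rfl⟩ := hb
  set m := orderOf (s i * s j) with hmdef
  set w := (u.map s).prod with hwdef
  have hw : w ∈ Subgroup.closure (Set.range s) := prod_mem s u
  have hprod := (prod_alternatingWord_eq_iff h.sq i j m).2 (pow_orderOf_eq_one _)
  simp only [walls_append, one_mul, List.map_append, List.prod_append, ← hwdef, ← hprod] at hr hr' ⊢
  set U := walls s ρ f S α 1 u
  set p := walls s ρ f S α w (alternatingWord i j m)
  set q := walls s ρ f S α w (alternatingWord j i m)
  set T := walls s ρ f S α (w * ((alternatingWord i j m).map s).prod) v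
  have hpn : p.Nodup := hr.nodup.of_append_left.of_append_right
  have hqn : q.Nodup := hr'.nodup.of_append_left.of_append_right
  have hperm : p.Perm q := by
    have h1 : (U ++ p ++ T).Perm (U ++ q ++ T) :=
      perm_of_nodup_of_mem_iff hr.nodup hr'.nodup fun k => by rw [hr.mem_iff, hr'.mem_iff]
    exact (List.perm_append_left_iff U).1 ((List.perm_append_right_iff T).1 h1)
  set a := wall ρ f S α w i with ha
  set b := wall ρ f S α w j with hb
  have hab : a ≠ b := fun hab => hij (h.wall_injective hw hab)
  have haS := (h.wall_spec hw i).1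
  have hbS := (h.wall_spec hw j).1
  have hlet : ∀ (x y : J) n, ∀ z ∈ alternatingWord x y n, z = x ∨ z = y := by
    intro x y n
    induction n with
    | zero => simp [alternatingWord]
    | succ n ih =>
      intro z hz
      rw [alternatingWord_succ', List.mem_cons] at hz
      rcases hz with hz | hz
      · split_ifs at hz
        · exact Or.inr hz
        · exact Or.inl hz
      · exact ih z hz
  have hpline : ∀ k ∈ p, k ∈ line f S a b := by
    intro k hk
    obtain ⟨c, d, e⟩ := h.inPlane_walls hw (hlet i j m) k hk
    refine ⟨h.mem_of_mem_walls hw hk, ?_⟩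
    rcases (h.wall_spec hw i).2 with e1 | e1 <;> rcases (h.wall_spec hw j).2 with e2 | e2
    · exact ⟨c, d, comp_right_injective w (by
        rw [e, LinearMap.add_comp, LinearMap.smul_comp, LinearMap.smul_comp, e1, e2])⟩
    · exact ⟨c, -d, comp_right_injective w (by
        rw [e, LinearMap.add_comp, LinearMap.smul_comp, LinearMap.smul_comp, e1, e2]; module)⟩
    · exact ⟨-c, d, comp_right_injective w (by
        rw [e, LinearMap.add_comp, LinearMap.smul_comp, LinearMap.smul_comp, e1, e2]; module)⟩
    · exact ⟨-c, -d, comp_right_injective w (by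
        rw [e, LinearMap.add_comp, LinearMap.smul_comp, LinearMap.smul_comp, e1, e2]; module)⟩
  have hsub : sepLines f S (U ++ p ++ T) (U ++ q ++ T) ⊆ {line f S a b} := by
    rintro L ⟨hL, hne⟩
    by_contra hLne
    apply hne
    simp only [List.filter_append]
    rw [filter_eq_of_perm_of_subsingleton hpn hperm]
    intro k hk k' hk' hkL hkL'
    by_contra hkk
    apply hLne
    rw [Set.mem_singleton_iff, h.posFamily.eq_line hL (by simpa using hkL) (by simpa using hkL') hkk,
      h.posFamily.line_eq haS hbS hkk (hpline k hk) (hpline k' hk')]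
  exact (Set.encard_le_encard hsub).trans (Set.encard_singleton _).le

/-- Reduced words of `w₀` correspond bijectively to galleries; flips give edges and edges separate
at most one flat, so the general diameter statement applies. -/
theorem exists_longest_ediam (hchain : HasModularChain f S) :
    ∃ w₀, (∀ w, IsLongest s w ↔ w = w₀) ∧
      (wordGraph s w₀).ediam = (lines f S).encard := by
  obtain ⟨w₀, hw₀, hS⟩ := h.exists_inversions_eq
  refine ⟨w₀, h.isLongest_iff hw₀ hS, ?_⟩
  obtain ⟨r₀, hr₀⟩ := hchain.exists_accessible h.posFamily
  have hlen : wordLength s w₀ = S.ncard := by rw [h.wordLength_eq hw₀, hS]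
  have hgal : ∀ l : ReducedWord s w₀, IsListGallery f S (walls s ρ f S α 1 l.1) :=
    fun l => h.isListGallery_walls hS l.2.1 (l.2.2.trans hlen)
  refine ediam_eq (φ := fun l : ReducedWord s w₀ => walls s ρ f S α 1 l.1) h.posFamily hgal
    (fun r hr => ?_) (fun l l' e => ?_) (fun l l' L hf => ?_) (fun l l' hadj => ?_) hr₀
  · obtain ⟨l, hl, hlw, hll⟩ := h.exists_word_of_gallery hw₀ hS hr
    exact ⟨⟨l, hlw, hll.trans hlen.symm⟩, hl⟩
  · exact Subtype.ext (h.walls_injective (one_mem _) e)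
  · rw [wordGraph, SimpleGraph.fromRel_adj]
    refine ⟨?_, Or.inl (h.braidMove_of_flipAt hS l.2.1 (l.2.2.trans hlen) l'.2.1
      (l'.2.2.trans hlen) hf)⟩
    rintro rfl
    have := hf.sepLines_eq h.posFamily
    rw [sepLines_self] at this
    exact Set.singleton_ne_empty L this.symm
  · rw [wordGraph, SimpleGraph.fromRel_adj] at hadj
    rcases hadj.2 with hb | hb
    · exact h.sepLines_encard_le_of_braidMove (hgal l) (hgal l') hb
    · rw [sepLines_comm]
      exact h.sepLines_encard_le_of_braidMove (hgal l') (hgal l) hb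

end

end IsRootFamily

end ReducedWords

/-! ### Rank-two flats added by a modular step, and passage to a quotient. -/

namespace ListGallery

open scoped Classical

variable {V ι : Type*} [AddCommGroup V] [Module ℝ V] {f : ι → Module.Dual ℝ V} {S T : Set ι}
  {x₀ e : V}

/-- The rank-two flats created in a modular step, counted by representatives `(K, H)` with `K ∈ T`
and `H ∈ S \ T`. -/
theorem IsModularStep.encard_lines (h : IsModularStep f S T e) (hf : IsPosFamily f S x₀)
    {P : Set (ι × ι)} (hP : ∀ p ∈ P, p.1 ∈ T ∧ p.2 ∈ S ∧ p.2 ∉ T)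
    (hinj : ∀ K H H', (K, H) ∈ P → (K, H') ∈ P → H' ∈ line f S K H → H = H')
    (hsurj : ∀ K ∈ T, ∀ H ∈ S, H ∉ T → ∃ H', (K, H') ∈ P ∧ H' ∈ line f S K H) :
    (lines f S).encard = (lines f T).encard + P.encard := by
  have hne : ∀ p ∈ P, p.1 ≠ p.2 := by
    rintro ⟨K, H⟩ hp (e : K = H)
    exact (hP _ hp).2.2 (e ▸ (hP _ hp).1)
  have hinjOn : Set.InjOn (fun p : ι × ι => line f S p.1 p.2) P := by
    rintro ⟨K, H⟩ hp ⟨K', H'⟩ hp' (e : line f S K H = line f S K' H')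
    obtain ⟨hK, hH, hHT⟩ := hP _ hp
    obtain ⟨hK', hH', hHT'⟩ := hP _ hp'
    -- A flat that leaves `T` contains just one member of `T`, so the flat determines the first
    -- component of its representative.
    obtain rfl : K' = K := h.mem_unique hf hH hHT hK hK' (e ▸ left_mem_line (h.subset hK'))
    rw [hinj K' H H' hp hp' (e ▸ right_mem_line hH')]
  have hunion : lines f S = lines f T ∪ (fun p : ι × ι => line f S p.1 p.2) '' P := by
    apply Set.Subset.antisymm
    · have key : ∀ K ∈ T, ∀ H ∈ S, H ∉ T → ∀ L ∈ lines f S, K ∈ L → H ∈ L →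
          L ∈ (fun p : ι × ι => line f S p.1 p.2) '' P := by
        intro K hK H hH hHT L hL hKL hHL
        have hKH : K ≠ H := by rintro rfl; exact hHT hK
        obtain ⟨H', hp, hH'⟩ := hsurj K hK H hH hHT
        have hL' := hf.eq_line hL hKL hHL hKH
        refine ⟨(K, H'), hp, ?_⟩
        rw [hL']
        exact hf.line_eq (h.subset hK) hH (hne _ hp) (left_mem_line (h.subset hK)) hH'
      intro L hL
      obtain ⟨a, ha, b, hb, hab, rfl⟩ := id hL
      by_cases haT : a ∈ T
      · by_cases hbT : b ∈ T
        · exact Or.inl ⟨a, haT, b, hbT, hab, h.line_eq haT hbT⟩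
        · exact Or.inr (key a haT b hb hbT _ hL (left_mem_line ha) (right_mem_line hb))
      · by_cases hbT : b ∈ T
        · exact Or.inr (key b hbT a ha haT _ hL (right_mem_line hb) (left_mem_line ha))
        · obtain ⟨K, hK, hKl⟩ := h.modular a ha haT b hb hbT hab
          exact Or.inr (key K hK a ha haT _ hL hKl (left_mem_line ha))
    · rintro L (hL | ⟨p, hp, rfl⟩)
      · exact h.lines_subset hL
      · exact line_mem_lines (h.subset (hP p hp).1) (hP p hp).2.1 (hne p hp)
  have hdisj : Disjoint (lines f T) ((fun p : ι × ι => line f S p.1 p.2) '' P) := by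
    rw [Set.disjoint_left]
    rintro L hL ⟨p, hp, rfl⟩
    exact (hP p hp).2.2 (subset_of_mem_lines hL (right_mem_line (hP p hp).2.1))
  rw [hunion, Set.encard_union_eq hdisj, hinjOn.encard_image]

section Quotient

variable {U : Submodule ℝ V} {g : ι → Module.Dual ℝ (V ⧸ U)}

theorem line_quotient (hg : ∀ k ∈ S, g k ∘ₗ U.mkQ = f k) {a b : ι} (ha : a ∈ S) (hb : b ∈ S) :
    line g S a b = line f S a b := by
  ext k
  refine and_congr_right fun hk => exists_congr fun α => exists_congr fun β => ?_
  rw [← hg k hk, ← hg a ha, ← hg b hb, ← LinearMap.smul_comp, ← LinearMap.smul_comp,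
    ← LinearMap.add_comp, LinearMap.cancel_right U.mkQ_surjective]

theorem lines_quotient (hg : ∀ k ∈ S, g k ∘ₗ U.mkQ = f k) : lines g S = lines f S := by
  ext L
  constructor
  · rintro ⟨a, ha, b, hb, hab, rfl⟩
    exact ⟨a, ha, b, hb, hab, line_quotient hg ha hb⟩
  · rintro ⟨a, ha, b, hb, hab, rfl⟩
    exact ⟨a, ha, b, hb, hab, (line_quotient hg ha hb).symm⟩

theorem IsPosFamily.quotient (hf : IsPosFamily f S x₀) (hg : ∀ k ∈ S, g k ∘ₗ U.mkQ = f k) :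
    IsPosFamily g S (U.mkQ x₀) := by
  refine ⟨fun k hk => ?_, fun a ha b hb α e => ?_⟩
  · rw [← LinearMap.comp_apply, hg k hk]
    exact hf.pos k hk
  · refine hf.inj a ha b hb α ?_
    rw [← hg a ha, ← hg b hb, e, LinearMap.smul_comp]

end Quotient

end ListGallery

/-! ### Roots of types A and B and their modular chains. -/

namespace ReducedWords

open ListGallery

open scoped Classical

/-- Indices of the positive roots of types `A` and `B`: `(m, i, s)` stands for `x_m + s x_i`. -/
abbrev RootIndex (n : ℕ) : Type := Fin n × Fin n × SignType

/-- The functional `x_m + s x_i`. -/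
def root {n : ℕ} (k : RootIndex n) : Module.Dual ℝ (Fin n → ℝ) :=
  LinearMap.proj k.1 + (k.2.2 : ℝ) • LinearMap.proj k.2.1

theorem root_apply {n : ℕ} (k : RootIndex n) (x : Fin n → ℝ) :
    root k x = x k.1 + (k.2.2 : ℝ) * x k.2.1 := rfl

/-- The positive roots `x_m - x_i`, `i < m`, of type `A` involving only the first `N`
coordinates. -/
def rootsA (n N : ℕ) : Set (RootIndex n) := {k | k.1.val < N ∧ k.2.1 < k.1 ∧ k.2.2 = -1}

/-- The positive roots `x_m ± x_i`, `i < m`, and `x_m`, of type `B` involving only the first `N`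
coordinates. -/
def rootsB (n N : ℕ) : Set (RootIndex n) :=
  {k | k.1.val < N ∧ ((k.2.1 < k.1 ∧ k.2.2 ≠ 0) ∨ (k.2.1 = k.1 ∧ k.2.2 = 0))}

theorem rootsA_subset_rootsB (n N : ℕ) : rootsA n N ⊆ rootsB n N :=
  fun k hk => ⟨hk.1, Or.inl ⟨hk.2.1, by rw [hk.2.2]; decide⟩⟩

/-- The base point `(1, 2, …, n)`. -/
def basePoint (n : ℕ) : Fin n → ℝ := fun i => (i : ℝ) + 1

theorem sign_cases (s : SignType) : s = 0 ∨ s = 1 ∨ s = -1 := by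
  cases s <;> decide

section RootLemmas

variable {n N : ℕ}

theorem rootsB_le {k : RootIndex n} (hk : k ∈ rootsB n N) : k.2.1 ≤ k.1 := by
  rcases hk.2 with h | h
  · exact h.1.le
  · exact h.1.le

theorem root_single_top {k : RootIndex n} (hk : k ∈ rootsB n N) :
    root k (Pi.single k.1 1) = 1 := by
  rw [root_apply]
  rcases hk.2 with ⟨h, -⟩ | ⟨-, h⟩
  · simp [h.ne]
  · simp [h]

theorem root_single_of_ne {k : RootIndex n} {j : Fin n} (h1 : k.1 ≠ j) (h2 : k.2.1 ≠ j) :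
    root k (Pi.single j 1) = 0 := by
  rw [root_apply]
  simp [h1, h2]

theorem root_single_bot_ne_zero {k : RootIndex n} (hk : k ∈ rootsB n N) :
    root k (Pi.single k.2.1 1) ≠ 0 := by
  rw [root_apply]
  rcases hk.2 with ⟨h, hs⟩ | ⟨h, hs⟩
  · rcases sign_cases k.2.2 with e | e | e
    · exact absurd e hs
    · simp [h.ne', e]
    · simp [h.ne', e]
  · simp [h, hs]

/-- The larger coordinate occurs with coefficient one, so proportional roots have the same top
coordinate and factor one; comparing the lower terms finishes. -/
theorem isPosFamily_rootsB (n N : ℕ) : IsPosFamily root (rootsB n N) (basePoint n) := by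
  refine ⟨fun k hk => ?_, ?_⟩
  · rw [root_apply, basePoint, basePoint]
    have hm : (0 : ℝ) ≤ (k.1 : ℝ) := Nat.cast_nonneg _
    have hi : (0 : ℝ) ≤ (k.2.1 : ℝ) := Nat.cast_nonneg _
    rcases hk.2 with ⟨h, -⟩ | ⟨-, h⟩
    · have h' : (k.2.1 : ℝ) < (k.1 : ℝ) := by exact_mod_cast h
      rcases sign_cases k.2.2 with e | e | e <;> simp only [e]
      · simp; linarith
      · simp; linarith
      · simpa using h
    · simp only [h]; simp; linarith
  · rintro a ha b hb c e
    have hx : ∀ x, root a x = c * root b x := fun x => by rw [e]; simp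
    have hab : a.1 = b.1 := by
      rcases lt_trichotomy a.1 b.1 with h | h | h
      · have h1 := hx (Pi.single b.1 1)
        rw [root_single_top hb, root_single_of_ne h.ne ((rootsB_le ha).trans_lt h).ne] at h1
        have h2 := hx (Pi.single a.1 1)
        rw [root_single_top ha, ← mul_one c, ← h1, zero_mul] at h2
        norm_num at h2
      · exact h
      · have h1 := hx (Pi.single a.1 1)
        rw [root_single_top ha, root_single_of_ne h.ne ((rootsB_le hb).trans_lt h).ne] at h1
        norm_num at h1
    have hc : c = 1 := by
      have h1 := hx (Pi.single b.1 1)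
      rw [root_single_top hb, ← hab, root_single_top ha] at h1
      linarith
    obtain ⟨m, i, s⟩ := a
    obtain ⟨m', i', s'⟩ := b
    simp only at hab
    subst hab
    have hx' : ∀ x : Fin n → ℝ, (s : ℝ) * x i = (s' : ℝ) * x i' := by
      intro x
      have := hx x
      rw [hc, root_apply, root_apply] at this
      simp only at this
      linarith
    have hbig : ∀ (i i' : Fin n) (s s' : SignType), s ≠ 0 →
        (∀ x : Fin n → ℝ, (s : ℝ) * x i = (s' : ℝ) * x i') → i = i' ∧ s = s' := by
      intro i i' s s' hs hx
      have h1 := hx (Pi.single i 1)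
      by_cases hii : i' = i
      · subst hii
        refine ⟨rfl, ?_⟩
        rcases sign_cases s with e | e | e <;> rcases sign_cases s' with e' | e' | e' <;>
          simp only [e, e'] at h1 ⊢ <;> norm_num at h1
      · exfalso
        rcases sign_cases s with e | e | e
        · exact hs e
        · simp [e, hii] at h1
        · simp [e, hii] at h1
    rcases ha.2 with ⟨h, hs⟩ | ⟨h, hs⟩
    · obtain ⟨rfl, rfl⟩ := hbig i i' s s' hs hx'
      rfl
    · rcases hb.2 with ⟨h', hs'⟩ | ⟨h', hs'⟩
      · obtain ⟨rfl, rfl⟩ := hbig i' i s' s hs' fun x => (hx' x).symm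
        rfl
      · simp only at h hs h' hs'
        rw [h, hs, h', hs']

/-- The direction is the newest coordinate vector. Two roots involving that coordinate have a
difference free of it, and this difference is up to a scalar a root in the earlier coordinates. -/
theorem isModularStep_rootsB (hN : N < n) :
    IsModularStep root (rootsB n (N + 1)) (rootsB n N) (Pi.single ⟨N, hN⟩ 1) := by
  have htop : ∀ k ∈ rootsB n (N + 1), k ∉ rootsB n N → k.1 = ⟨N, hN⟩ := by
    intro k hk hk'
    have h1 := hk.1
    have h2 : ¬ k.1.val < N := fun h => hk' ⟨h, hk.2⟩
    exact Fin.ext (by simp; omega)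
  refine ⟨fun k hk => ⟨hk.1.trans (Nat.lt_succ_self N), hk.2⟩, fun k hk => ?_, fun k hk hk' => ?_, ?_⟩
  · have h1 := hk.1
    have h2 : k.2.1.val ≤ k.1.val := rootsB_le hk
    exact root_single_of_ne (fun h => by simp [h] at h1) (fun h => by rw [h] at h2; simp at h2; omega)
  · rw [← htop k hk hk', root_single_top hk]
    exact one_pos
  · rintro ⟨m, i, s⟩ ha haT ⟨m', i', s'⟩ hb hbT hab
    have hm := htop _ ha haT
    have hm' := htop _ hb hbT
    simp only at hm hm'
    subst hm
    subst hm'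
    have hin : ∀ k : RootIndex n, k.1 < ⟨N, hN⟩ →
        ((k.2.1 < k.1 ∧ k.2.2 ≠ 0) ∨ (k.2.1 = k.1 ∧ k.2.2 = 0)) →
        (∃ α β : ℝ, root k = α • root (⟨N, hN⟩, i, s) + β • root (⟨N, hN⟩, i', s')) →
        ∃ K ∈ rootsB n N, K ∈ line root (rootsB n (N + 1)) (⟨N, hN⟩, i, s) (⟨N, hN⟩, i', s') := by
      intro k hk hk' hl
      have hk1 : k.1.val < N := hk
      exact ⟨k, ⟨hk1, hk'⟩, ⟨Nat.lt_succ_of_lt hk1, hk'⟩, hl⟩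
    have hss : ∀ s : SignType, s ≠ 0 → (s : ℝ) * s = 1 := by
      intro s hs
      rcases sign_cases s with e | e | e
      · exact absurd e hs
      · simp [e]
      · simp [e]
    rcases ha.2 with ⟨hi, hs⟩ | ⟨hi, hs⟩ <;> rcases hb.2 with ⟨hi', hs'⟩ | ⟨hi', hs'⟩ <;>
      simp only at hi hs hi' hs'
    · rcases lt_trichotomy i i' with hlt | heq | hgt
      · refine hin (i', i, -(s * s')) hi' (Or.inl ⟨hlt, by simp [hs, hs']⟩)
          ⟨-s', s', LinearMap.ext fun x => ?_⟩
        simp only [root_apply, LinearMap.add_apply, LinearMap.smul_apply, smul_eq_mul,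
          SignType.coe_neg, SignType.coe_mul]
        linear_combination -(x i') * hss s' hs'
      · subst heq
        have hne : s ≠ s' := fun h => hab (by rw [h])
        have hneg : s' = -s := by
          rcases sign_cases s with e | e | e <;> rcases sign_cases s' with e' | e' | e' <;>
            simp_all
        -- The two roots are `x_N ± x_i`: their difference is `±2 x_i`, which explains the halves.
        refine hin (i, i, 0) hi (Or.inr ⟨rfl, rfl⟩) ⟨s / 2, -s / 2, LinearMap.ext fun x => ?_⟩
        rw [hneg]
        simp only [root_apply, LinearMap.add_apply, LinearMap.smul_apply, smul_eq_mul,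
          SignType.coe_neg, SignType.coe_zero]
        linear_combination -(x i) * hss s hs
      · refine hin (i, i', -(s * s')) hi (Or.inl ⟨hgt, by simp [hs, hs']⟩)
          ⟨s, -s, LinearMap.ext fun x => ?_⟩
        simp only [root_apply, LinearMap.add_apply, LinearMap.smul_apply, smul_eq_mul,
          SignType.coe_neg, SignType.coe_mul]
        linear_combination -(x i) * hss s hs
    · refine hin (i, i, 0) hi (Or.inr ⟨rfl, rfl⟩) ⟨s, -s, LinearMap.ext fun x => ?_⟩
      rw [hs']
      simp only [root_apply, LinearMap.add_apply, LinearMap.smul_apply, smul_eq_mul,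
        SignType.coe_zero]
      linear_combination -(x i) * hss s hs
    · refine hin (i', i', 0) hi' (Or.inr ⟨rfl, rfl⟩) ⟨-s', s', LinearMap.ext fun x => ?_⟩
      rw [hs]
      simp only [root_apply, LinearMap.add_apply, LinearMap.smul_apply, smul_eq_mul,
        SignType.coe_zero]
      linear_combination -(x i') * hss s' hs'
    · exact absurd (by rw [hi, hs, hi', hs']) hab

theorem isModularStep_rootsA (hN : N < n) :
    IsModularStep root (rootsA n (N + 1)) (rootsA n N) (Pi.single ⟨N, hN⟩ 1) := by
  have hB := isModularStep_rootsB hN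
  have hmem : ∀ k ∈ rootsA n (N + 1), k ∉ rootsA n N → k ∉ rootsB n N :=
    fun k hk hk' hkB => hk' ⟨hkB.1, hk.2⟩
  refine ⟨fun k hk => ⟨hk.1.trans (Nat.lt_succ_self N), hk.2⟩,
    fun k hk => hB.zero k (rootsA_subset_rootsB n N hk),
    fun k hk hk' => hB.pos k (rootsA_subset_rootsB _ _ hk) (hmem k hk hk'), ?_⟩
  rintro ⟨m, i, s⟩ ha haT ⟨m', i', s'⟩ hb hbT hab
  obtain ⟨h1, hi, hs⟩ := ha
  obtain ⟨h2, hi', hs'⟩ := hb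
  simp only at h1 hi hs h2 hi' hs'
  subst hs hs'
  have hm : m.val = N := by
    by_contra hne
    exact haT ⟨show m.val < N by omega, hi, rfl⟩
  have hm' : m'.val = N := by
    by_contra hne
    exact hbT ⟨show m'.val < N by omega, hi', rfl⟩
  obtain rfl : m = m' := Fin.ext (hm.trans hm'.symm)
  have hi1 : i.val < N := by rw [← hm]; exact hi
  have hi2 : i'.val < N := by rw [← hm]; exact hi'
  rcases lt_trichotomy i i' with hlt | heq | hgt
  · refine ⟨(i', i, -1), ⟨hi2, hlt, rfl⟩, ⟨show i'.val < N + 1 by omega, hlt, rfl⟩, 1, -1,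
      LinearMap.ext fun x => ?_⟩
    simp only [root_apply, LinearMap.add_apply, LinearMap.smul_apply, smul_eq_mul,
      SignType.coe_neg, SignType.coe_one]
    ring
  · exact absurd (by rw [heq]) hab
  · refine ⟨(i, i', -1), ⟨hi1, hgt, rfl⟩, ⟨show i.val < N + 1 by omega, hgt, rfl⟩, -1, 1,
      LinearMap.ext fun x => ?_⟩
    simp only [root_apply, LinearMap.add_apply, LinearMap.smul_apply, smul_eq_mul,
      SignType.coe_neg, SignType.coe_one]
    ring

theorem rootsA_zero : rootsA n 0 = ∅ := by
  ext k; simp [rootsA]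

theorem rootsB_zero : rootsB n 0 = ∅ := by
  ext k; simp [rootsB]

theorem hasModularChain_rootsA (hN : N ≤ n) : HasModularChain root (rootsA n N) := by
  induction N with
  | zero => rw [rootsA_zero]; exact .empty
  | succ N ih => exact .step (Set.toFinite _) (isModularStep_rootsA hN) (ih (Nat.le_of_succ_le hN))

theorem hasModularChain_rootsB (hN : N ≤ n) : HasModularChain root (rootsB n N) := by
  induction N with
  | zero => rw [rootsB_zero]; exact .empty
  | succ N ih => exact .step (Set.toFinite _) (isModularStep_rootsB hN) (ih (Nat.le_of_succ_le hN))

end RootLemmas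

end ReducedWords

/-! ### Numbers of rank-two flats in types A and B. -/

namespace ReducedWords

open ListGallery

open scoped Classical

section Counting

variable {n N : ℕ}

/-- Representatives of the rank-two flats created by the coordinate `N`. -/
def newFlats (R R' : Set (RootIndex n)) : Set (RootIndex n × RootIndex n) :=
  {p | p.1 ∈ R ∧ (p.2 ∈ R' ∧ p.2 ∉ R) ∧ p.2.2.1 ≠ p.1.2.1}

/-- Evaluation at the new coordinate vector gives `β = 1`. Neither representative involves the lower
coordinate of `K`, whereas `K` does, so evaluation there gives `α = 0`. -/
theorem newFlats_inj (hN : N < n) {K H H' : RootIndex n} (hK : K ∈ rootsB n N)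
    (hH : H ∈ rootsB n (N + 1)) (hHT : H ∉ rootsB n N) (hH' : H' ∈ rootsB n (N + 1))
    (hHT' : H' ∉ rootsB n N) (hne : H.2.1 ≠ K.2.1) (hne' : H'.2.1 ≠ K.2.1)
    (hl : ∃ α β : ℝ, root H' = α • root K + β • root H) : H = H' := by
  have htop : ∀ k ∈ rootsB n (N + 1), k ∉ rootsB n N → k.1 = ⟨N, hN⟩ := by
    intro k hk hk'
    have h1 := hk.1
    have h2 : ¬ k.1.val < N := fun h => hk' ⟨h, hk.2⟩
    exact Fin.ext (by simp; omega)
  have hst := isModularStep_rootsB hN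
  obtain ⟨α, β, hl⟩ := hl
  have hx : ∀ x, root H' x = α * root K x + β * root H x := fun x => by rw [hl]; simp
  have e1 := htop H hH hHT
  have e2 := htop H' hH' hHT'
  have hβ : β = 1 := by
    have h1 := hx (Pi.single ⟨N, hN⟩ 1)
    rw [hst.zero K hK] at h1
    conv at h1 => lhs; rw [← e2, root_single_top hH']
    rw [← e1, root_single_top hH] at h1
    linarith
  have hKN : K.2.1.val < N := lt_of_le_of_lt (rootsB_le hK) hK.1
  have hKne : (⟨N, hN⟩ : Fin n) ≠ K.2.1 := fun h => by rw [← h] at hKN; simp at hKN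
  have hα : α = 0 := by
    have h1 := hx (Pi.single K.2.1 1)
    rw [root_single_of_ne (e2 ▸ hKne) hne', root_single_of_ne (e1 ▸ hKne) hne] at h1
    have h2 : α * root K (Pi.single K.2.1 1) = 0 := by linarith
    exact (mul_eq_zero.1 h2).resolve_right (root_single_bot_ne_zero hK)
  refine ((isPosFamily_rootsB n (N + 1)).inj H' hH' H hH 1 ?_).symm
  rw [hl, hα, hβ, zero_smul, zero_add]

/-- Within a new flat through `K`, a root sharing its lower coordinate with `K` is normalized by
eliminating that coordinate with a multiple of `K`. -/
theorem encard_lines_rootsB_succ (hN : N < n) :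
    (lines root (rootsB n (N + 1))).encard = (lines root (rootsB n N)).encard +
      (newFlats (rootsB n N) (rootsB n (N + 1))).encard := by
  have hst := isModularStep_rootsB hN
  refine hst.encard_lines (isPosFamily_rootsB n (N + 1)) (fun p hp => ⟨hp.1, hp.2.1⟩) ?_ ?_
  · intro K H H' hp hp' hl
    exact newFlats_inj hN hp.1 hp.2.1.1 hp.2.1.2 hp'.2.1.1 hp'.2.1.2 hp.2.2 hp'.2.2 hl.2
  · rintro ⟨p, q, t⟩ hK ⟨m, h, s⟩ hH hHT
    by_cases hq : h = q
    · subst hq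
      have hm : m.val = N := by
        have h1 : m.val < N + 1 := hH.1
        have h2 : ¬ m.val < N := fun h => hHT ⟨h, hH.2⟩
        omega
      have hpN : p.val < N := hK.1
      have hhp : h.val ≤ p.val := rootsB_le hK
      have hs : s ≠ 0 := by
        rcases hH.2 with ⟨-, hs⟩ | ⟨h1, -⟩
        · exact hs
        · have h1' : h = m := h1
          rw [h1'] at hhp
          omega
      rcases hK.2 with ⟨hlt, ht⟩ | ⟨heq, ht⟩
      · have ht' : t ≠ 0 := ht
        have hlt' : h < p := hlt
        -- Eliminating `x_q` between `x_m + s x_q` and `x_p + t x_q` leaves `x_m - s t x_p`.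
        have hH' : ((m, p, -(s * t)) : RootIndex n) ∈ rootsB n (N + 1) :=
          ⟨hH.1, Or.inl ⟨show p.val < m.val by omega, by simp [hs, ht']⟩⟩
        refine ⟨(m, p, -(s * t)), ⟨hK, ⟨hH', fun h => ?_⟩, ?_⟩, hH', -(s * t), 1,
          LinearMap.ext fun x => ?_⟩
        · have : m.val < N := h.1
          omega
        · exact hlt'.ne'
        · have htt : (t : ℝ) * t = 1 := by
            rcases sign_cases t with e | e | e
            · exact absurd e ht'
            · simp [e]
            · simp [e]
          simp only [root_apply, LinearMap.add_apply, LinearMap.smul_apply, smul_eq_mul,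
            SignType.coe_neg, SignType.coe_mul]
          linear_combination (s : ℝ) * x h * htt
      · have ht' : t = 0 := ht
        have heq' : h = p := heq
        subst ht' heq'
        -- Here `K = x_p`, and subtracting `s K` from `x_m + s x_p` leaves the coordinate functional
        -- `x_m`.
        have hH' : ((m, m, 0) : RootIndex n) ∈ rootsB n (N + 1) := ⟨hH.1, Or.inr ⟨rfl, rfl⟩⟩
        refine ⟨(m, m, 0), ⟨hK, ⟨hH', fun h => ?_⟩, ?_⟩, hH', -s, 1,
          LinearMap.ext fun x => ?_⟩
        · have : m.val < N := h.1
          omega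
        · intro (e : m = h)
          rw [e] at hm
          omega
        · simp only [root_apply, LinearMap.add_apply, LinearMap.smul_apply, smul_eq_mul,
            SignType.coe_zero]
          ring
    · exact ⟨(m, h, s), ⟨hK, ⟨hH, hHT⟩, hq⟩, right_mem_line hH⟩

theorem encard_lines_rootsA_succ (hN : N < n) :
    (lines root (rootsA n (N + 1))).encard = (lines root (rootsA n N)).encard +
      (newFlats (rootsA n N) (rootsA n (N + 1))).encard := by
  have hst := isModularStep_rootsA hN
  have hmem : ∀ k ∈ rootsA n (N + 1), k ∉ rootsA n N → k ∉ rootsB n N :=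
    fun k hk hk' hkB => hk' ⟨hkB.1, hk.2⟩
  refine hst.encard_lines ((isPosFamily_rootsB n (N + 1)).mono (rootsA_subset_rootsB _ _))
    (fun p hp => ⟨hp.1, hp.2.1⟩) ?_ ?_
  · intro K H H' hp hp' hl
    exact newFlats_inj hN (rootsA_subset_rootsB _ _ hp.1) (rootsA_subset_rootsB _ _ hp.2.1.1)
      (hmem _ hp.2.1.1 hp.2.1.2) (rootsA_subset_rootsB _ _ hp'.2.1.1)
      (hmem _ hp'.2.1.1 hp'.2.1.2) hp.2.2 hp'.2.2 hl.2
  · rintro ⟨p, q, t⟩ hK ⟨m, h, s⟩ hH hHT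
    by_cases hq : h = q
    · subst hq
      have hm : m.val = N := by
        have h1 : m.val < N + 1 := hH.1
        have h2 : ¬ m.val < N := fun h => hHT ⟨h, hH.2⟩
        omega
      have hpN : p.val < N := hK.1
      obtain ⟨-, hlt, ht⟩ := id hK
      obtain ⟨-, hlt', hs⟩ := id hH
      simp only at hlt ht hlt' hs
      subst ht hs
      have hH' : ((m, p, -1) : RootIndex n) ∈ rootsA n (N + 1) :=
        ⟨hH.1, show p.val < m.val by omega, rfl⟩
      refine ⟨(m, p, -1), ⟨hK, ⟨hH', fun h => ?_⟩, hlt.ne'⟩, hH', -1, 1,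
        LinearMap.ext fun x => ?_⟩
      · have : m.val < N := h.1
        omega
      · simp only [root_apply, LinearMap.add_apply, LinearMap.smul_apply, smul_eq_mul,
          SignType.coe_neg, SignType.coe_one]
        ring
    · exact ⟨(m, h, s), ⟨hK, ⟨hH, hHT⟩, hq⟩, right_mem_line hH⟩

theorem card_filter_lt_ne (hN : N ≤ n) (q : Fin n) (hq : q.val < N) :
    (Finset.univ.filter fun i : Fin n => i.val < N ∧ i ≠ q).card = N - 1 := by
  have h1 : (Finset.univ.filter fun i : Fin n => i.val < N).card = N := by
    rw [Fin.card_filter_val_lt]; exact min_eq_right hN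
  have h2 : (Finset.univ.filter fun i : Fin n => i.val < N ∧ i ≠ q) =
      (Finset.univ.filter fun i : Fin n => i.val < N).erase q := by
    ext i; simp [and_comm]
  rw [h2, Finset.card_erase_of_mem (by simpa using hq), h1]

/-- Counting `newFlats` fibrewise. -/
theorem ncard_newFlats {R R' : Set (RootIndex n)} {c : ℕ}
    (h : ∀ K ∈ R, {H | (H ∈ R' ∧ H ∉ R) ∧ H.2.1 ≠ K.2.1}.ncard = c) :
    (newFlats R R').ncard = R.ncard * c := by
  have e : newFlats R R' =
      ((R.toFinset.sigma fun K => {H | (H ∈ R' ∧ H ∉ R) ∧ H.2.1 ≠ K.2.1}.toFinset).map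
        (Equiv.sigmaEquivProd _ _).toEmbedding : Finset (RootIndex n × RootIndex n)) := by
    ext ⟨K, H⟩
    simp [newFlats]
  rw [e, Set.ncard_coe_finset, Finset.card_map, Finset.card_sigma, Set.ncard_eq_toFinset_card' R,
    ← smul_eq_mul, ← Finset.sum_const]
  refine Finset.sum_congr rfl fun K hK => ?_
  rw [← h K (by simpa using hK), Set.ncard_eq_toFinset_card']

theorem ncard_newA (hN : N < n) (q : Fin n) (hq : q.val < N) :
    {H | (H ∈ rootsA n (N + 1) ∧ H ∉ rootsA n N) ∧ H.2.1 ≠ q}.ncard = N - 1 := by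
  have e : {H | (H ∈ rootsA n (N + 1) ∧ H ∉ rootsA n N) ∧ H.2.1 ≠ q} =
      (((Finset.univ.filter fun i : Fin n => i.val < N ∧ i ≠ q).image fun i =>
        ((⟨N, hN⟩, i, -1) : RootIndex n) : Finset (RootIndex n)) : Set (RootIndex n)) := by
    ext ⟨m, i, s⟩
    simp only [rootsA, Set.mem_ofPred_eq, Finset.coe_image, Finset.coe_filter, Finset.mem_univ,
      true_and, Set.mem_image, Prod.mk.injEq]
    constructor
    · rintro ⟨⟨⟨h1, h2, h3⟩, h4⟩, h5⟩
      have hm : m.val = N := by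
        have : ¬ m.val < N := fun h => h4 ⟨h, h2, h3⟩
        omega
      exact ⟨i, ⟨by rw [← hm]; exact h2, h5⟩, Fin.ext hm.symm, rfl, h3.symm⟩
    · rintro ⟨i', ⟨h1, h2⟩, rfl, rfl, rfl⟩
      exact ⟨⟨⟨by simp, h1, rfl⟩, by simp⟩, h2⟩
  rw [e, Set.ncard_coe_finset, Finset.card_image_of_injective, card_filter_lt_ne hN.le q hq]
  intro i i' h
  simpa using h

/-- There are `N - 1` admissible lower coordinates with two signs each, and the coordinate
functional `x_N`. The truncated subtraction is harmless since `q < N`. -/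
theorem ncard_newB (hN : N < n) (q : Fin n) (hq : q.val < N) :
    {H | (H ∈ rootsB n (N + 1) ∧ H ∉ rootsB n N) ∧ H.2.1 ≠ q}.ncard = 2 * N - 1 := by
  have e : {H | (H ∈ rootsB n (N + 1) ∧ H ∉ rootsB n N) ∧ H.2.1 ≠ q} =
      ((insert ((⟨N, hN⟩, ⟨N, hN⟩, 0) : RootIndex n)
        (((Finset.univ.filter fun i : Fin n => i.val < N ∧ i ≠ q) ×ˢ
          ({1, -1} : Finset SignType)).image fun p =>
        ((⟨N, hN⟩, p.1, p.2) : RootIndex n)) : Finset (RootIndex n)) : Set (RootIndex n)) := by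
    ext ⟨m, i, s⟩
    simp only [rootsB, Set.mem_ofPred_eq, Finset.coe_insert, Finset.coe_image, Set.mem_insert_iff,
      Set.mem_image, Prod.mk.injEq, Finset.mem_coe, Finset.mem_product, Finset.mem_filter,
      Finset.mem_univ, true_and, Finset.mem_insert, Finset.mem_singleton]
    constructor
    · rintro ⟨⟨⟨h1, h2⟩, h4⟩, h5⟩
      have hm : m.val = N := by
        have : ¬ m.val < N := fun h => h4 ⟨h, h2⟩
        omega
      have hm' : m = ⟨N, hN⟩ := Fin.ext hm
      rcases h2 with ⟨h2, h3⟩ | ⟨h2, h3⟩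
      · exact Or.inr ⟨(i, s), ⟨⟨by rw [← hm]; exact h2, h5⟩,
          (sign_cases s).resolve_left h3⟩, hm'.symm, rfl, rfl⟩
      · exact Or.inl ⟨hm', h2.trans hm', h3⟩
    · rintro (⟨rfl, rfl, rfl⟩ | ⟨⟨i', s'⟩, ⟨⟨h1, h2⟩, h3⟩, rfl, rfl, rfl⟩)
      · exact ⟨⟨⟨by simp, Or.inr ⟨rfl, rfl⟩⟩, by simp⟩, fun h => by rw [← h] at hq; simp at hq⟩
      · refine ⟨⟨⟨by simp, Or.inl ⟨h1, ?_⟩⟩, by simp⟩, h2⟩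
        rcases h3 with h3 | h3 <;> simp only at h3 <;> subst h3 <;> simp
  have hni : ((⟨N, hN⟩, ⟨N, hN⟩, 0) : RootIndex n) ∉
      ((Finset.univ.filter fun i : Fin n => i.val < N ∧ i ≠ q) ×ˢ
          ({1, -1} : Finset SignType)).image fun p => ((⟨N, hN⟩, p.1, p.2) : RootIndex n) := by
    simp
  rw [e, Set.ncard_coe_finset, Finset.card_insert_of_notMem hni, Finset.card_image_of_injective,
    Finset.card_product, card_filter_lt_ne hN.le q hq]
  · have : ({1, -1} : Finset SignType).card = 2 := by decide
    rw [this]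
    omega
  · rintro ⟨i, s⟩ ⟨i', s'⟩ h
    simpa using h

theorem ncard_rootsA (hN : N ≤ n) : 2 * (rootsA n N).ncard = N * (N - 1) := by
  induction N with
  | zero => simp [rootsA_zero]
  | succ N ih =>
    have hN' : N < n := hN
    have e : rootsA n (N + 1) = rootsA n N ∪
        (((Finset.univ.filter fun i : Fin n => i.val < N).image fun i =>
          ((⟨N, hN'⟩, i, -1) : RootIndex n) : Finset (RootIndex n)) : Set (RootIndex n)) := by
      ext ⟨m, i, s⟩
      simp only [rootsA, Set.mem_ofPred_eq, Set.mem_union, Finset.coe_image, Finset.coe_filter,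
        Finset.mem_univ, true_and, Set.mem_image, Prod.mk.injEq]
      constructor
      · rintro ⟨h1, h2, h3⟩
        by_cases hm : m.val < N
        · exact Or.inl ⟨hm, h2, h3⟩
        · have hm' : m.val = N := by omega
          exact Or.inr ⟨i, by rw [← hm']; exact h2, Fin.ext hm'.symm, rfl, h3.symm⟩
      · rintro (⟨h1, h2, h3⟩ | ⟨i', h1, rfl, rfl, rfl⟩)
        · exact ⟨by omega, h2, h3⟩
        · exact ⟨by simp, h1, rfl⟩
    rw [e, Set.ncard_union_eq ?_ (Set.toFinite _) (Set.toFinite _), Set.ncard_coe_finset,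
      Finset.card_image_of_injective, Fin.card_filter_val_lt, min_eq_right hN'.le, mul_add,
      ih hN'.le]
    · cases N with
      | zero => rfl
      | succ N => simp; ring
    · intro i i' h
      simpa using h
    · rw [Set.disjoint_left]
      rintro ⟨m, i, s⟩ h1 h2
      simp only [Finset.coe_image, Set.mem_image, Prod.mk.injEq] at h2
      obtain ⟨i', -, rfl, -, -⟩ := h2
      have : N < N := h1.1
      omega

theorem ncard_rootsB (hN : N ≤ n) : (rootsB n N).ncard = N ^ 2 := by
  induction N with
  | zero => simp [rootsB_zero]
  | succ N ih =>
    have hN' : N < n := hN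
    have e : rootsB n (N + 1) = rootsB n N ∪
        ((insert ((⟨N, hN'⟩, ⟨N, hN'⟩, 0) : RootIndex n)
        (((Finset.univ.filter fun i : Fin n => i.val < N) ×ˢ
          ({1, -1} : Finset SignType)).image fun p =>
        ((⟨N, hN'⟩, p.1, p.2) : RootIndex n)) : Finset (RootIndex n)) : Set (RootIndex n)) := by
      ext ⟨m, i, s⟩
      simp only [rootsB, Set.mem_ofPred_eq, Set.mem_union, Finset.coe_insert, Finset.coe_image,
        Set.mem_insert_iff, Set.mem_image, Prod.mk.injEq, Finset.mem_coe, Finset.mem_product,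
        Finset.mem_filter, Finset.mem_univ, true_and, Finset.mem_insert, Finset.mem_singleton]
      constructor
      · rintro ⟨h1, h2⟩
        by_cases hm : m.val < N
        · exact Or.inl ⟨hm, h2⟩
        · have hm' : m.val = N := by omega
          have hm'' : m = ⟨N, hN'⟩ := Fin.ext hm'
          rcases h2 with ⟨h2, h3⟩ | ⟨h2, h3⟩
          · exact Or.inr (Or.inr ⟨(i, s), ⟨by rw [← hm']; exact h2,
              (sign_cases s).resolve_left h3⟩, hm''.symm, rfl, rfl⟩)
          · exact Or.inr (Or.inl ⟨hm'', h2.trans hm'', h3⟩)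
      · rintro (⟨h1, h2⟩ | ⟨rfl, rfl, rfl⟩ | ⟨⟨i', s'⟩, ⟨h1, h3⟩, rfl, rfl, rfl⟩)
        · exact ⟨by omega, h2⟩
        · exact ⟨by simp, Or.inr ⟨rfl, rfl⟩⟩
        · refine ⟨by simp, Or.inl ⟨h1, ?_⟩⟩
          rcases h3 with h3 | h3 <;> simp only at h3 <;> subst h3 <;> simp
    have hni : ((⟨N, hN'⟩, ⟨N, hN'⟩, 0) : RootIndex n) ∉
        ((Finset.univ.filter fun i : Fin n => i.val < N) ×ˢ
          ({1, -1} : Finset SignType)).image fun p => ((⟨N, hN'⟩, p.1, p.2) : RootIndex n) := by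
      simp
    rw [e, Set.ncard_union_eq ?_ (Set.toFinite _) (Set.toFinite _), Set.ncard_coe_finset,
      Finset.card_insert_of_notMem hni, Finset.card_image_of_injective, Finset.card_product,
      Fin.card_filter_val_lt, min_eq_right hN'.le, ih hN'.le]
    · have : ({1, -1} : Finset SignType).card = 2 := by decide
      rw [this]
      ring
    · rintro ⟨i, s⟩ ⟨i', s'⟩ h
      simpa using h
    · rw [Set.disjoint_left]
      rintro ⟨m, i, s⟩ h1 h2
      have hm : m.val < N := h1.1
      simp only [Finset.coe_insert, Finset.coe_image, Set.mem_insert_iff, Set.mem_image,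
        Prod.mk.injEq] at h2
      rcases h2 with ⟨rfl, -⟩ | ⟨p, -, rfl, -, -⟩
      · simp at hm
      · simp at hm

theorem lines_empty {V ι : Type*} [AddCommGroup V] [Module ℝ V] (f : ι → Module.Dual ℝ V) :
    lines f ∅ = ∅ := by
  ext L; simp [lines]

theorem exists_encard_lines_rootsA (hN : N ≤ n) : ∃ D : ℕ, (lines root (rootsA n N)).encard = D ∧
    (D : ℚ) = 1 / 24 * N * (N - 1) * (N - 2) * (3 * N - 5) := by
  induction N with
  | zero => exact ⟨0, by simp [rootsA_zero, lines_empty], by simp⟩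
  | succ N ih =>
    have hN' : N < n := hN
    obtain ⟨D, hD, hD'⟩ := ih hN'.le
    have hnew := ncard_newFlats (R := rootsA n N) (R' := rootsA n (N + 1)) (c := N - 1)
      fun K hK => ncard_newA hN' K.2.1 (lt_of_le_of_lt hK.2.1.le hK.1)
    refine ⟨D + (rootsA n N).ncard * (N - 1), ?_, ?_⟩
    · rw [encard_lines_rootsA_succ hN', hD, ← (Set.toFinite _).cast_ncard_eq, hnew]
      push_cast
      rfl
    · have hc := ncard_rootsA hN'.le
      -- The case `N = 0` is separated because `N - 1` is truncated there.
      cases N with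
      | zero => simp [rootsA_zero] at hD' ⊢; rw [hD']
      | succ N =>
        have hc' : (2 : ℚ) * ((rootsA n (N + 1)).ncard : ℚ) = (N + 1) * N := by
          have : 2 * (rootsA n (N + 1)).ncard = (N + 1) * N := by rw [hc]; simp
          exact_mod_cast this
        rw [Nat.add_sub_cancel]
        push_cast at hD' ⊢
        rw [hD']
        linear_combination (N : ℚ) / 2 * hc'

theorem exists_encard_lines_rootsB (hN : N ≤ n) : ∃ D : ℕ, (lines root (rootsB n N)).encard = D ∧
    (D : ℚ) = 1 / 6 * N * (N - 1) * (3 * N ^ 2 - 5 * N + 1) := by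
  induction N with
  | zero => exact ⟨0, by simp [rootsB_zero, lines_empty], by simp⟩
  | succ N ih =>
    have hN' : N < n := hN
    obtain ⟨D, hD, hD'⟩ := ih hN'.le
    have hnew := ncard_newFlats (R := rootsB n N) (R' := rootsB n (N + 1)) (c := 2 * N - 1)
      fun K hK => ncard_newB hN' K.2.1 (lt_of_le_of_lt (rootsB_le hK) hK.1)
    refine ⟨D + (rootsB n N).ncard * (2 * N - 1), ?_, ?_⟩
    · rw [encard_lines_rootsB_succ hN', hD, ← (Set.toFinite _).cast_ncard_eq, hnew]
      push_cast
      rfl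
    · rw [ncard_rootsB hN'.le]
      cases N with
      | zero => simp at hD' ⊢; rw [hD']
      | succ N =>
        have : 2 * (N + 1) - 1 = 2 * N + 1 := by omega
        rw [this]
        push_cast at hD' ⊢
        rw [hD']
        ring

end Counting

end ReducedWords

/-! ### The symmetric and hyperoctahedral groups as root families. -/

namespace ReducedWords

open ListGallery

open scoped Classical

section AdjacentSwap

variable {n : ℕ} {a b : Fin n}

theorem swap_lt_swap (hab : b.val = a.val + 1) {i m : Fin n} (him : i < m)
    (hne : ¬ (i = a ∧ m = b)) : Equiv.swap a b i < Equiv.swap a b m := by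
  simp only [Equiv.swap_apply_def]
  simp only [Fin.ext_iff, Fin.lt_def] at *
  split_ifs <;> omega

theorem root_comp_perm (k : RootIndex n) (σ : Equiv.Perm (Fin n)) (x : Fin n → ℝ) :
    root k (x ∘ σ) = root (σ k.1, σ k.2.1, k.2.2) x := rfl

theorem comp_swap_eq (hab : b.val = a.val + 1) (x : Fin n → ℝ) :
    x ∘ Equiv.swap a b = x + root (b, a, -1) x • (Pi.single a 1 - Pi.single b 1) := by
  have hne : a ≠ b := fun h => by rw [h] at hab; omega
  ext i
  simp only [Function.comp_apply, Pi.add_apply, Pi.smul_apply, Pi.sub_apply, root_apply,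
    Equiv.swap_apply_def, smul_eq_mul]
  split_ifs with h1 h2
  · subst h1; simp [hne]
  · subst h2; simp [hne.symm]
  · simp [h1, h2]

theorem root_single_sub_single (hab : b.val = a.val + 1) :
    root (b, a, -1) (Pi.single a 1 - Pi.single b 1) = -2 := by
  have hne : a ≠ b := fun h => by rw [h] at hab; omega
  simp [root_apply, hne, hne.symm]
  norm_num

theorem strictMono_of_adjacent {x : Fin n → ℝ}
    (hx : ∀ a b : Fin n, b.val = a.val + 1 → x a < x b) : StrictMono x := by
  have key : ∀ d : ℕ, ∀ i m : Fin n, m.val = i.val + d + 1 → x i < x m := by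
    intro d
    induction d with
    | zero => exact fun i m h => hx i m h
    | succ d ih =>
      intro i m h
      exact (ih i ⟨i.val + d + 1, by omega⟩ rfl).trans (hx _ _ (by simp only; omega))
  intro i m him
  exact key (m.val - i.val - 1) i m (by have := Fin.lt_def.1 him; omega)

theorem perm_eq_one_of_strictMono {σ : Equiv.Perm (Fin n)} (h : StrictMono σ) : σ = 1 :=
  Equiv.ext fun _ => le_antisymm h.apply_le h.le_apply

theorem basePoint_lt_iff {i j : Fin n} : basePoint n i < basePoint n j ↔ i < j := by
  simp [basePoint]

theorem coordKer_sub (i m : Fin n) : coordKer 1 i (-1) m = LinearMap.ker (root (m, i, -1)) := by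
  ext x
  simp only [coordKer, LinearMap.mem_ker, root_apply, LinearMap.add_apply, LinearMap.smul_apply,
    LinearMap.proj_apply, smul_eq_mul, SignType.coe_neg_one]
  constructor <;> intro h <;> linarith

end AdjacentSwap

section TypeA

/-- The symmetric group permuting the coordinates of `ℝ^n`. -/
def permRep (n : ℕ) : Equiv.Perm (Fin n) →* Module.End ℝ (Fin n → ℝ) where
  -- Precomposition reverses products; the inverse restores a homomorphism.
  toFun σ := LinearMap.funLeft ℝ ℝ (σ⁻¹ : Equiv.Perm (Fin n))
  map_one' := rfl
  map_mul' σ τ := by ext; simp [LinearMap.funLeft]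

theorem permRep_apply {n : ℕ} (σ : Equiv.Perm (Fin n)) (x : Fin n → ℝ) :
    permRep n σ x = x ∘ (σ⁻¹ : Equiv.Perm (Fin n)) := rfl

theorem permRep_genA {n : ℕ} (j : Fin (n - 1)) (x : Fin n → ℝ) :
    permRep n (genA n j) x = x ∘ Equiv.swap ⟨j, by omega⟩ ⟨j + 1, by omega⟩ := by
  rw [permRep_apply, genA, Equiv.swap_inv]

/-- The simple roots `x_{j+1} - x_j` of type `A`. -/
def simpleA (n : ℕ) (j : Fin (n - 1)) : RootIndex n := (⟨j + 1, by omega⟩, ⟨j, by omega⟩, -1)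

theorem isRootFamily_rootsA (n : ℕ) :
    IsRootFamily (genA n) (permRep n) root (rootsA n n) (simpleA n) (basePoint n) where
  posFamily := (isPosFamily_rootsB n n).mono (rootsA_subset_rootsB n n)
  finite := Set.toFinite _
  simple_mem j := ⟨by simp [simpleA]; omega, by simp [simpleA, Fin.lt_def], rfl⟩
  simple_inj i j h := by
    simp only [simpleA, Prod.mk.injEq, Fin.mk.injEq] at h
    exact Fin.ext h.2.1
  sq j := Equiv.swap_mul_self _ _
  refl j := by
    refine ⟨_, root_single_sub_single (a := ⟨j, by omega⟩) (b := ⟨j + 1, by omega⟩) rfl, fun x => ?_⟩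
    rw [permRep_genA]
    exact comp_swap_eq rfl x
  perm j k hk hne := by
    obtain ⟨m, i, s⟩ := k
    obtain ⟨-, h2, h3⟩ := hk
    simp only at h2 h3
    subst h3
    refine ⟨(genA n j m, genA n j i, -1), ⟨Fin.isLt _, ?_, rfl⟩, LinearMap.ext fun x => ?_⟩
    · exact swap_lt_swap rfl h2 fun h => hne (by rw [h.1, h.2]; rfl)
    · rw [LinearMap.comp_apply, permRep_genA]
      rfl
  dominant x hx k hk := by
    obtain ⟨m, i, s⟩ := k
    obtain ⟨-, h2, h3⟩ := hk
    simp only at h2 h3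
    subst h3
    have hm : StrictMono x := strictMono_of_adjacent fun a b hab => by
      have := hx ⟨a, by omega⟩
      have hb : (⟨a + 1, by omega⟩ : Fin n) = b := Fin.ext hab.symm
      simpa [simpleA, root_apply, hb] using this
    simpa [root_apply] using hm h2
  -- The base point is strictly increasing, so positivity of all roots says that `w⁻¹` is an
  -- increasing permutation.
  faithful w _ hw := by
    have : StrictMono (w⁻¹ : Equiv.Perm (Fin n)) := fun i m him => by
      have := hw (m, i, -1) ⟨Fin.isLt _, him, rfl⟩
      rw [permRep_apply, root_comp_perm] at this
      rw [← basePoint_lt_iff]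
      simpa [root_apply] using this
    exact inv_eq_one.1 (perm_eq_one_of_strictMono this)

/-- The roots of type A vanish on the diagonal line and descend to the quotient; their linear
relations are the same there. -/
theorem exists_functionals_arrangementA (n : ℕ) :
    ∃ g : RootIndex n → Module.Dual ℝ ((Fin n → ℝ) ⧸ Submodule.span ℝ {(fun _ => 1 : Fin n → ℝ)}),
      (∀ k ∈ rootsA n n, g k ∘ₗ Submodule.mkQ _ = root k) ∧
        arrangementA n = (fun k => LinearMap.ker (g k)) '' rootsA n n := by
  set U := Submodule.span ℝ {(fun _ => 1 : Fin n → ℝ)} with hU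
  have hle : ∀ k ∈ rootsA n n, U ≤ LinearMap.ker (root k) := by
    rintro ⟨m, i, s⟩ ⟨-, -, h⟩
    simp only at h
    subst h
    rw [hU, Submodule.span_singleton_le_iff_mem]
    simp [root_apply]
  refine ⟨fun k => if h : k ∈ rootsA n n then U.liftQ (root k) (hle k h) else 0, fun k hk => ?_, ?_⟩
  · simp only [dif_pos hk]
    exact U.liftQ_mkQ _ _
  · ext K
    constructor
    · rintro ⟨H, ⟨i, m, him, rfl⟩, -, rfl⟩
      have hk : ((m, i, -1) : RootIndex n) ∈ rootsA n n := ⟨Fin.isLt _, him, rfl⟩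
      refine ⟨_, hk, ?_⟩
      simp only [dif_pos hk, Submodule.ker_liftQ, coordKer_sub]
      rfl
    · rintro ⟨⟨m, i, s⟩, hk, rfl⟩
      have hk' := hk
      obtain ⟨-, him, h⟩ := hk'
      simp only at him h
      subst h
      refine ⟨_, ⟨i, m, him, rfl⟩, ?_, ?_⟩
      · rw [coordKer_sub]
        exact hle _ hk
      · simp only [dif_pos hk, Submodule.ker_liftQ, coordKer_sub]
        rfl

theorem encard_flats_arrangementA (n : ℕ) :
    (flats (arrangementA n) 2).encard = (lines root (rootsA n n)).encard := by
  obtain ⟨g, hg, hA⟩ := exists_functionals_arrangementA n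
  rw [flats_two_encard (((isRootFamily_rootsA n).posFamily).quotient hg) hA, lines_quotient hg]

theorem exists_diameter_typeA (n : ℕ) :
    ∃ w₀, (∀ w, IsLongest (genA n) w ↔ w = w₀) ∧
      ∃ D : ℕ, (wordGraph (genA n) w₀).ediam = D ∧ (flats (arrangementA n) 2).encard = D ∧
        (D : ℚ) = 1 / 24 * n * (n - 1) * (n - 2) * (3 * n - 5) := by
  obtain ⟨w₀, h, hd⟩ := (isRootFamily_rootsA n).exists_longest_ediam (hasModularChain_rootsA le_rfl)
  obtain ⟨D, hD, hq⟩ := exists_encard_lines_rootsA (le_refl n)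
  exact ⟨w₀, h, D, hd.trans hD, (encard_flats_arrangementA n).trans hD, hq⟩

end TypeA

section TypeB

/-- The signed permutation group acting on `ℝ^n`. -/
def signedRep (n : ℕ) : ((Fin n → ℝ) ≃ₗ[ℝ] (Fin n → ℝ)) →* Module.End ℝ (Fin n → ℝ) :=
  LinearEquiv.automorphismGroup.toLinearMapMonoidHom

theorem signedRep_apply {n : ℕ} (w : (Fin n → ℝ) ≃ₗ[ℝ] (Fin n → ℝ)) (x : Fin n → ℝ) :
    signedRep n w x = w x := rfl

theorem genB_zero_apply {n : ℕ} {j : Fin n} (hj : j.val = 0) (x : Fin n → ℝ) :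
    genB n j x = fun i => if i = j then -x i else x i := by
  ext i
  rw [genB, if_pos hj, LinearEquiv.piCongrRight_apply]
  split_ifs <;> rfl

theorem genB_pos_apply {n : ℕ} {j : Fin n} (hj : j.val ≠ 0) (x : Fin n → ℝ) :
    genB n j x = x ∘ Equiv.swap ⟨j - 1, by omega⟩ j := by
  rw [genB, if_neg hj]
  rfl

/-- The simple roots of type `B`: `x_0` and `x_j - x_{j-1}`. -/
def simpleB (n : ℕ) (j : Fin n) : RootIndex n :=
  if j.val = 0 then (j, j, 0) else (j, ⟨j - 1, by omega⟩, -1)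

theorem simpleB_zero {n : ℕ} {j : Fin n} (hj : j.val = 0) : simpleB n j = (j, j, 0) := if_pos hj

theorem simpleB_pos {n : ℕ} {j : Fin n} (hj : j.val ≠ 0) :
    simpleB n j = (j, ⟨j - 1, by omega⟩, -1) := if_neg hj

/-- The generated group is only known as a subgroup of linear automorphisms; this explicit form of
its elements is what faithfulness needs. -/
theorem exists_signed_perm {n : ℕ} {w : (Fin n → ℝ) ≃ₗ[ℝ] (Fin n → ℝ)}
    (hw : w ∈ Subgroup.closure (Set.range (genB n))) :
    ∃ (ε : Fin n → ℝ) (σ : Equiv.Perm (Fin n)), (∀ i, ε i = 1 ∨ ε i = -1) ∧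
      ∀ x i, w x i = ε i * x (σ i) := by
  induction hw using Subgroup.closure_induction with
  | mem w hw =>
    obtain ⟨j, rfl⟩ := hw
    by_cases hj : j.val = 0
    · refine ⟨fun i => if i = j then -1 else 1, 1, fun i => ?_, fun x i => ?_⟩
      · simp only; split_ifs <;> simp
      · rw [genB_zero_apply hj]; simp only; split_ifs <;> simp
    · exact ⟨1, Equiv.swap ⟨j - 1, by omega⟩ j, fun i => by simp, fun x i => by
        rw [genB_pos_apply hj]; simp⟩
  | one => exact ⟨1, 1, fun i => by simp, fun x i => by simp⟩
  | mul w w' _ _ ih ih' =>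
    obtain ⟨ε, σ, hε, h⟩ := ih
    obtain ⟨ε', σ', hε', h'⟩ := ih'
    refine ⟨fun i => ε i * ε' (σ i), σ' * σ, fun i => ?_, fun x i => ?_⟩
    · rcases hε i with e | e <;> rcases hε' (σ i) with e' | e' <;> simp [e, e']
    · rw [LinearEquiv.mul_apply, h, h', Equiv.Perm.mul_apply, mul_assoc]
  | inv w _ ih =>
    obtain ⟨ε, σ, hε, h⟩ := ih
    refine ⟨fun i => ε (σ⁻¹ i), σ⁻¹, fun i => hε _, fun x i => ?_⟩
    have := h (w⁻¹ x) (σ⁻¹ i)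
    rw [← LinearEquiv.mul_apply, mul_inv_cancel, ← Equiv.Perm.mul_apply, mul_inv_cancel] at this
    change x (σ⁻¹ i) = _ * (w⁻¹ x) i at this
    rw [this, ← mul_assoc]
    rcases hε (σ⁻¹ i) with e | e <;> simp only [e] <;> simp

theorem exists_perm_genB_zero {n : ℕ} {j : Fin n} (hj : j.val = 0) {k : RootIndex n}
    (hk : k ∈ rootsB n n) (hne : k ≠ simpleB n j) :
    ∃ k' ∈ rootsB n n, ∀ x, root k (genB n j x) = root k' x := by
  obtain ⟨m, i, s⟩ := k
  rw [simpleB_zero hj] at hne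
  have hmj : m ≠ j := by
    rintro rfl
    rcases hk.2 with ⟨h, -⟩ | ⟨h, h'⟩
    · have := Fin.lt_def.1 h
      simp only at this
      omega
    · simp only at h h'
      subst h h'
      exact hne rfl
  by_cases hij : i = j
  · subst hij
    have h := hk.2.resolve_right fun h => hmj h.1.symm
    refine ⟨(m, i, -s), ⟨hk.1, Or.inl ⟨h.1, by simpa using h.2⟩⟩, fun x => ?_⟩
    simp [root_apply, genB_zero_apply hj, hmj]
  · refine ⟨(m, i, s), hk, fun x => ?_⟩
    simp [root_apply, genB_zero_apply hj, hmj, hij]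

theorem exists_perm_genB_pos {n : ℕ} {j : Fin n} (hj : j.val ≠ 0) {k : RootIndex n}
    (hk : k ∈ rootsB n n) (hne : k ≠ simpleB n j) :
    ∃ k' ∈ rootsB n n, ∀ x, root k (genB n j x) = root k' x := by
  obtain ⟨m, i, s⟩ := k
  rw [simpleB_pos hj] at hne
  have hval : j.val = (⟨j - 1, by omega⟩ : Fin n).val + 1 := by simp only; omega
  -- The pair exchanged by the swap is the one whose order is not preserved; with the simple root
  -- excluded, only `x_j + x_{j-1}` remains, and it is fixed.
  by_cases h : i = ⟨j - 1, by omega⟩ ∧ m = j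
  · obtain ⟨h1, rfl⟩ := h
    have hlt : i < m := by rw [h1, Fin.lt_def]; omega
    have hs := (hk.2.resolve_right fun h => hlt.ne h.1).2
    have hs1 : s = 1 := by
      rcases sign_cases s with e | e | e
      · exact absurd e hs
      · exact e
      · rw [h1, e] at hne
        exact absurd rfl hne
    refine ⟨(m, i, s), hk, fun x => ?_⟩
    rw [genB_pos_apply hj, root_comp_perm, root_apply, root_apply, hs1, ← h1]
    simp [add_comm]
  · refine ⟨_, ?_, fun x => by rw [genB_pos_apply hj, root_comp_perm]⟩
    refine ⟨Fin.isLt _, ?_⟩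
    rcases hk.2 with ⟨h1, h2⟩ | ⟨h1, h2⟩
    · exact Or.inl ⟨swap_lt_swap hval h1 h, h2⟩
    · exact Or.inr ⟨congrArg (Equiv.swap _ j) h1, h2⟩

theorem isRootFamily_rootsB (n : ℕ) :
    IsRootFamily (genB n) (signedRep n) root (rootsB n n) (simpleB n) (basePoint n) where
  posFamily := isPosFamily_rootsB n n
  finite := Set.toFinite _
  simple_mem j := by
    by_cases hj : j.val = 0
    · rw [simpleB_zero hj]
      exact ⟨Fin.isLt _, Or.inr ⟨rfl, rfl⟩⟩
    · rw [simpleB_pos hj]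
      exact ⟨Fin.isLt _, Or.inl ⟨by rw [Fin.lt_def]; simp only; omega, by simp⟩⟩
  simple_inj i j h := by
    have h1 : ∀ j, (simpleB n j).1 = j := fun j => by unfold simpleB; split_ifs <;> rfl
    rw [← h1 i, h, h1]
  sq j := by
    ext x i
    rw [LinearEquiv.mul_apply]
    by_cases hj : j.val = 0
    · rw [genB_zero_apply hj, genB_zero_apply hj]
      simp only
      split_ifs <;> simp
    · rw [genB_pos_apply hj, genB_pos_apply hj]
      simp
  refl j := by
    by_cases hj : j.val = 0
    · refine ⟨-2 • Pi.single j 1, ?_, fun x => ?_⟩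
      · simp [simpleB_zero hj, root_apply]
      · ext i
        rw [signedRep_apply, genB_zero_apply hj, simpleB_zero hj]
        simp only [root_apply, Pi.add_apply, Pi.smul_apply]
        split_ifs with h
        · subst h; simp; ring
        · simp [h]
    · have hval : j.val = (⟨j - 1, by omega⟩ : Fin n).val + 1 := by simp only; omega
      rw [simpleB_pos hj]
      refine ⟨_, root_single_sub_single hval, fun x => ?_⟩
      rw [signedRep_apply, genB_pos_apply hj]
      exact comp_swap_eq hval x
  perm j k hk hne := by
    obtain ⟨k', hk', h⟩ : ∃ k' ∈ rootsB n n, ∀ x, root k (genB n j x) = root k' x := by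
      by_cases hj : j.val = 0
      · exact exists_perm_genB_zero hj hk hne
      · exact exists_perm_genB_pos hj hk hne
    exact ⟨k', hk', LinearMap.ext h⟩
  dominant x hx k hk := by
    have hm : StrictMono x := strictMono_of_adjacent fun a b hab => by
      have := hx b
      rw [simpleB_pos (by omega), root_apply] at this
      have ha : (⟨b - 1, by omega⟩ : Fin n) = a := Fin.ext (by simp only; omega)
      simp only [ha] at this
      simpa using this
    have hpos : ∀ i, 0 < x i := fun i => by
      have h0 : 0 < x ⟨0, i.pos⟩ := by
        have := hx ⟨0, i.pos⟩
        rw [simpleB_zero rfl, root_apply] at this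
        simpa using this
      exact h0.trans_le (hm.monotone (Fin.le_def.2 (Nat.zero_le _)))
    obtain ⟨m, i, s⟩ := k
    rw [root_apply]
    rcases hk.2 with ⟨h1, h2⟩ | ⟨h1, h2⟩ <;> simp only at h1 h2 ⊢
    · rcases sign_cases s with e | e | e
      · exact absurd e h2
      · rw [e]
        simpa using add_pos (hpos m) (hpos i)
      · rw [e]
        simpa using hm h1
    · rw [h2]
      simpa using hpos m
  -- Positivity of the coordinate functionals makes all signs `+1`, and positivity of the
  -- differences makes the permutation increasing.
  faithful w hw hpos := by
    obtain ⟨ε, σ, hε, h⟩ := exists_signed_perm hw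
    have hb : ∀ i, 0 < basePoint n i := fun i => by unfold basePoint; positivity
    have hε1 : ∀ i, ε i = 1 := fun i => by
      have := hpos (i, i, 0) ⟨Fin.isLt _, Or.inr ⟨rfl, rfl⟩⟩
      rw [root_apply, signedRep_apply, h] at this
      rcases hε i with e | e
      · exact e
      · have hb' := hb (σ i)
        simp [e] at this
        linarith
    have hσ : StrictMono σ := fun i m him => by
      have := hpos (m, i, -1) ⟨Fin.isLt _, Or.inl ⟨him, by simp⟩⟩
      rw [root_apply, signedRep_apply, h, h, hε1, hε1] at this
      rw [← basePoint_lt_iff]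
      simpa using this
    ext x i
    rw [h, hε1, perm_eq_one_of_strictMono hσ]
    simp

theorem arrangementB_eq (n : ℕ) :
    arrangementB n = (fun k => LinearMap.ker (root k)) '' rootsB n n := by
  have hadd : ∀ i m : Fin n, coordKer 1 i 1 m = LinearMap.ker (root (m, i, 1)) := by
    intro i m
    ext x
    simp only [coordKer, LinearMap.mem_ker, root_apply, LinearMap.add_apply, LinearMap.smul_apply,
      LinearMap.proj_apply, smul_eq_mul, SignType.coe_one]
    constructor <;> intro h <;> linarith
  have hproj : ∀ i : Fin n, LinearMap.ker (LinearMap.proj i : (Fin n → ℝ) →ₗ[ℝ] ℝ) =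
      LinearMap.ker (root (i, i, 0)) := by
    intro i
    ext x
    simp [root_apply]
  ext H
  constructor
  · rintro (⟨i, m, him, rfl | rfl⟩ | ⟨i, rfl⟩)
    · exact ⟨_, ⟨Fin.isLt _, Or.inl ⟨him, by simp⟩⟩, (coordKer_sub i m).symm⟩
    · exact ⟨_, ⟨Fin.isLt _, Or.inl ⟨him, by simp⟩⟩, (hadd i m).symm⟩
    · exact ⟨_, ⟨Fin.isLt _, Or.inr ⟨rfl, rfl⟩⟩, (hproj i).symm⟩
  · rintro ⟨⟨m, i, s⟩, ⟨-, ⟨h1, h2⟩ | ⟨h1, h2⟩⟩, rfl⟩ <;> simp only at h1 h2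
    · rcases sign_cases s with rfl | rfl | rfl
      · exact absurd rfl h2
      · exact Or.inl ⟨i, m, h1, Or.inr (hadd i m).symm⟩
      · exact Or.inl ⟨i, m, h1, Or.inl (coordKer_sub i m).symm⟩
    · subst h1 h2
      exact Or.inr ⟨_, (hproj _).symm⟩

theorem exists_diameter_typeB (n : ℕ) :
    ∃ w₀, (∀ w, IsLongest (genB n) w ↔ w = w₀) ∧
      ∃ D : ℕ, (wordGraph (genB n) w₀).ediam = D ∧ (flats (arrangementB n) 2).encard = D ∧
        (D : ℚ) = 1 / 6 * n * (n - 1) * (3 * n ^ 2 - 5 * n + 1) := by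
  obtain ⟨w₀, h, hd⟩ := (isRootFamily_rootsB n).exists_longest_ediam (hasModularChain_rootsB le_rfl)
  obtain ⟨D, hD, hq⟩ := exists_encard_lines_rootsB (le_refl n)
  exact ⟨w₀, h, D, hd.trans hD,
    (flats_two_encard (isPosFamily_rootsB n n) (arrangementB_eq n)).trans hD, hq⟩

end TypeB

end ReducedWords

/-! ### The dihedral groups. -/

namespace ReducedWords

open CoxeterSystem

open scoped Classical

section Dihedral

theorem exists_reducedWord {J G : Type*} [Group G] {s : J → G} {w : G} {l : List J}
    (hl : (l.map s).prod = w) : ∃ l' : List J, (l'.map s).prod = w ∧ l'.length = wordLength s w :=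
  Nat.sInf_mem (s := {k | ∃ l : List J, (l.map s).prod = w ∧ l.length = k}) ⟨_, l, hl, rfl⟩

theorem wordLength_le {J G : Type*} [Group G] {s : J → G} {w : G} {l : List J}
    (hl : (l.map s).prod = w) : wordLength s w ≤ l.length :=
  Nat.sInf_le ⟨l, hl, rfl⟩

theorem isChain_of_reduced {J G : Type*} [Group G] {s : J → G} (hs : ∀ j, s j * s j = 1)
    {l : List J} (hl : l.length = wordLength s (l.map s).prod) : l.IsChain (· ≠ ·) := by
  rw [List.isChain_iff_forall_rel_of_append_cons_cons]
  rintro i j u v rfl rfl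
  have := wordLength_le (s := s) (l := u ++ v) (w := ((u ++ i :: i :: v).map s).prod) (by
    simp [← mul_assoc (s i), hs])
  rw [← hl] at this
  simp at this

variable {m : ℕ}

theorem genI_sq (m : ℕ) (j : Fin 2) : genI m j * genI m j = 1 := by
  fin_cases j <;> simp [genI]

theorem orderOf_genI_mul (m : ℕ) {x y : Fin 2} (hxy : x ≠ y) :
    orderOf (genI m x * genI m y) = m := by
  have h : genI m 0 * genI m 1 = DihedralGroup.r 1 := by simp [genI]
  have h' : genI m 1 * genI m 0 = (DihedralGroup.r 1)⁻¹ := by simp [genI]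
  fin_cases x <;> fin_cases y
  · exact absurd rfl hxy
  · exact (congrArg orderOf h).trans DihedralGroup.orderOf_r_one
  · exact (congrArg orderOf h').trans ((orderOf_inv _).trans DihedralGroup.orderOf_r_one)
  · exact absurd rfl hxy

/-- The group element, as rotation or reflection, remembers the parity of the length of any word for
it. -/
theorem prod_genI (m : ℕ) (l : List (Fin 2)) : ∃ i,
    (l.map (genI m)).prod = if Even l.length then DihedralGroup.r i else DihedralGroup.sr i := by
  induction l with
  | nil => exact ⟨0, by simp⟩
  | cons j l ih =>
    obtain ⟨i, h⟩ := ih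
    obtain ⟨t, ht⟩ : ∃ t, genI m j = DihedralGroup.sr t := by
      fin_cases j
      · exact ⟨0, rfl⟩
      · exact ⟨1, rfl⟩
    rw [List.map_cons, List.prod_cons, h, ht, List.length_cons]
    by_cases he : Even l.length
    · exact ⟨t + i, by simp [he, Nat.even_add_one]⟩
    · exact ⟨i - t, by simp [he, Nat.even_add_one]⟩

theorem even_length_iff {l l' : List (Fin 2)}
    (h : (l.map (genI m)).prod = (l'.map (genI m)).prod) : Even l.length ↔ Even l'.length := by
  obtain ⟨i, hi⟩ := prod_genI m l
  obtain ⟨i', hi'⟩ := prod_genI m l'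
  rw [hi, hi'] at h
  by_cases h1 : Even l.length <;> by_cases h2 : Even l'.length <;> simp [h1, h2] at h ⊢

theorem prod_alternatingWord_comm (m : ℕ) {x y : Fin 2} (hxy : x ≠ y) :
    ((alternatingWord x y m).map (genI m)).prod = ((alternatingWord y x m).map (genI m)).prod := by
  rw [prod_alternatingWord_eq_iff (genI_sq m)]
  exact orderOf_dvd_iff_pow_eq_one.1 (orderOf_genI_mul m hxy).dvd

theorem eq_alternatingWord_of_reduced {l : List (Fin 2)}
    (hl : l.length = wordLength (genI m) (l.map (genI m)).prod) :
    ∃ x y, x ≠ y ∧ l = alternatingWord x y l.length := by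
  rcases eq_alternatingWord (x := 0) (y := 1) (fun j _ => by fin_cases j <;> simp)
    (isChain_of_reduced (genI_sq m) hl) with h | h
  · exact ⟨0, 1, by decide, h⟩
  · exact ⟨1, 0, by decide, h⟩

/-- Reduced words alternate, and an alternating word longer than `m` contains one of length `m + 1`,
which the braid relation shortens by two letters. -/
theorem length_le_of_reduced (hm : 2 ≤ m) {l : List (Fin 2)}
    (hl : l.length = wordLength (genI m) (l.map (genI m)).prod) : l.length ≤ m := by
  by_contra hlt
  obtain ⟨x, y, hxy, e⟩ := eq_alternatingWord_of_reduced hl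
  obtain ⟨p, hp⟩ := exists_prefix_alternatingWord x y (m := m + 1) (n := l.length) (by omega)
  obtain ⟨k, rfl⟩ : ∃ k, m = k + 1 := ⟨m - 1, by omega⟩
  have hlen := congrArg List.length hp
  rw [List.length_append, length_alternatingWord, length_alternatingWord] at hlen
  have h1 : ((alternatingWord x y (k + 1 + 1)).map (genI (k + 1))).prod =
      ((alternatingWord y x k).map (genI (k + 1))).prod := by
    rw [alternatingWord_succ', List.map_cons, List.prod_cons, prod_alternatingWord_comm _ hxy,
      alternatingWord_succ', List.map_cons, List.prod_cons, ← mul_assoc]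
    simp only [Nat.even_add_one]
    by_cases hk : Even k <;> simp [hk, genI_sq]
  have := wordLength_le (s := genI (k + 1)) (l := p ++ alternatingWord y x k)
    (w := (l.map (genI (k + 1))).prod) (by
      rw [e, hp, List.map_append, List.map_append, List.prod_append, List.prod_append, h1])
  rw [← hl, List.length_append, length_alternatingWord] at this
  omega

/-- Parity separates lengths of different parity; for equal parity, the products differ as powers of
the rotation with distinct exponents below its order `m`. -/
theorem prod_alternatingWord_ne {x y : Fin 2} (hxy : x ≠ y) {k k' : ℕ} (hk : k < k')
    (hk' : k' ≤ m) :
    ((alternatingWord x y k).map (genI m)).prod ≠ ((alternatingWord x y k').map (genI m)).prod := by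
  intro h
  have hev := even_length_iff h
  rw [length_alternatingWord, length_alternatingWord] at hev
  have hpow : ∀ a b, a < b → b < m →
      (genI m x * genI m y) ^ a ≠ (genI m x * genI m y) ^ b := fun a b hab hb e =>
    hab.ne (pow_injOn_Iio_orderOf (by rw [orderOf_genI_mul m hxy]; exact hab.trans hb)
      (by rw [orderOf_genI_mul m hxy]; exact hb) e)
  rcases Nat.even_or_odd' k with ⟨a, ha⟩
  rcases Nat.even_or_odd' k' with ⟨b, hb⟩
  rcases ha with rfl | rfl <;> rcases hb with rfl | rfl
  · rw [prod_alternatingWord_even, prod_alternatingWord_even] at h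
    exact hpow a b (by omega) (by omega) h
  · simp at hev
  · simp at hev
  · rw [prod_alternatingWord_odd, prod_alternatingWord_odd] at h
    exact hpow a b (by omega) (by omega) (mul_left_cancel h)

theorem wordLength_alternatingWord (hm : 2 ≤ m) {x y : Fin 2} (hxy : x ≠ y) :
    wordLength (genI m) ((alternatingWord x y m).map (genI m)).prod = m := by
  obtain ⟨l, hl, hlen⟩ := exists_reducedWord (s := genI m) (l := alternatingWord x y m) rfl
  rw [← hl] at hlen
  have hle := length_le_of_reduced hm hlen
  rw [← hl, ← hlen]
  by_contra hne
  obtain ⟨x', y', hxy', e⟩ := eq_alternatingWord_of_reduced hlen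
  -- A shorter reduced expression would again alternate. Since both alternating words of length `m`
  -- have the same product, the letters may be taken in the same order, and distinct lengths up to
  -- `m` give distinct products.
  refine prod_alternatingWord_ne (k := l.length) hxy' (lt_of_le_of_ne hle hne) le_rfl ?_
  rw [← e, hl]
  have hcases : (x' = x ∧ y' = y) ∨ (x' = y ∧ y' = x) := by
    clear * - hxy hxy'
    revert x y x' y'
    decide
  rcases hcases with ⟨rfl, rfl⟩ | ⟨rfl, rfl⟩
  · rfl
  · exact prod_alternatingWord_comm m hxy

/-- The longest element has exactly two reduced words, the two alternating ones of length `m`,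
joined by a single braid move; the graph is complete on two vertices. -/
theorem exists_longest_ediam_typeI (hm : 2 ≤ m) :
    ∃ w₀, (∀ w, IsLongest (genI m) w ↔ w = w₀) ∧ (wordGraph (genI m) w₀).ediam = 1 := by
  set w₀ := ((alternatingWord 0 1 m).map (genI m)).prod with hw₀
  have h01 : (0 : Fin 2) ≠ 1 := by decide
  have hlen₀ : wordLength (genI m) w₀ = m := wordLength_alternatingWord hm h01
  have hw₀' : w₀ = ((alternatingWord 1 0 m).map (genI m)).prod := prod_alternatingWord_comm m h01
  have hprod : ∀ l : List (Fin 2), l.length = wordLength (genI m) (l.map (genI m)).prod →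
      l.length = m → l = alternatingWord 0 1 m ∨ l = alternatingWord 1 0 m := by
    intro l hl e
    rw [← e]
    exact eq_alternatingWord (fun j _ => by fin_cases j <;> simp) (isChain_of_reduced (genI_sq m) hl)
  have hbound : ∀ v ∈ Subgroup.closure (Set.range (genI m)), ∃ l : List (Fin 2),
      (l.map (genI m)).prod = v ∧ l.length = wordLength (genI m) v ∧ l.length ≤ m := by
    intro v hv
    obtain ⟨l', hl'⟩ := exists_word_of_sq (genI_sq m) hv
    obtain ⟨l, rfl, hlen⟩ := exists_reducedWord hl'
    exact ⟨l, rfl, hlen, length_le_of_reduced hm hlen⟩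
  have hmem : w₀ ∈ Subgroup.closure (Set.range (genI m)) := IsRootFamily.prod_mem _ _
  refine ⟨w₀, fun w => ⟨fun ⟨hw, hmax⟩ => ?_, ?_⟩, ?_⟩
  · obtain ⟨l, rfl, h2, h3⟩ := hbound w hw
    have := hmax w₀ hmem
    rcases hprod l h2 (by omega) with rfl | rfl
    · rfl
    · exact hw₀'.symm
  · rintro rfl
    refine ⟨hmem, fun v hv => ?_⟩
    obtain ⟨l, -, h2, h3⟩ := hbound v hv
    omega
  · let a : ReducedWord (genI m) w₀ :=
      ⟨alternatingWord 0 1 m, hw₀.symm, by rw [hlen₀, length_alternatingWord]⟩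
    let b : ReducedWord (genI m) w₀ :=
      ⟨alternatingWord 1 0 m, hw₀'.symm, by rw [hlen₀, length_alternatingWord]⟩
    have hab : a ≠ b := by
      intro h
      have h' : alternatingWord (0 : Fin 2) 1 m = alternatingWord 1 0 m := congrArg Subtype.val h
      obtain ⟨k, rfl⟩ : ∃ k, m = k + 1 := ⟨m - 1, by omega⟩
      simp only [alternatingWord_succ, List.concat_eq_append] at h'
      have := (List.append_inj' h' rfl).2
      simp at this
    have hall : ∀ c : ReducedWord (genI m) w₀, c = a ∨ c = b := by
      rintro ⟨l, hl, hlen⟩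
      rcases hprod l (by rw [hl, hlen]) (hlen.trans hlen₀) with h | h
      · exact Or.inl (Subtype.ext h)
      · exact Or.inr (Subtype.ext h)
    have hbraid : BraidMove (genI m) a.1 b.1 :=
      ⟨0, 1, [], [], h01, by simp [a, orderOf_genI_mul m h01], by simp [b, orderOf_genI_mul m h01]⟩
    have htop : wordGraph (genI m) w₀ = ⊤ := by
      ext c d
      rw [SimpleGraph.top_adj, wordGraph, SimpleGraph.fromRel_adj]
      refine and_iff_left_of_imp fun hcd => ?_
      rcases hall c with rfl | rfl <;> rcases hall d with rfl | rfl
      · exact absurd rfl hcd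
      · exact Or.inl hbraid
      · exact Or.inr hbraid
      · exact absurd rfl hcd
    have : Nontrivial (ReducedWord (genI m) w₀) := ⟨a, b, hab⟩
    rw [htop, SimpleGraph.ediam_top]

theorem encard_flats_arrangementI (hm : 2 ≤ m) : (flats (arrangementI m) 2).encard = 1 := by
  rw [Set.encard_eq_one]
  refine ⟨⊥, Set.eq_singleton_iff_unique_mem.2 ⟨⟨⟨arrangementI m, subset_rfl, ?_⟩, ?_⟩, ?_⟩⟩
  · symm
    rw [eq_bot_iff]
    intro x hx
    rw [Submodule.mem_sInf] at hx
    -- The lines at angles `0` and `π/m` already meet only in the origin, because `sin (π/m) > 0`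
    -- for `m ≥ 2`.
    have h0 := hx _ ⟨0, by omega, rfl⟩
    have h1 := hx _ ⟨1, by omega, rfl⟩
    simp [coordKer] at h0 h1
    have hm' : (0 : ℝ) < m := by positivity
    have hsin : 0 < Real.sin (Real.pi / m) := by
      apply Real.sin_pos_of_pos_of_lt_pi
      · exact div_pos Real.pi_pos hm'
      · rw [div_lt_iff₀ hm']
        have : (2 : ℝ) ≤ m := by exact_mod_cast hm
        nlinarith [Real.pi_pos]
    rw [h0] at h1
    have h2 : x 0 = 0 := by simpa [hsin.ne'] using h1
    ext i
    fin_cases i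
    · exact h2
    · exact h0
  · have := Submodule.finrank_quotient_add_finrank (⊥ : Submodule ℝ (Fin 2 → ℝ))
    simpa using this
  · rintro X ⟨-, hX⟩
    have := Submodule.finrank_quotient_add_finrank X
    rw [hX, Module.finrank_fin_fun] at this
    exact Submodule.finrank_eq_zero.1 (by omega)

end Dihedral

end ReducedWords

theorem theorem1p1 :
    -- supersolvable arrangements
    (∀ (V : Type*) [AddCommGroup V] [Module ℝ V] [TopologicalSpace V] [IsTopologicalAddGroup V]
        [ContinuousSMul ℝ V] [T2Space V] [FiniteDimensional ℝ V]
        (A : Set (Submodule ℝ V)) (_ : IsEssentialArrangement A) (_ : IsSupersolvable A)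
        (X : Fin (Module.finrank ℝ V + 1) → Submodule ℝ V) (_ : IsModularFlag A X)
        (c₀ : Chamber A) (_ : ∀ i, c₀.IsIncident (X i)),
        (galleryGraph A c₀).ediam = (flats A 2).encard) ∧
    -- type `A_{n-1}`
    (∀ n : ℕ, 1 ≤ n → ∃ w₀, (∀ w, IsLongest (genA n) w ↔ w = w₀) ∧
      ∃ D : ℕ, (wordGraph (genA n) w₀).ediam = D ∧ (flats (arrangementA n) 2).encard = D ∧
        (D : ℚ) = 1 / 24 * n * (n - 1) * (n - 2) * (3 * n - 5)) ∧
    -- type `B_n`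
    (∀ n : ℕ, 1 ≤ n → ∃ w₀, (∀ w, IsLongest (genB n) w ↔ w = w₀) ∧
      ∃ D : ℕ, (wordGraph (genB n) w₀).ediam = D ∧ (flats (arrangementB n) 2).encard = D ∧
        (D : ℚ) = 1 / 6 * n * (n - 1) * (3 * n ^ 2 - 5 * n + 1)) ∧
    -- type `I_2(m)`
    (∀ m : ℕ, 2 ≤ m → ∃ w₀, (∀ w, IsLongest (genI m) w ↔ w = w₀) ∧
      (wordGraph (genI m) w₀).ediam = 1 ∧ (flats (arrangementI m) 2).encard = 1) := by
  refine ⟨?_, fun n _ => exists_diameter_typeA n, fun n _ => exists_diameter_typeB n, fun m hm => ?_⟩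
  · intro V _ _ _ _ _ _ _ A hA _ X hX c₀ hinc
    obtain ⟨f, hf⟩ := exists_isDefiningFamily hA c₀
    exact hf.ediam_galleryGraph (hf.hasModularChain hA hX hinc)
  · obtain ⟨w₀, h, hd⟩ := exists_longest_ediam_typeI hm
    exact ⟨w₀, h, hd, encard_flats_arrangementI hm⟩
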